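/- \textbf{Setting.} Let $c>1$, $0<2d<c-1$, $I_1=[-c-2d,-c+2d]$, $I_2=[-1,1]$. Let $(a(n,t),b(n,t))$, $n\in\mathbb Z$, $t\in\mathbb R$, be a real solution, bounded in $n$ locally uniformly in $t$, of the Toda lattice \[\dot b(n,t)=2\big(a(n,t)^2-a(n-1,t)^2\big),\qquad \dot a(n,t)=a(n,t)\big(b(n+1,t)-b(n,t)\big),\] with $a(n,0)>0$ and \[\sum_{n\le 0}e^{C|n|}\big(|a(n,0)-d|+|b(n,0)+c|\big)+\sum_{n\ge0}e^{Cn}\big(|a(n,0)-\tfrac12|+|b(n,0)|\big)<\infty\] for some $C\ge\max\{c+2d+\sqrt{(c+2d)^2-1},\ \tfrac1{2d}(1+c+\sqrt{(1+c)^2-4d^2})\}$. Let $(H(t)y)(n)=a(n-1,t)y(n-1)+b(n,t)y(n)+a(n,t)y(n+1)$. Let $\mathbb M$ be the compact Riemann surface of $w^2=(\lambda^2-1)((\lambda+c)^2-4d^2)$, $p=(\lambda,w)$, $p^*=(\lambda,-w)$. Here $\sqrt{\lambda^2-1}$ and $\sqrt{(\lambda+c)^2-4d^2}$ denote the branches holomorphic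 off $I_2$ resp. $I_1$ and asymptotic to $\lambda$ at infinity. The upper sheet $\Pi_U$ consists of the points with $\lambda\notin I_1\cup I_2$ and $w=-\sqrt{\lambda^2-1}\sqrt{(\lambda+c)^2-4d^2}$, together with $\infty_+$; the lower sheet is $\Pi_L=\{p^*: p\in\Pi_U\}$; $\Sigma_j$ is the closed curve over $I_j$, and $\Sigma=\Sigma_1\cup\Sigma_2$. For functions given on $\Pi_U$, values at points of $\Sigma$ are limits from $\Pi_U$. On $\Pi_U\cup\Sigma$ put $z_2=\lambda-\sqrt{\lambda^2-1}$ and $z_1=\frac1{2d}\big(\lambda+c-\sqrt{(\lambda+c)^2-4d^2}\big)$. Let $\psi_1,\psi_2$ be the Jost solutions, that is, $H(t)\psi_j=\lambda\psi_j$ with $z_1^{n}\psi_1(p,n,t)\to1$ as $n\to-\infty$ and $z_2^{-n}\psi_2(p,n,t)\to1$ as $n\to+\infty$, and let \[W(p,t)=a(n-1,t)\big(\psi_1(p,n-1,t)\psi_2(p,n,t)-\psi_1(p,n,t)\psi_2(p,n-1,t)\big),\] \[T_2=-\sqrt{\lambda^2-1}/W,\qquad T_1=-\sqrt{(\lambda+c)^2-4d^2}/W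 .\] Let $R_j(p,t)$, $p\in\Sigma_j$, be given by $T_2\psi_1=\overline{\psi_2}+R_2\psi_2$ on $\Sigma_2$ and $T_1\psi_2=\overline{\psi_1}+R_1\psi_1$ on $\Sigma_1$. Write $R_j(p)=R_j(p,0)$ and $\chi(p)=-\lim_{p'\in\Pi_U\to p}T_1(p',0)\overline{T_2(p',0)}$, $p\in\Sigma$. For $t\neq0$ and $\xi=n/t$ let, on $\Pi_U$, \[\Phi_1=d(z_1^{-1}-z_1)-\xi\log z_1,\qquad \Phi_2=\tfrac12(z_2-z_2^{-1})+\xi\log z_2,\] continued to $\Pi_L$ by $\Phi_j(p^*)=-\Phi_j(p)$. Subscripts $\pm$ denote limits at $p\in\Sigma$ from $\Pi_U$ and $\Pi_L$, respectively; $e^{t\Phi_{j,\pm}}$ is the limit of $e^{t\Phi_j}$, which does not depend on the branch of the logarithm. Let, on $\Pi_U$, \[m_2(p,n,t)=(T_2\psi_1z_2^n,\ \psi_2z_2^{-n}),\qquad m_1(p,n,t)=(T_1\psi_2z_1^{-n},\ \psi_1z_1^{n}),\] extended to $\Pi_L$ by $m_j(p^*)=m_j(p)\begin{pmatrix}0&1\\1&0\end{pmatrix}$.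 \textbf{Theorem.} Assume that $H(0)$ has no discrete spectrum, that is, no eigenvalues outside $I_1\cup I_2$, and that $W(p,0)\ne0$ at the four points with $\lambda\in\{-c-2d,-c+2d,-1,1\}$. Then, for every $t\in\mathbb R$, the Jost solutions exist on $\Pi_U\cup\Sigma$, the $T_j$ are holomorphic on $\Pi_U$ at finite $\lambda$ and continuous up to $\Sigma$, and there are $R_j$ satisfying the scattering relations on all of $\Sigma_j$. For all $n\in\mathbb Z$, $t\ne0$ and $j=1,2$ the function $m_j(\cdot,n,t)$ is holomorphic on $\mathbb M\setminus\Sigma$, and it satisfies: I. the limits $m_{j,\pm}(p)$ exist at every $p\in\Sigma$ and $m_{j,+}=m_{j,-}v_j$, where \[v_2=\begin{cases}\begin{pmatrix}0&-\overline{R_2}\,e^{-2t\Phi_2}\\R_2\,e^{2t\Phi_2}&1\end{pmatrix},&p\in\Sigma_2,\\[4mm]\begin{pmatrix}\chi\, e^{t(\Phi_{2,+}-\Phi_{2,-})}&e^{-t(\Phi_{2,+}+\Phi_{2,-})}\\e^{t(\Phi_{2,+}+\Phi_{2,-})}&0\end{pmatrix},&p\in\Sigma_1,\end{cases}\] \[v_1=\begin{cases}\begin{pmatrix}0&-\overline{R_1}\,e^{-2t\Phi_1}\\R_1\,e^{2t\Phi_1}&1\end{pmatrix},&p\in\Sigma_1,\\[4mm]\begin{pmatrix}\overline\chi\,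 e^{t(\Phi_{1,+}-\Phi_{1,-})}&e^{-t(\Phi_{1,+}+\Phi_{1,-})}\\e^{t(\Phi_{1,+}+\Phi_{1,-})}&0\end{pmatrix},&p\in\Sigma_2;\end{cases}\] II. $m_j(p^*)=m_j(p)\begin{pmatrix}0&1\\1&0\end{pmatrix}$ for $p\in\mathbb M\setminus\Sigma$; III. $\lim_{p\in\Pi_U\to\infty_+}m_j(p)=(\hat m_j,\tilde m_j)$ with $\hat m_j\tilde m_j=1$ and $\hat m_j>0$. -/

import Mathlib

open Filter Topology

namespace TodaShock

noncomputable section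

/-! ### The two-sheeted surface -/

/-- The branch of `√((lam - α)(lam - β))` which is holomorphic off the segment `[α, β]` and behaves
like `lam` at infinity. -/
def bandRoot (α β lam : ℂ) : ℂ := (lam - α) * ((lam - β) / (lam - α)) ^ (1 / 2 : ℂ)

theorem bandRoot_sq (α β lam : ℂ) : bandRoot α β lam ^ 2 = (lam - α) * (lam - β) := by
  unfold bandRoot
  have h : (((lam - β) / (lam - α)) ^ (1 / 2 : ℂ)) ^ 2 = (lam - β) / (lam - α) := by
    simp
  rw [mul_pow, h]
  by_cases h0 : lam - α = 0
  · simp [h0]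
  · field_simp

/-- `I₁ = [-c - 2d, -c + 2d]`, as a subset of `ℂ`. -/
def I1 (c d : ℝ) : Set ℂ := (fun x : ℝ => (x : ℂ)) '' Set.Icc (-c - 2 * d) (-c + 2 * d)

/-- `I₂ = [-1, 1]`, as a subset of `ℂ`. -/
def I2 : Set ℂ := (fun x : ℝ => (x : ℂ)) '' Set.Icc (-1) 1

/-- `I₁ ∪ I₂`. -/
def bands (c d : ℝ) : Set ℂ := I1 c d ∪ I2

/-- `√((lam + c)² - 4d²)`, holomorphic off `I₁`. -/
def root1 (c d : ℝ) (lam : ℂ) : ℂ := bandRoot (-c - 2 * d) (-c + 2 * d) lam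

/-- `√(lam² - 1)`, holomorphic off `I₂`. -/
def root2 (lam : ℂ) : ℂ := bandRoot (-1) 1 lam

/-- `R^{1/2}(lam) = -√((lam² - 1)((lam + c)² - 4d²))`, holomorphic off `I₁ ∪ I₂`. -/
def Rhalf (c d : ℝ) (lam : ℂ) : ℂ := -(root2 lam * root1 c d lam)

/-- The finite part of the surface `𝕄`: the curve `w² = (lam² - 1)((lam + c)² - 4d²)` in `ℂ × ℂ`.
A point is `p = (lam, w)`; the topology is the subspace topology, so that `(lam + i0, +)` and
`(lam - i0, -)` are the same point for `lam ∈ I₁ ∪ I₂`. -/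
abbrev Curve (c d : ℝ) : Type :=
  {p : ℂ × ℂ // p.2 ^ 2 = (p.1 ^ 2 - 1) * ((p.1 + c) ^ 2 - 4 * (d : ℂ) ^ 2)}

variable {c d : ℝ}

/-- The projection `π(p) = lam`. -/
def Curve.lam (p : Curve c d) : ℂ := p.1.1

/-- The second coordinate `w`. -/
def Curve.w (p : Curve c d) : ℂ := p.1.2

/-- The sheet exchange map `p ↦ p*`. -/
def Curve.star (p : Curve c d) : Curve c d := ⟨(p.1.1, -p.1.2), by simpa using p.2⟩

/-- The point `(lam, +)`. -/
def upperPt (c d : ℝ) (lam : ℂ) : Curve c d :=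
  ⟨(lam, Rhalf c d lam), by
    simp only [Rhalf, root1, root2, neg_sq, mul_pow, bandRoot_sq]
    ring⟩

/-- The upper sheet `Π_U` (without `∞₊`). -/
def PiU (c d : ℝ) : Set (Curve c d) := {p | p.lam ∉ bands c d ∧ p.w = Rhalf c d p.lam}

/-- The lower sheet `Π_L` (without `∞₋`). -/
def PiL (c d : ℝ) : Set (Curve c d) := {p | p.lam ∉ bands c d ∧ p.w = -Rhalf c d p.lam}

/-- The contour `Σ₁` over `I₁`. -/
def Sigma1 (c d : ℝ) : Set (Curve c d) := {p | p.lam ∈ I1 c d}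

/-- The contour `Σ₂` over `I₂`. -/
def Sigma2 (c d : ℝ) : Set (Curve c d) := {p | p.lam ∈ I2}

/-- `Σ = Σ₁ ∪ Σ₂`. -/
def Sig (c d : ℝ) : Set (Curve c d) := Sigma1 c d ∪ Sigma2 c d

/-- `clos Π_U = Π_U ∪ Σ`. -/
def closU (c d : ℝ) : Set (Curve c d) := PiU c d ∪ Sig c d

/-- The filter of `p ∈ Π_U`, `p → ∞₊`. -/
def atInfPlus (c d : ℝ) : Filter (Curve c d) :=
  comap Curve.lam (Bornology.cobounded ℂ) ⊓ 𝓟 (PiU c d)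

open Classical in
/-- A function of `lam` regarded as a function on `clos Π_U`: its value at `p ∈ Π_U` is `f lam`, its
value at `p ∈ Σ` is the limit from within `Π_U`. -/
def onClosU (f : ℂ → ℂ) (p : Curve c d) : ℂ :=
  if p ∈ PiU c d then f p.lam else limUnder (𝓝[PiU c d] p) (fun q => f q.lam)

/-- `√((lam + c)² - 4d²)` on `clos Π_U`. -/
def s1 (p : Curve c d) : ℂ := onClosU (root1 c d) p

/-- `√(lam² - 1)` on `clos Π_U`. -/
def s2 (p : Curve c d) : ℂ := onClosU root2 p

/-- The Joukovski variable `z₁` on `clos Π_U`. -/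
def z1 (p : Curve c d) : ℂ := (p.lam + c - s1 p) / (2 * d)

/-- The Joukovski variable `z₂` on `clos Π_U`. -/
def z2 (p : Curve c d) : ℂ := p.lam - s2 p

/-! ### Jacobi operators, Jost solutions and scattering data -/

/-- `ψ` solves `a(n-1)ψ(n-1) + b(n)ψ(n) + a(n)ψ(n+1) = lam ψ(n)`. -/
def IsJacobiSolution (a b : ℤ → ℝ) (lam : ℂ) (ψ : ℤ → ℂ) : Prop :=
  ∀ n : ℤ, (a (n - 1) : ℂ) * ψ (n - 1) + (b n : ℂ) * ψ n + (a n : ℂ) * ψ (n + 1) = lam * ψ n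

/-- The discrete spectrum of the Jacobi operator in `ℓ²(ℤ)`: its eigenvalues outside
`I₁ ∪ I₂`. -/
def discreteSpectrum (c d : ℝ) (a b : ℤ → ℝ) : Set ℝ :=
  {E | (E : ℂ) ∉ bands c d ∧
    ∃ y : ℤ → ℂ, y ≠ 0 ∧ Memℓp y 2 ∧ IsJacobiSolution a b (E : ℂ) y}

/-- `ψ` is the left Jost solution at `p`: `z₁ⁿ ψ(n) → 1` as `n → -∞`. -/
def IsJost1 (a b : ℤ → ℝ) (p : Curve c d) (ψ : ℤ → ℂ) : Prop :=
  IsJacobiSolution a b p.lam ψ ∧ Tendsto (fun n : ℤ => z1 p ^ n * ψ n) atBot (𝓝 1)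

/-- `ψ` is the right Jost solution at `p`: `z₂⁻ⁿ ψ(n) → 1` as `n → +∞`. -/
def IsJost2 (a b : ℤ → ℝ) (p : Curve c d) (ψ : ℤ → ℂ) : Prop :=
  IsJacobiSolution a b p.lam ψ ∧ Tendsto (fun n : ℤ => z2 p ^ (-n) * ψ n) atTop (𝓝 1)

/-- The left Jost solution `ψ₁(p, ·)`. -/
def jost1 (a b : ℤ → ℝ) (p : Curve c d) : ℤ → ℂ := Classical.epsilon (IsJost1 a b p)

/-- The right Jost solution `ψ₂(p, ·)`. -/
def jost2 (a b : ℤ → ℝ) (p : Curve c d) : ℤ → ℂ := Classical.epsilon (IsJost2 a b p)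

/-- `W(p) = a(n-1)(ψ₁(n-1)ψ₂(n) - ψ₁(n)ψ₂(n-1))`, which does not depend on `n`; here `n = 0`. -/
def wronskian (a b : ℤ → ℝ) (p : Curve c d) : ℂ :=
  (a (-1) : ℂ) * (jost1 a b p (-1) * jost2 a b p 0 - jost1 a b p 0 * jost2 a b p (-1))

/-- The left transmission coefficient on `clos Π_U`. -/
def T1 (a b : ℤ → ℝ) (p : Curve c d) : ℂ := -s1 p / wronskian a b p

/-- The right transmission coefficient on `clos Π_U`. -/
def T2 (a b : ℤ → ℝ) (p : Curve c d) : ℂ := -s2 p / wronskian a b p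

/-- The left reflection coefficient on `Σ₁`, given by the scattering relation
`T₁ψ₂ = conj ψ₁ + R₁ψ₁`. -/
def R1 (a b : ℤ → ℝ) (p : Curve c d) : ℂ :=
  Classical.epsilon fun r : ℂ =>
    ∀ n : ℤ, T1 a b p * jost2 a b p n = starRingEnd ℂ (jost1 a b p n) + r * jost1 a b p n

/-- The right reflection coefficient on `Σ₂`, given by the scattering relation
`T₂ψ₁ = conj ψ₂ + R₂ψ₂`. -/
def R2 (a b : ℤ → ℝ) (p : Curve c d) : ℂ :=
  Classical.epsilon fun r : ℂ =>
    ∀ n : ℤ, T2 a b p * jost1 a b p n = starRingEnd ℂ (jost2 a b p n) + r * jost2 a b p n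

/-- `χ(p) = -lim T₁(p') conj (T₂(p'))` as `p' ∈ Π_U` tends to `p ∈ Σ`. -/
def chi (a b : ℤ → ℝ) (p : Curve c d) : ℂ :=
  -limUnder (𝓝[PiU c d] p) (fun q => T1 a b q * starRingEnd ℂ (T2 a b q))

/-- The functions `ψ_j`, `T_j`, `R_j` are the Jost solutions, the transmission and the reflection
coefficients of the Jacobi operator with coefficients `a`, `b`: the Jost solutions exist on
`clos Π_U` and are normalized as required, and the coefficients are the ones of the scattering
relations on `Σ_j`, the `T_j` being continued holomorphically to `Π_U`. -/
structure IsScatteringData (a b : ℤ → ℝ) (ψ₁ ψ₂ : Curve c d → ℤ → ℂ)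
    (τ₁ τ₂ ρ₁ ρ₂ : Curve c d → ℂ) : Prop where
  jost_left : ∀ p ∈ closU c d, IsJost1 a b p (ψ₁ p)
  jost_right : ∀ p ∈ closU c d, IsJost2 a b p (ψ₂ p)
  left_relation : ∀ p ∈ Sigma1 c d, ∀ n : ℤ,
    τ₁ p * ψ₂ p n = starRingEnd ℂ (ψ₁ p n) + ρ₁ p * ψ₁ p n
  right_relation : ∀ p ∈ Sigma2 c d, ∀ n : ℤ,
    τ₂ p * ψ₁ p n = starRingEnd ℂ (ψ₂ p n) + ρ₂ p * ψ₂ p n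
  left_holomorphic : DifferentiableOn ℂ (fun lam => τ₁ (upperPt c d lam)) (bands c d)ᶜ
  right_holomorphic : DifferentiableOn ℂ (fun lam => τ₂ (upperPt c d lam)) (bands c d)ᶜ
  left_boundary : ∀ p ∈ Sig c d, Tendsto τ₁ (𝓝[PiU c d] p) (𝓝 (τ₁ p))
  right_boundary : ∀ p ∈ Sig c d, Tendsto τ₂ (𝓝[PiU c d] p) (𝓝 (τ₂ p))

/-! ### The vector functions and the Riemann-Hilbert problems -/

open Classical in
/-- Extension of a vector function from `Π_U` to `Π_L` by `m(p*) = m(p) (0 1; 1 0)`. -/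
def extendSym (f : Curve c d → Fin 2 → ℂ) (p : Curve c d) : Fin 2 → ℂ :=
  if p ∈ PiU c d then f p else ![f p.star 1, f p.star 0]

/-- `m₁ = (T₁ψ₂z₁⁻ⁿ, ψ₁z₁ⁿ)` on `Π_U`, extended by symmetry. -/
def m1 (a b : ℤ → ℝ) (n : ℤ) : Curve c d → Fin 2 → ℂ :=
  extendSym fun p => ![T1 a b p * jost2 a b p n * z1 p ^ (-n), jost1 a b p n * z1 p ^ n]

/-- `m₂ = (T₂ψ₁z₂ⁿ, ψ₂z₂⁻ⁿ)` on `Π_U`, extended by symmetry. -/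
def m2 (a b : ℤ → ℝ) (n : ℤ) : Curve c d → Fin 2 → ℂ :=
  extendSym fun p => ![T2 a b p * jost1 a b p n * z2 p ^ n, jost2 a b p n * z2 p ^ (-n)]

open Classical in
/-- Extension of a scalar function from `Π_U` to `Π_L` as an odd function, `f(p*) = -f(p)`. -/
def extendOdd (f : Curve c d → ℂ) (p : Curve c d) : ℂ :=
  if p ∈ PiU c d then f p else -f p.star

/-- The phase `Φ₁ = d(z₁⁻¹ - z₁) - ξ log z₁` on `Π_U`, continued to `Π_L` as an odd function. -/
def Phi1 (ξ : ℝ) : Curve c d → ℂ :=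
  extendOdd fun p => d * ((z1 p)⁻¹ - z1 p) - ξ * Complex.log (z1 p)

/-- The phase `Φ₂ = (z₂ - z₂⁻¹)/2 + ξ log z₂` on `Π_U`, continued to `Π_L` as an odd function. -/
def Phi2 (ξ : ℝ) : Curve c d → ℂ :=
  extendOdd fun p => (z2 p - (z2 p)⁻¹) / 2 + ξ * Complex.log (z2 p)

/-- `e^{tΦ₊(p)}`: the boundary value of `e^{tΦ}` at `p ∈ Σ` from `Π_U`. With `ξ = n/t` the function
`e^{tΦ_j}` does not depend on the branch of the logarithm and has such limits on all of `Σ`, also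
at the branch points. -/
def expPlus (t : ℝ) (Φ : Curve c d → ℂ) (p : Curve c d) : ℂ :=
  limUnder (𝓝[PiU c d] p) (fun q => Complex.exp (t * Φ q))

/-- `e^{tΦ₋(p)}`: the boundary value of `e^{tΦ}` at `p ∈ Σ` from `Π_L`. -/
def expMinus (t : ℝ) (Φ : Curve c d → ℂ) (p : Curve c d) : ℂ :=
  limUnder (𝓝[PiL c d] p) (fun q => Complex.exp (t * Φ q))

/-- The jump matrix on the contour `Σ_j` for the problem with index `j`:
`(0, -conj R e^{-2tΦ}; R e^{2tΦ}, 1)`. -/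
def jumpOwn (R Ep : ℂ) : Matrix (Fin 2) (Fin 2) ℂ :=
  !![0, -starRingEnd ℂ R * (Ep ^ 2)⁻¹; R * Ep ^ 2, 1]

/-- The jump matrix on the other contour:
`(X e^{t(Φ₊ - Φ₋)}, e^{-t(Φ₊ + Φ₋)}; e^{t(Φ₊ + Φ₋)}, 0)`. -/
def jumpOther (X Ep Em : ℂ) : Matrix (Fin 2) (Fin 2) ℂ :=
  !![X * (Ep / Em), (Ep * Em)⁻¹; Ep * Em, 0]

open Classical in
/-- The jump matrix `v₁` built from the scattering data of the initial data `a₀`, `b₀`. -/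
def v1 (a₀ b₀ : ℤ → ℝ) (n : ℤ) (t : ℝ) (p : Curve c d) : Matrix (Fin 2) (Fin 2) ℂ :=
  if p ∈ Sigma1 c d then jumpOwn (R1 a₀ b₀ p) (expPlus t (Phi1 (n / t)) p)
  else jumpOther (starRingEnd ℂ (chi a₀ b₀ p))
    (expPlus t (Phi1 (n / t)) p) (expMinus t (Phi1 (n / t)) p)

open Classical in
/-- The jump matrix `v₂` built from the scattering data of the initial data `a₀`, `b₀`. -/
def v2 (a₀ b₀ : ℤ → ℝ) (n : ℤ) (t : ℝ) (p : Curve c d) : Matrix (Fin 2) (Fin 2) ℂ :=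
  if p ∈ Sigma2 c d then jumpOwn (R2 a₀ b₀ p) (expPlus t (Phi2 (n / t)) p)
  else jumpOther (chi a₀ b₀ p)
    (expPlus t (Phi2 (n / t)) p) (expMinus t (Phi2 (n / t)) p)

/-- `m` solves the vector Riemann-Hilbert problem on `𝕄` with jump matrix `v` on `Σ`. Holomorphy on
the two sheets is expressed in the local coordinate `lam`; at `∞₊` and `∞₋` it amounts to the
existence of the limits, which is part of the normalization and the symmetry condition. -/
structure SolvesRHP (v : Curve c d → Matrix (Fin 2) (Fin 2) ℂ)
    (m : Curve c d → Fin 2 → ℂ) : Prop where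
  holomorphic_upper : DifferentiableOn ℂ (fun lam => m (upperPt c d lam)) (bands c d)ᶜ
  holomorphic_lower : DifferentiableOn ℂ (fun lam => m (upperPt c d lam).star) (bands c d)ᶜ
  jump : ∀ p ∈ Sig c d, ∃ mp mm : Fin 2 → ℂ,
    Tendsto m (𝓝[PiU c d] p) (𝓝 mp) ∧ Tendsto m (𝓝[PiL c d] p) (𝓝 mm) ∧
      mp = Matrix.vecMul mm (v p)
  symmetry : ∀ p ∈ PiU c d ∪ PiL c d, m p.star = Matrix.vecMul (m p) !![0, 1; 1, 0]
  normalization : ∃ mhat mtilde : ℝ, Tendsto m (atInfPlus c d) (𝓝 ![(mhat : ℂ), (mtilde : ℂ)]) ∧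
    mhat * mtilde = 1 ∧ 0 < mhat

/-! ### The Cauchy problem for the Toda lattice -/

/-- Solutions of the Toda lattice on `ℤ × ℝ`, bounded in `n` locally uniformly in `t` (the class in
which the Cauchy problem is uniquely solvable). -/
structure IsTodaSolution (a b : ℤ → ℝ → ℝ) : Prop where
  b_eq : ∀ n t, HasDerivAt (b n) (2 * (a n t ^ 2 - a (n - 1) t ^ 2)) t
  a_eq : ∀ n t, HasDerivAt (a n) (a n t * (b (n + 1) t - b n t)) t
  bounded : ∀ τ : ℝ, ∃ M : ℝ, ∀ n t, |t| ≤ τ → |a n t| ≤ M ∧ |b n t| ≤ M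

/-- Initial data decaying exponentially fast, with rate `C`, to the left background `(d, -c)` and
the right background `(1/2, 0)`. -/
structure SteplikeDecay (c d C : ℝ) (a₀ b₀ : ℤ → ℝ) : Prop where
  left : Summable fun n : ℕ => Real.exp (C * n) * (|a₀ (-(n : ℤ)) - d| + |b₀ (-(n : ℤ)) + c|)
  right : Summable fun n : ℕ => Real.exp (C * n) * (|a₀ (n : ℤ) - 1 / 2| + |b₀ (n : ℤ)|)

/-- The Wronskian of the Jost solutions does not vanish at the edges of the spectrum. -/
def NonResonant (c d : ℝ) (a₀ b₀ : ℤ → ℝ) : Prop :=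
  ∀ p : Curve c d, (p.lam = -c - 2 * d ∨ p.lam = -c + 2 * d ∨ p.lam = -1 ∨ p.lam = 1) →
    wronskian a₀ b₀ p ≠ 0

end

end TodaShock

/-!
Solutions of the Jacobi equation of the form `zⁿ F(z, n)` are built from either end of the
lattice: `F` is the limit of the functions obtained by freezing the coefficients at their
background values beyond the site `N` and solving the recursion downwards from there. The
exponential decay makes this limit locally uniform in `‖z‖ ≤ 1`, `n` and `t`, so `F` is continuous
up to the cuts, holomorphic inside, and positive at `z = 0`. The Toda equations turn into a linear
evolution of the truncated solutions with an error which vanishes in the limit. Hence the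
Wronskian, the transmission and the reflection coefficients evolve by explicit exponentials, which
together with `zⁿ` are the exponentials of the phases.

On the cut of an end its root and Joukowski variable satisfy `conj s = -s` and `conj z = z⁻¹`,
while those of the other end are real. The constancy of Wronskians then gives the scattering
relations, and also that the Wronskian of the Jost solutions can vanish on a cut only at a branch
point. Off the cuts a zero would be an eigenvalue. Both jump conditions are the scattering
relations, read on the cut of the end in question and on the cut of the other end, respectively.
Exchanging the ends by a reflection of the lattice which reverses time reduces all statements to
one end.
-/

namespace TodaShock

noncomputable section

/-! ### Normalized Jost functions -/

section JostFunction

/-- Coefficients `a`, `b` exponentially close to the constants `A`, `B` at `+∞`, with `a` bounded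
below by `m > 0`; the constants are explicit because the estimates are later used uniformly in
time. The rate is `ρ²` so that the error still decays after division by the weight `ρⁿ` of
`weightedSize`. -/
structure HasBackground (A B m Q ρ : ℝ) (a b : ℤ → ℝ) : Prop where
  m_pos : 0 < m
  Q_nonneg : 0 ≤ Q
  rho_pos : 0 < ρ
  rho_lt : ρ < 1
  le_a : ∀ n, m ≤ a n
  a_sub : ∀ n, |a n - A| ≤ Q * (ρ ^ n) ^ 2
  b_sub : ∀ n, |b n - B| ≤ Q * (ρ ^ n) ^ 2

/-- The equation at site `n` satisfied by `F n = z⁻ⁿ ψ n` when `ψ` solves the Jacobi equation with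
`lam = B + A (z + z⁻¹)`. Unlike the latter, it makes sense at `z = 0`. -/
def NormalizedEq (A B : ℝ) (a b : ℤ → ℝ) (z : ℂ) (F : ℤ → ℂ) (n : ℤ) : Prop :=
  (a (n - 1) : ℂ) * F (n - 1) =
    (A * (1 + z ^ 2) - (b n - B) * z) * F n - a n * z ^ 2 * F (n + 1)

/-- The deviation of the coefficients of `NormalizedEq` at site `n` from those of the constant
background, applied to a constant function `F`. -/
def perturbation (A B : ℝ) (a b : ℤ → ℝ) (z : ℂ) (n : ℤ) : ℂ :=
  ((a (n - 1) - A : ℝ) : ℂ) + z ^ 2 * ((a n - A : ℝ) : ℂ) + ((b n - B : ℝ) : ℂ) * z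

/-- The discrete derivative of `F`, weighted by `a`. -/
def flux (a : ℤ → ℝ) (F : ℤ → ℂ) (n : ℤ) : ℂ := a n * (F (n + 1) - F n)

/-- The size of the Cauchy data of `F` at site `n`. The weight of the flux makes the constant in
the one-step estimate `HasBackground.weightedSize_pred_le` summable. -/
def weightedSize (ρ : ℝ) (a : ℤ → ℝ) (F : ℤ → ℂ) (n : ℤ) : ℝ :=
  ‖F n‖ + (ρ ^ n)⁻¹ * ‖flux a F n‖

/-- The constant in the bound for `perturbation`. -/
def pertConst (Q ρ : ℝ) : ℝ := 3 * Q / ρ ^ 2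

/-- The constant in the one-step estimate for `weightedSize`. -/
def stepConst (m Q ρ : ℝ) : ℝ := pertConst Q ρ + 1 / (m * ρ)

/-- The constant in the stability estimate for `weightedSize`: twice the sum of
`stepConst m Q ρ * ρ ^ k` over `k > 0`. -/
def stabConst (m Q ρ : ℝ) : ℝ := 2 * stepConst m Q ρ * ρ / (1 - ρ)

variable {A B m Q ρ : ℝ} {a b : ℤ → ℝ} {z : ℂ} {F G : ℤ → ℂ} {n : ℤ}

theorem NormalizedEq.sub (hF : NormalizedEq A B a b z F n) (hG : NormalizedEq A B a b z G n) :
    NormalizedEq A B a b z (fun k => F k - G k) n := by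
  unfold NormalizedEq at *
  linear_combination hF - hG

theorem NormalizedEq.flux_pred (hF : NormalizedEq A B a b z F n) :
    flux a F (n - 1) = z ^ 2 * flux a F n + perturbation A B a b z n * F n := by
  simp only [NormalizedEq, flux, perturbation, sub_add_cancel] at *
  push_cast
  linear_combination -hF

theorem norm_le_weightedSize (hρ : 0 < ρ) (a : ℤ → ℝ) (F : ℤ → ℂ) (n : ℤ) :
    ‖F n‖ ≤ weightedSize ρ a F n :=
  le_add_of_nonneg_right (by positivity)

theorem weightedSize_nonneg (hρ : 0 < ρ) (a : ℤ → ℝ) (F : ℤ → ℂ) (n : ℤ) :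
    0 ≤ weightedSize ρ a F n :=
  (norm_nonneg _).trans (norm_le_weightedSize hρ a F n)

namespace HasBackground

theorem a_pos (h : HasBackground A B m Q ρ a b) (n : ℤ) : 0 < a n := h.m_pos.trans_le (h.le_a n)

theorem a_ne (h : HasBackground A B m Q ρ a b) (n : ℤ) : (a n : ℂ) ≠ 0 := by
  exact_mod_cast (h.a_pos n).ne'

theorem pertConst_nonneg (h : HasBackground A B m Q ρ a b) : 0 ≤ pertConst Q ρ := by
  have := h.Q_nonneg
  unfold pertConst; positivity

theorem stepConst_nonneg (h : HasBackground A B m Q ρ a b) : 0 ≤ stepConst m Q ρ := by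
  have := h.m_pos; have := h.pertConst_nonneg; have := h.rho_pos
  unfold stepConst; positivity

theorem stabConst_nonneg (h : HasBackground A B m Q ρ a b) : 0 ≤ stabConst m Q ρ := by
  have := h.stepConst_nonneg; have := h.rho_pos; have := sub_pos.2 h.rho_lt
  unfold stabConst; positivity

theorem norm_perturbation_le (h : HasBackground A B m Q ρ a b) (hz : ‖z‖ ≤ 1) (n : ℤ) :
    ‖perturbation A B a b z n‖ ≤ pertConst Q ρ * (ρ ^ n) ^ 2 := by
  have hρ := h.rho_pos
  have h_pred : (ρ ^ (n - 1)) ^ 2 = (ρ ^ n) ^ 2 / ρ ^ 2 := by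
    rw [zpow_sub_one₀ hρ.ne']; field_simp
  have h_le : Q * (ρ ^ n) ^ 2 ≤ Q * ((ρ ^ n) ^ 2 / ρ ^ 2) := by
    refine mul_le_mul_of_nonneg_left ?_ h.Q_nonneg
    rw [le_div_iff₀ (by positivity)]
    exact mul_le_of_le_one_right (by positivity) (pow_le_one₀ hρ.le h.rho_lt.le)
  have h_first : ‖((a (n - 1) - A : ℝ) : ℂ)‖ ≤ Q * ((ρ ^ n) ^ 2 / ρ ^ 2) := by
    rw [Complex.norm_real, ← h_pred]; exact h.a_sub (n - 1)
  have h_second : ‖z ^ 2 * ((a n - A : ℝ) : ℂ)‖ ≤ Q * ((ρ ^ n) ^ 2 / ρ ^ 2) := by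
    rw [norm_mul, norm_pow, Complex.norm_real]
    exact (mul_le_of_le_one_left (norm_nonneg _) (pow_le_one₀ (norm_nonneg _) hz)).trans
      ((h.a_sub n).trans h_le)
  have h_third : ‖((b n - B : ℝ) : ℂ) * z‖ ≤ Q * ((ρ ^ n) ^ 2 / ρ ^ 2) := by
    rw [norm_mul, Complex.norm_real]
    exact (mul_le_of_le_one_right (norm_nonneg _) hz).trans ((h.b_sub n).trans h_le)
  calc ‖perturbation A B a b z n‖
      ≤ _ := norm_add₃_le
    _ ≤ _ := add_le_add_three h_first h_second h_third
    _ = pertConst Q ρ * (ρ ^ n) ^ 2 := by rw [pertConst]; ring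

theorem norm_le_norm_mul_div (h : HasBackground A B m Q ρ a b) (n : ℤ) (x : ℂ) :
    ‖x‖ ≤ ‖(a n : ℂ) * x‖ / m := by
  rw [le_div_iff₀ h.m_pos, norm_mul, Complex.norm_real, Real.norm_of_nonneg (h.a_pos n).le,
    mul_comm]
  exact mul_le_mul_of_nonneg_right (h.le_a n) (norm_nonneg _)

theorem weighted_flux_pred_le (h : HasBackground A B m Q ρ a b) (hz : ‖z‖ ≤ 1)
    (hF : NormalizedEq A B a b z F n) :
    (ρ ^ (n - 1))⁻¹ * ‖flux a F (n - 1)‖ ≤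
      (ρ ^ n)⁻¹ * ‖flux a F n‖ + stepConst m Q ρ * ρ ^ n * ‖F n‖ := by
  have hρ := h.rho_pos
  have hm := h.m_pos
  have h_flux : ‖flux a F (n - 1)‖ ≤ ‖flux a F n‖ + pertConst Q ρ * (ρ ^ n) ^ 2 * ‖F n‖ := by
    rw [hF.flux_pred]
    refine (norm_add_le _ _).trans (add_le_add ?_ ?_)
    · rw [norm_mul, norm_pow]
      exact mul_le_of_le_one_left (norm_nonneg _) (pow_le_one₀ (norm_nonneg _) hz)
    · rw [norm_mul]
      exact mul_le_mul_of_nonneg_right (h.norm_perturbation_le hz n) (norm_nonneg _)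
  have h_weight : (ρ ^ (n - 1))⁻¹ ≤ (ρ ^ n)⁻¹ := by
    rw [zpow_sub_one₀ hρ.ne', mul_inv, inv_inv]
    exact mul_le_of_le_one_right (by positivity) h.rho_lt.le
  have h_const : pertConst Q ρ ≤ stepConst m Q ρ := le_add_of_nonneg_right (by positivity)
  calc (ρ ^ (n - 1))⁻¹ * ‖flux a F (n - 1)‖
      ≤ (ρ ^ n)⁻¹ * (‖flux a F n‖ + pertConst Q ρ * (ρ ^ n) ^ 2 * ‖F n‖) := by gcongr
    _ = (ρ ^ n)⁻¹ * ‖flux a F n‖ + pertConst Q ρ * ρ ^ n * ‖F n‖ := by field_simp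
    _ ≤ _ := by gcongr

theorem norm_pred_le (h : HasBackground A B m Q ρ a b) (F : ℤ → ℂ) (n : ℤ) :
    ‖F (n - 1)‖ ≤
      ‖F n‖ + stepConst m Q ρ * ρ ^ n * ((ρ ^ (n - 1))⁻¹ * ‖flux a F (n - 1)‖) := by
  have hρ := h.rho_pos
  have hm := h.m_pos
  have h_const : 1 / (m * ρ) ≤ stepConst m Q ρ := le_add_of_nonneg_left h.pertConst_nonneg
  have h_diff : ‖F n - F (n - 1)‖ ≤ ‖flux a F (n - 1)‖ / m := by
    simpa only [flux, sub_add_cancel] using h.norm_le_norm_mul_div (n - 1) (F n - F (n - 1))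
  calc ‖F (n - 1)‖ ≤ ‖F n‖ + ‖F n - F (n - 1)‖ := norm_le_norm_add_norm_sub _ _
    _ ≤ ‖F n‖ + ‖flux a F (n - 1)‖ / m := by gcongr
    _ = ‖F n‖ + 1 / (m * ρ) * ρ ^ n * ((ρ ^ (n - 1))⁻¹ * ‖flux a F (n - 1)‖) := by
        rw [zpow_sub_one₀ hρ.ne']; field_simp
    _ ≤ _ := by gcongr

theorem weightedSize_pred_le (h : HasBackground A B m Q ρ a b) (hz : ‖z‖ ≤ 1)
    (hF : NormalizedEq A B a b z F n) :
    weightedSize ρ a F (n - 1) ≤ (1 + stepConst m Q ρ * ρ ^ n) ^ 2 * weightedSize ρ a F n := by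
  have hρ := h.rho_pos
  have h_flux := h.weighted_flux_pred_le hz hF
  have h_value := h.norm_pred_le F n
  set f := ‖F n‖
  set y := (ρ ^ n)⁻¹ * ‖flux a F n‖
  set y' := (ρ ^ (n - 1))⁻¹ * ‖flux a F (n - 1)‖
  set ε := stepConst m Q ρ * ρ ^ n
  have hε : 0 ≤ ε := mul_nonneg h.stepConst_nonneg (by positivity)
  have hεf : 0 ≤ ε * f := by positivity
  have hεy : 0 ≤ ε * y := by positivity
  calc weightedSize ρ a F (n - 1) ≤ (1 + ε) * (f + y') := by
        rw [weightedSize]; linarith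
    _ ≤ (1 + ε) * ((1 + ε) * (f + y)) :=
        mul_le_mul_of_nonneg_left (by linarith) (by linarith)
    _ = (1 + ε) ^ 2 * weightedSize ρ a F n := by rw [weightedSize]; ring

theorem weightedSize_le (h : HasBackground A B m Q ρ a b) (hz : ‖z‖ ≤ 1) {N : ℤ}
    (hF : ∀ n ≤ N, NormalizedEq A B a b z F n) (hn : n ≤ N) :
    weightedSize ρ a F n ≤ weightedSize ρ a F N * Real.exp (stabConst m Q ρ * ρ ^ n) := by
  have hρ := h.rho_pos
  suffices H : weightedSize ρ a F n ≤
      weightedSize ρ a F N * Real.exp (stabConst m Q ρ * (ρ ^ n - ρ ^ N)) by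
    refine H.trans (mul_le_mul_of_nonneg_left (Real.exp_le_exp.2 ?_)
      (weightedSize_nonneg hρ a F N))
    exact mul_le_mul_of_nonneg_left (sub_le_self _ (by positivity)) h.stabConst_nonneg
  induction n, hn using Int.leInductionDown with
  | base => simp
  | pred n hn ih =>
    have hk := h.stepConst_nonneg
    have hexp : (1 + stepConst m Q ρ * ρ ^ n) ^ 2 ≤
        Real.exp (2 * (stepConst m Q ρ * ρ ^ n)) := by
      rw [two_mul, Real.exp_add, ← sq, add_comm]
      exact pow_le_pow_left₀ (by positivity) (Real.add_one_le_exp _) 2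
    have htele : 2 * (stepConst m Q ρ * ρ ^ n) = stabConst m Q ρ * (ρ ^ (n - 1) - ρ ^ n) := by
      have : 1 - ρ ≠ 0 := (sub_pos.2 h.rho_lt).ne'
      rw [stabConst, zpow_sub_one₀ hρ.ne']
      field_simp
    calc weightedSize ρ a F (n - 1)
        ≤ (1 + stepConst m Q ρ * ρ ^ n) ^ 2 * weightedSize ρ a F n :=
          h.weightedSize_pred_le hz (hF n hn)
      _ ≤ Real.exp (2 * (stepConst m Q ρ * ρ ^ n)) *
          (weightedSize ρ a F N * Real.exp (stabConst m Q ρ * (ρ ^ n - ρ ^ N))) :=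
          mul_le_mul hexp ih (weightedSize_nonneg hρ a F n) (Real.exp_pos _).le
      _ = weightedSize ρ a F N * Real.exp (stabConst m Q ρ * (ρ ^ (n - 1) - ρ ^ N)) := by
          rw [htele, mul_left_comm, ← Real.exp_add, ← mul_add, sub_add_sub_cancel]

end HasBackground

/-- The pair `(F (N - k), F (N - k + 1))`, where `F` solves the normalized equation with
`F N = F (N + 1) = 1`. -/
def jostPair (a b : ℤ → ℝ) (A B : ℝ) (z : ℂ) (N : ℤ) : ℕ → ℂ × ℂ
  | 0 => (1, 1)
  | k + 1 =>
    (((A * (1 + z ^ 2) - (b (N - k) - B) * z) * (jostPair a b A B z N k).1 -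
      a (N - k) * z ^ 2 * (jostPair a b A B z N k).2) / a (N - k - 1), (jostPair a b A B z N k).1)

/-- The normalized Jost function of the coefficients frozen at the background beyond `N`: it is `1`
on `[N, ∞)` and solves the normalized equation at the sites `n ≤ N`. -/
def jostApprox (a b : ℤ → ℝ) (A B : ℝ) (z : ℂ) (N n : ℤ) : ℂ :=
  (jostPair a b A B z N (N - n).toNat).1

theorem jostApprox_of_le {N n : ℤ} (hn : N ≤ n) : jostApprox a b A B z N n = 1 := by
  have : (N - n).toNat = 0 := by omega
  simp [jostApprox, this, jostPair]

theorem jostPair_snd {N n : ℤ} (hn : n ≤ N) :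
    (jostPair a b A B z N (N - n).toNat).2 = jostApprox a b A B z N (n + 1) := by
  rcases hn.eq_or_lt with rfl | hlt
  · simp [jostApprox, jostPair]
  · have h1 : (N - n).toNat = (N - (n + 1)).toNat + 1 := by omega
    rw [h1]; rfl

theorem jostApprox_pred {N n : ℤ} (hn : n ≤ N) :
    jostApprox a b A B z N (n - 1) = ((A * (1 + z ^ 2) - (b n - B) * z) * jostApprox a b A B z N n -
      a n * z ^ 2 * jostApprox a b A B z N (n + 1)) / a (n - 1) := by
  have h1 : (N - (n - 1)).toNat = (N - n).toNat + 1 := by omega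
  have h2 : N - ((N - n).toNat : ℤ) = n := by omega
  rw [jostApprox, h1, jostPair, h2, jostPair_snd hn]
  rfl

@[elab_as_elim]
theorem two_step_descent {P : ℤ → Prop} (N : ℤ) (tail : ∀ n, N ≤ n → P n)
    (pred : ∀ n ≤ N, P n → P (n + 1) → P (n - 1)) (n : ℤ) : P n := by
  rcases le_total N n with h | h
  · exact tail n h
  · suffices P n ∧ P (n + 1) from this.1
    induction n, h using Int.leInductionDown with
    | base => exact ⟨tail N le_rfl, tail _ (by omega)⟩
    | pred n hn ih => exact ⟨pred n hn ih.1 ih.2, by simpa using ih.1⟩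

theorem jostApprox_differentiable (N n : ℤ) :
    Differentiable ℂ (fun z => jostApprox a b A B z N n) := by
  induction n using two_step_descent N with
  | tail n hn => simp only [jostApprox_of_le hn]; fun_prop
  | pred n hn ih ih' => simp only [jostApprox_pred hn]; fun_prop

theorem jostApprox_conj (z : ℂ) (N n : ℤ) :
    jostApprox a b A B (starRingEnd ℂ z) N n = starRingEnd ℂ (jostApprox a b A B z N n) := by
  induction n using two_step_descent N with
  | tail n hn => simp [jostApprox_of_le hn]
  | pred n hn ih ih' => simp [jostApprox_pred hn, ih, ih']

/-- The normalized Jost function `z ↦ z⁻ⁿ ψ(z, n)`. -/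
def jostF (a b : ℤ → ℝ) (A B : ℝ) (n : ℤ) (z : ℂ) : ℂ :=
  limUnder atTop fun N : ℕ => jostApprox a b A B z N n

/-- The constant in the estimate of the truncation error of `jostApprox`. -/
def errConst (m Q ρ : ℝ) (n : ℤ) : ℝ :=
  pertConst Q ρ * (1 / m + 1) * Real.exp (stabConst m Q ρ * ρ ^ n)

namespace HasBackground

theorem normalizedEq_jostApprox (h : HasBackground A B m Q ρ a b) (z : ℂ) {N n : ℤ} (hn : n ≤ N) :
    NormalizedEq A B a b z (jostApprox a b A B z N) n := by
  have := h.a_ne (n - 1)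
  rw [NormalizedEq, jostApprox_pred hn]
  field_simp

theorem errConst_nonneg (h : HasBackground A B m Q ρ a b) (n : ℤ) : 0 ≤ errConst m Q ρ n := by
  have := h.m_pos; have := h.pertConst_nonneg
  unfold errConst; positivity

theorem flux_jostApprox_succ (h : HasBackground A B m Q ρ a b) (z : ℂ) (N : ℤ) :
    flux a (jostApprox a b A B z (N + 1)) N = perturbation A B a b z (N + 1) := by
  have h_one : jostApprox a b A B z (N + 1) (N + 1) = 1 := jostApprox_of_le le_rfl
  have h_flux : flux a (jostApprox a b A B z (N + 1)) (N + 1) = 0 := by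
    rw [flux, h_one, jostApprox_of_le (by omega), sub_self, mul_zero]
  simpa only [add_sub_cancel_right, h_one, h_flux, mul_zero, mul_one, zero_add] using
    (h.normalizedEq_jostApprox z (le_refl (N + 1))).flux_pred

theorem weightedSize_jostApprox_succ_sub (h : HasBackground A B m Q ρ a b) (hz : ‖z‖ ≤ 1)
    (N : ℕ) :
    weightedSize ρ a (fun k => jostApprox a b A B z (N + 1) k - jostApprox a b A B z N k) N ≤
      pertConst Q ρ * (1 / m + 1) * ρ ^ N := by
  have hρ := h.rho_pos
  have hm := h.m_pos
  have hP := h.pertConst_nonneg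
  set D : ℤ → ℂ := fun k => jostApprox a b A B z (N + 1) k - jostApprox a b A B z N k with hD
  have hD_succ : D (N + 1) = 0 := by
    simp only [hD, jostApprox_of_le (le_refl ((N : ℤ) + 1)),
      jostApprox_of_le (show (N : ℤ) ≤ N + 1 by omega), sub_self]
  have hD_flux : flux a D N = perturbation A B a b z (N + 1) := by
    rw [← h.flux_jostApprox_succ z N]
    simp only [flux, hD_succ, jostApprox_of_le (le_refl ((N : ℤ) + 1))]
    simp only [hD, jostApprox_of_le (le_refl (N : ℤ))]
    ring
  have hflux_le : ‖flux a D N‖ ≤ pertConst Q ρ * (ρ ^ N) ^ 2 := by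
    rw [hD_flux]
    refine (h.norm_perturbation_le hz _).trans ?_
    have : ρ ^ (N + 1) ≤ ρ ^ N := pow_le_pow_of_le_one hρ.le h.rho_lt.le (Nat.le_succ N)
    exact_mod_cast mul_le_mul_of_nonneg_left (pow_le_pow_left₀ (by positivity) this 2) hP
  have hval_le : ‖D N‖ ≤ ‖flux a D N‖ / m := by
    have := h.norm_le_norm_mul_div N (D N)
    rwa [flux, hD_succ, zero_sub, mul_neg, norm_neg]
  calc weightedSize ρ a D N
      ≤ pertConst Q ρ * (ρ ^ N) ^ 2 / m + (ρ ^ N)⁻¹ * (pertConst Q ρ * (ρ ^ N) ^ 2) := by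
        rw [weightedSize, zpow_natCast]
        gcongr
        exact hval_le.trans (by gcongr)
    _ = pertConst Q ρ * (ρ ^ N / m + 1) * ρ ^ N := by field_simp
    _ ≤ _ := by
        gcongr
        exact pow_le_one₀ hρ.le h.rho_lt.le

theorem dist_jostApprox_succ (h : HasBackground A B m Q ρ a b) (hz : ‖z‖ ≤ 1) (n : ℤ) (N : ℕ) :
    dist (jostApprox a b A B z N n) (jostApprox a b A B z (N + 1 : ℕ) n)
      ≤ errConst m Q ρ n * ρ ^ N := by
  have hρ := h.rho_pos
  push_cast
  rcases lt_or_ge (N : ℤ) n with hn | hn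
  · rw [jostApprox_of_le hn.le, jostApprox_of_le (by omega), dist_self]
    exact mul_nonneg (h.errConst_nonneg n) (by positivity)
  set D : ℤ → ℂ := fun k => jostApprox a b A B z (N + 1) k - jostApprox a b A B z N k
  have hD : ∀ k ≤ (N : ℤ), NormalizedEq A B a b z D k := fun k hk =>
    (h.normalizedEq_jostApprox z (by omega)).sub (h.normalizedEq_jostApprox z hk)
  calc dist (jostApprox a b A B z N n) (jostApprox a b A B z (N + 1) n)
      = ‖D n‖ := by rw [dist_comm, dist_eq_norm]
    _ ≤ weightedSize ρ a D n := norm_le_weightedSize hρ a D n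
    _ ≤ weightedSize ρ a D N * Real.exp (stabConst m Q ρ * ρ ^ n) := h.weightedSize_le hz hD hn
    _ ≤ pertConst Q ρ * (1 / m + 1) * ρ ^ N * Real.exp (stabConst m Q ρ * ρ ^ n) := by
        gcongr
        exact h.weightedSize_jostApprox_succ_sub hz N
    _ = errConst m Q ρ n * ρ ^ N := by rw [errConst]; ring

theorem tendsto_jostApprox (h : HasBackground A B m Q ρ a b) (hz : ‖z‖ ≤ 1) (n : ℤ) :
    Tendsto (fun N : ℕ => jostApprox a b A B z N n) atTop (𝓝 (jostF a b A B n z)) :=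
  tendsto_nhds_limUnder (cauchySeq_tendsto_of_complete
    (cauchySeq_of_le_geometric ρ _ h.rho_lt (h.dist_jostApprox_succ hz n)))

theorem dist_jostApprox_jostF (h : HasBackground A B m Q ρ a b) (hz : ‖z‖ ≤ 1) (n : ℤ) (N : ℕ) :
    dist (jostApprox a b A B z N n) (jostF a b A B n z) ≤ errConst m Q ρ n * ρ ^ N / (1 - ρ) :=
  dist_le_of_le_geometric_of_tendsto ρ _ h.rho_lt (h.dist_jostApprox_succ hz n)
    (h.tendsto_jostApprox hz n) N

theorem tendsto_errConst_mul (h : HasBackground A B m Q ρ a b) (n : ℤ) :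
    Tendsto (fun N : ℕ => errConst m Q ρ n * ρ ^ N / (1 - ρ)) atTop (𝓝 0) := by
  simpa using ((tendsto_pow_atTop_nhds_zero_of_lt_one h.rho_pos.le h.rho_lt).const_mul
    (errConst m Q ρ n)).div_const (1 - ρ)

theorem normalizedEq_jostF (h : HasBackground A B m Q ρ a b) (hz : ‖z‖ ≤ 1) (n : ℤ) :
    NormalizedEq A B a b z (fun k => jostF a b A B k z) n := by
  have hlhs := (h.tendsto_jostApprox hz (n - 1)).const_mul (a (n - 1) : ℂ)
  have hrhs := ((h.tendsto_jostApprox hz n).const_mul (A * (1 + z ^ 2) - (b n - B) * z)).sub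
    ((h.tendsto_jostApprox hz (n + 1)).const_mul (a n * z ^ 2))
  refine tendsto_nhds_unique (hlhs.congr' ?_) hrhs
  filter_upwards [eventually_ge_atTop n.toNat] with N hN
  exact h.normalizedEq_jostApprox z (by omega)

theorem tendstoUniformlyOn_jostApprox (h : HasBackground A B m Q ρ a b) (n : ℤ) :
    TendstoUniformlyOn (fun (N : ℕ) z => jostApprox a b A B z N n) (jostF a b A B n) atTop
      (Metric.closedBall 0 1) := by
  rw [Metric.tendstoUniformlyOn_iff]
  intro ε hε
  filter_upwards [(h.tendsto_errConst_mul n).eventually_lt_const hε] with N hN w hw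
  rw [dist_comm]
  exact (h.dist_jostApprox_jostF (by simpa using hw) n N).trans_lt hN

theorem continuousOn_jostF (h : HasBackground A B m Q ρ a b) (n : ℤ) :
    ContinuousOn (jostF a b A B n) (Metric.closedBall 0 1) :=
  (h.tendstoUniformlyOn_jostApprox n).continuousOn
    (Frequently.of_forall fun N => (jostApprox_differentiable N n).continuous.continuousOn)

theorem differentiableOn_jostF (h : HasBackground A B m Q ρ a b) (n : ℤ) :
    DifferentiableOn ℂ (jostF a b A B n) (Metric.ball 0 1) :=
  ((h.tendstoUniformlyOn_jostApprox n).mono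
    Metric.ball_subset_closedBall).tendstoLocallyUniformlyOn.differentiableOn
    (Eventually.of_forall fun N => (jostApprox_differentiable N n).differentiableOn)
    Metric.isOpen_ball

theorem jostF_conj (h : HasBackground A B m Q ρ a b) (hz : ‖z‖ ≤ 1) (n : ℤ) :
    jostF a b A B n (starRingEnd ℂ z) = starRingEnd ℂ (jostF a b A B n z) := by
  have hconj := h.tendsto_jostApprox (z := starRingEnd ℂ z) (by simpa using hz) n
  simp only [jostApprox_conj] at hconj
  exact tendsto_nhds_unique hconj
    ((Complex.continuous_conj.tendsto _).comp (h.tendsto_jostApprox hz n))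

theorem errConst_le (h : HasBackground A B m Q ρ a b) {k n : ℤ} (hn : k ≤ n) :
    errConst m Q ρ n ≤ errConst m Q ρ k := by
  have := h.m_pos; have := h.pertConst_nonneg; have := h.stabConst_nonneg
  unfold errConst
  gcongr ?_ * Real.exp (_ * ?_)
  exact zpow_le_zpow_right_of_le_one₀ h.rho_pos h.rho_lt.le hn

theorem tendsto_jostF_atTop (h : HasBackground A B m Q ρ a b) (hz : ‖z‖ ≤ 1) :
    Tendsto (fun n => jostF a b A B n z) atTop (𝓝 1) := by
  have hρ := h.rho_pos
  have hlim : Tendsto (fun n : ℤ => errConst m Q ρ 0 * ρ ^ n.toNat / (1 - ρ)) atTop (𝓝 0) :=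
    (h.tendsto_errConst_mul 0).comp (tendsto_atTop.2 fun k => by
      filter_upwards [eventually_ge_atTop (k : ℤ)] with n hn; omega)
  rw [tendsto_iff_dist_tendsto_zero]
  refine squeeze_zero' (Eventually.of_forall fun _ => dist_nonneg) ?_ hlim
  filter_upwards [eventually_ge_atTop 0] with n hn
  have h_trunc := h.dist_jostApprox_jostF hz n n.toNat
  rw [jostApprox_of_le (by omega), dist_comm] at h_trunc
  have := sub_pos.2 h.rho_lt
  exact h_trunc.trans (by gcongr; exact h.errConst_le hn)

theorem jostF_zero_pred (h : HasBackground A B m Q ρ a b) (n : ℤ) :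
    (a (n - 1) : ℂ) * jostF a b A B (n - 1) 0 = A * jostF a b A B n 0 := by
  simpa [NormalizedEq] using h.normalizedEq_jostF (z := 0) (by simp) n

theorem ofReal_re_jostF_zero (h : HasBackground A B m Q ρ a b) (n : ℤ) :
    ((jostF a b A B n 0).re : ℂ) = jostF a b A B n 0 := by
  have := h.jostF_conj (z := 0) (by simp) n
  rw [map_zero] at this
  exact Complex.conj_eq_iff_re.1 this.symm

theorem jostF_zero_re_pos (h : HasBackground A B m Q ρ a b) (hA : 0 < A) (n : ℤ) :
    0 < (jostF a b A B n 0).re := by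
  have hlim : Tendsto (fun k => (jostF a b A B k 0).re) atTop (𝓝 1) :=
    (Complex.continuous_re.tendsto _).comp (h.tendsto_jostF_atTop (z := 0) (by simp))
  obtain ⟨N, hN_pos, hnN⟩ :=
    ((hlim.eventually_const_lt zero_lt_one).and (eventually_ge_atTop n)).exists
  induction n, hnN using Int.leInductionDown with
  | base => exact hN_pos
  | pred k _ ih =>
    have hstep : a (k - 1) * (jostF a b A B (k - 1) 0).re = A * (jostF a b A B k 0).re := by
      simpa using congrArg Complex.re (h.jostF_zero_pred k)
    exact pos_of_mul_pos_right (by rw [hstep]; positivity) (h.a_pos (k - 1)).le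

end HasBackground

end JostFunction

/-! ### Time dependence of the normalized Jost functions -/

section TimeDerivative

theorem HasBackground.abs_a_le {A B m Q ρ : ℝ} {a b : ℤ → ℝ} (h : HasBackground A B m Q ρ a b)
    (n : ℤ) : |a n| ≤ |A| + Q * (ρ ^ n) ^ 2 := by
  calc |a n| = |A + (a n - A)| := by rw [add_sub_cancel]
    _ ≤ |A| + |a n - A| := abs_add_le _ _
    _ ≤ |A| + Q * (ρ ^ n) ^ 2 := by gcongr; exact h.a_sub n

/-- The generator of the Toda flow acting on normalized Jost functions: if `a`, `b` solve the Toda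
lattice, then `∂ₜ F = laxField F`. -/
def laxField (A B : ℝ) (a b : ℤ → ℝ) (z : ℂ) (F : ℤ → ℂ) (n : ℤ) : ℂ :=
  z⁻¹ * ((2 * A - (b n - B) * z) * F n - 2 * a (n - 1) * F (n - 1))

/-- The failure of the truncated Jost function to satisfy `∂ₜ F = laxField F`, multiplied by `z`. -/
def laxDefect (A B : ℝ) (a b : ℤ → ℝ → ℝ) (z : ℂ) (N : ℤ) (t : ℝ) (n : ℤ) : ℂ :=
  z * deriv (fun s => jostApprox (a · s) (b · s) A B z N n) t +
    ((b n t - B) * z - 2 * A) * jostApprox (a · t) (b · t) A B z N n +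
    2 * a (n - 1) t * jostApprox (a · t) (b · t) A B z N (n - 1)

/-- The constant in the bound for `laxDefect` at the truncation site. -/
def defectConst (A Q : ℝ) : ℝ := 3 * Q + 6 * Q * (|A| + Q)

variable {A B m Q ρ : ℝ} {a b : ℤ → ℝ → ℝ} {z : ℂ}

theorem jostApprox_differentiable_time (hT : IsTodaSolution a b) (ha : ∀ n t, a n t ≠ 0)
    (N n : ℤ) : Differentiable ℝ (fun t => jostApprox (a · t) (b · t) A B z N n) := by
  have hda : ∀ k, Differentiable ℝ (fun t => (a k t : ℂ)) := fun k t =>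
    (hT.a_eq k t).ofReal_comp.differentiableAt
  have hdb : ∀ k, Differentiable ℝ (fun t => (b k t : ℂ)) := fun k t =>
    (hT.b_eq k t).ofReal_comp.differentiableAt
  induction n using two_step_descent N with
  | tail n hn => simp only [jostApprox_of_le hn]; fun_prop
  | pred n hn ih ih' =>
    simp only [jostApprox_pred hn]
    have := hda n
    have := hdb n
    exact Differentiable.fun_div (by fun_prop) (hda _) fun t => by exact_mod_cast ha (n - 1) t

theorem normalizedEq_time_deriv (hT : IsTodaSolution a b) {F : ℤ → ℝ → ℂ} {n : ℤ} {t : ℝ}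
    (hF : ∀ s, NormalizedEq A B (a · s) (b · s) z (F · s) n)
    (hd : ∀ k, DifferentiableAt ℝ (F k) t) :
    a (n - 1) t * (b n t - b (n - 1) t) * F (n - 1) t + a (n - 1) t * deriv (F (n - 1)) t =
      -(2 * (a n t ^ 2 - a (n - 1) t ^ 2) * z) * F n t +
        (A * (1 + z ^ 2) - (b n t - B) * z) * deriv (F n) t -
        (a n t * (b (n + 1) t - b n t) * z ^ 2 * F (n + 1) t +
          a n t * z ^ 2 * deriv (F (n + 1)) t) := by
  have hlhs := (hT.a_eq (n - 1) t).ofReal_comp.mul (hd (n - 1)).hasDerivAt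
  have hrhs := (((((hT.b_eq n t).ofReal_comp.sub_const (B : ℂ)).mul_const z).const_sub
    (A * (1 + z ^ 2) : ℂ)).mul (hd n).hasDerivAt).sub
    (((hT.a_eq n t).ofReal_comp.mul_const (z ^ 2)).mul (hd (n + 1)).hasDerivAt)
  have key := hlhs.unique (hrhs.congr_of_eventuallyEq (Eventually.of_forall hF))
  push_cast [sub_add_cancel] at key
  exact key

theorem normalizedEq_laxDefect (hT : IsTodaSolution a b) (ha : ∀ n t, a n t ≠ 0) {N n : ℤ}
    (hn : n ≤ N) (t : ℝ) :
    NormalizedEq A B (a · t) (b · t) z (laxDefect A B a b z N t) n := by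
  set F : ℤ → ℝ → ℂ := fun n t => jostApprox (a · t) (b · t) A B z N n with hF_def
  have hF : ∀ k ≤ N, ∀ s, NormalizedEq A B (a · s) (b · s) z (F · s) k := fun k hk s => by
    have : (a (k - 1) s : ℂ) ≠ 0 := by exact_mod_cast ha (k - 1) s
    simp only [NormalizedEq, hF_def, jostApprox_pred hk]
    field_simp
  have h_deriv := normalizedEq_time_deriv hT (hF n hn)
    fun k => jostApprox_differentiable_time hT ha N k t
  have h_at := hF n hn t
  have h_pred := hF (n - 1) (by omega) t
  simp only [NormalizedEq, laxDefect, add_sub_cancel_right, sub_add_cancel, hF_def] at *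
  linear_combination z * h_deriv + 2 * (a (n - 1) t : ℂ) * h_pred +
    ((b n t - B) * z - 2 * A) * h_at

theorem deriv_jostApprox_of_le {N n : ℤ} (hn : N ≤ n) (t : ℝ) :
    deriv (fun s => jostApprox (a · s) (b · s) A B z N n) t = 0 := by
  simp only [jostApprox_of_le hn, deriv_const]

theorem laxDefect_self {t : ℝ} (h : HasBackground A B m Q ρ (a · t) (b · t)) (N : ℤ) :
    laxDefect A B a b z N t N = -((b N t - B : ℝ) * z + 2 * (a N t - A : ℝ) * z ^ 2) := by
  have h_eq := h.normalizedEq_jostApprox z (le_refl N)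
  rw [NormalizedEq, jostApprox_of_le le_rfl, jostApprox_of_le (Int.le_add_one le_rfl)] at h_eq
  rw [laxDefect, deriv_jostApprox_of_le le_rfl, jostApprox_of_le le_rfl]
  push_cast
  linear_combination 2 * h_eq

theorem laxDefect_succ (N : ℤ) (t : ℝ) :
    laxDefect A B a b z N t (N + 1) = (b (N + 1) t - B : ℝ) * z + 2 * (a N t - A : ℝ) := by
  rw [laxDefect, deriv_jostApprox_of_le (Int.le_add_one le_rfl), add_sub_cancel_right,
    jostApprox_of_le le_rfl, jostApprox_of_le (Int.le_add_one le_rfl)]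
  push_cast
  ring

theorem norm_mul_add_two_mul_le {x y q : ℝ} {u v : ℂ} (hx : |x| ≤ q) (hy : |y| ≤ q)
    (hu : ‖u‖ ≤ 1) (hv : ‖v‖ ≤ 1) : ‖(x * u + 2 * y * v : ℂ)‖ ≤ 3 * q := by
  calc ‖(x * u + 2 * y * v : ℂ)‖ ≤ |x| * ‖u‖ + 2 * |y| * ‖v‖ := by
        simpa using norm_add_le (x * u : ℂ) (2 * y * v)
    _ ≤ |x| * 1 + 2 * |y| * 1 := by gcongr
    _ ≤ 3 * q := by linarith

theorem norm_laxDefect_self_le {t : ℝ} (h : HasBackground A B m Q ρ (a · t) (b · t))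
    (hz : ‖z‖ ≤ 1) (N : ℤ) : ‖laxDefect A B a b z N t N‖ ≤ 3 * (Q * (ρ ^ N) ^ 2) := by
  rw [laxDefect_self h, norm_neg]
  exact norm_mul_add_two_mul_le (h.b_sub N) (h.a_sub N) hz
    (by rw [norm_pow]; exact pow_le_one₀ (norm_nonneg z) hz)

theorem norm_laxDefect_succ_le {t : ℝ} (h : HasBackground A B m Q ρ (a · t) (b · t))
    (hz : ‖z‖ ≤ 1) (N : ℤ) : ‖laxDefect A B a b z N t (N + 1)‖ ≤ 3 * (Q * (ρ ^ N) ^ 2) := by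
  have hρ := h.rho_pos
  have hb : |b (N + 1) t - B| ≤ Q * (ρ ^ N) ^ 2 := by
    refine (h.b_sub (N + 1)).trans ?_
    have := h.Q_nonneg
    have : ρ ^ (N + 1) ≤ ρ ^ N := zpow_le_zpow_right_of_le_one₀ hρ h.rho_lt.le (by omega)
    gcongr
  rw [laxDefect_succ, ← mul_one (2 * ((a N t - A : ℝ) : ℂ))]
  exact norm_mul_add_two_mul_le hb (h.a_sub N) hz (by simp)

theorem weightedSize_laxDefect_le {t : ℝ} (h : HasBackground A B m Q ρ (a · t) (b · t))
    (hz : ‖z‖ ≤ 1) (N : ℕ) :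
    weightedSize ρ (a · t) (laxDefect A B a b z N t) N ≤ defectConst A Q * ρ ^ N := by
  have hρ := h.rho_pos
  have hQ := h.Q_nonneg
  have hρN : ρ ^ N ≤ 1 := pow_le_one₀ hρ.le h.rho_lt.le
  have h_sq : (ρ ^ N) ^ 2 ≤ ρ ^ N := pow_le_of_le_one (by positivity) hρN two_ne_zero
  have h_self := norm_laxDefect_self_le h hz N
  have h_succ := norm_laxDefect_succ_le h hz N
  rw [zpow_natCast] at h_self h_succ
  have h_a : |a N t| ≤ |A| + Q := by
    refine (h.abs_a_le N).trans ?_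
    rw [zpow_natCast]
    gcongr
    exact mul_le_of_le_one_right hQ (h_sq.trans hρN)
  have h_flux : ‖flux (a · t) (laxDefect A B a b z N t) N‖ ≤
      (|A| + Q) * (6 * (Q * (ρ ^ N) ^ 2)) := by
    rw [flux, norm_mul, Complex.norm_real, Real.norm_eq_abs]
    gcongr
    exact (norm_sub_le _ _).trans (by linarith)
  calc weightedSize ρ (a · t) (laxDefect A B a b z N t) N
      ≤ 3 * (Q * (ρ ^ N) ^ 2) + (ρ ^ N)⁻¹ * ((|A| + Q) * (6 * (Q * (ρ ^ N) ^ 2))) := by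
        rw [weightedSize, zpow_natCast]
        gcongr
    _ = 3 * Q * (ρ ^ N) ^ 2 + 6 * Q * (|A| + Q) * ρ ^ N := by field_simp
    _ ≤ 3 * Q * ρ ^ N + 6 * Q * (|A| + Q) * ρ ^ N := by gcongr
    _ = defectConst A Q * ρ ^ N := by rw [defectConst]; ring

theorem norm_laxDefect_le (hT : IsTodaSolution a b) (ha : ∀ n t, a n t ≠ 0) {t : ℝ}
    (h : HasBackground A B m Q ρ (a · t) (b · t)) (hz : ‖z‖ ≤ 1) {n : ℤ} {N : ℕ} (hn : n ≤ N) :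
    ‖laxDefect A B a b z N t n‖ ≤
      defectConst A Q * Real.exp (stabConst m Q ρ * ρ ^ n) * ρ ^ N := by
  calc ‖laxDefect A B a b z N t n‖
      ≤ weightedSize ρ (a · t) (laxDefect A B a b z N t) n :=
        norm_le_weightedSize h.rho_pos (a · t) _ n
    _ ≤ weightedSize ρ (a · t) (laxDefect A B a b z N t) N *
          Real.exp (stabConst m Q ρ * ρ ^ n) :=
        h.weightedSize_le hz (fun k hk => normalizedEq_laxDefect hT ha hk t) hn
    _ ≤ defectConst A Q * ρ ^ N * Real.exp (stabConst m Q ρ * ρ ^ n) := by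
        gcongr
        exact weightedSize_laxDefect_le h hz N
    _ = defectConst A Q * Real.exp (stabConst m Q ρ * ρ ^ n) * ρ ^ N := by ring

theorem HasBackground.norm_two_mul_sub_le {a b : ℤ → ℝ} (h : HasBackground A B m Q ρ a b)
    (hz : ‖z‖ ≤ 1) (n : ℤ) :
    ‖(2 * A - (b n - B : ℝ) * z : ℂ)‖ ≤ 2 * |A| + Q * (ρ ^ n) ^ 2 := by
  calc ‖(2 * A - (b n - B : ℝ) * z : ℂ)‖ ≤ 2 * |A| + |b n - B| * ‖z‖ := by
        simpa [← Complex.ofReal_sub] using norm_sub_le (2 * A : ℂ) ((b n - B : ℝ) * z)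
    _ ≤ 2 * |A| + |b n - B| * 1 := by gcongr
    _ ≤ 2 * |A| + Q * (ρ ^ n) ^ 2 := by rw [mul_one]; gcongr; exact h.b_sub n

/-- The constant in the estimate of `norm_deriv_jostApprox_sub_laxField_le`. -/
def laxConst (A m Q ρ : ℝ) (n : ℤ) : ℝ :=
  defectConst A Q * Real.exp (stabConst m Q ρ * ρ ^ n) +
    (2 * |A| + Q * (ρ ^ n) ^ 2) * (errConst m Q ρ n / (1 - ρ)) +
    2 * (|A| + Q * (ρ ^ (n - 1)) ^ 2) * (errConst m Q ρ (n - 1) / (1 - ρ))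

theorem norm_deriv_jostApprox_sub_laxField_le (hT : IsTodaSolution a b) (ha : ∀ n t, a n t ≠ 0)
    {t : ℝ} (h : HasBackground A B m Q ρ (a · t) (b · t)) (hz : ‖z‖ ≤ 1) (hz0 : z ≠ 0) {n : ℤ}
    {N : ℕ} (hn : n ≤ N) :
    ‖deriv (fun s => jostApprox (a · s) (b · s) A B z N n) t -
      laxField A B (a · t) (b · t) z (fun k => jostF (a · t) (b · t) A B k z) n‖ ≤
      ‖z⁻¹‖ * laxConst A m Q ρ n * ρ ^ N := by
  set E : ℤ → ℂ := fun k =>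
    jostApprox (a · t) (b · t) A B z N k - jostF (a · t) (b · t) A B k z with hE
  have hE_le : ∀ k, ‖E k‖ ≤ errConst m Q ρ k / (1 - ρ) * ρ ^ N := fun k => by
    rw [hE, ← dist_eq_norm, div_mul_eq_mul_div]
    exact h.dist_jostApprox_jostF hz k N
  have h_split : deriv (fun s => jostApprox (a · s) (b · s) A B z N n) t -
      laxField A B (a · t) (b · t) z (fun k => jostF (a · t) (b · t) A B k z) n =
      z⁻¹ * (laxDefect A B a b z N t n + (2 * A - (b n t - B : ℝ) * z) * E n -
        2 * a (n - 1) t * E (n - 1)) := by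
    rw [laxDefect, laxField, hE]; push_cast; field_simp; ring
  have hQ := h.Q_nonneg
  have h_a : ‖(2 * a (n - 1) t : ℂ)‖ ≤ 2 * (|A| + Q * (ρ ^ (n - 1)) ^ 2) := by
    simpa using h.abs_a_le (n - 1)
  have h_here : ‖(2 * A - (b n t - B : ℝ) * z : ℂ) * E n‖ ≤
      (2 * |A| + Q * (ρ ^ n) ^ 2) * (errConst m Q ρ n / (1 - ρ) * ρ ^ N) := by
    rw [norm_mul]
    exact mul_le_mul (h.norm_two_mul_sub_le hz n) (hE_le n) (norm_nonneg _) (by positivity)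
  have h_pred : ‖(2 * a (n - 1) t : ℂ) * E (n - 1)‖ ≤
      2 * (|A| + Q * (ρ ^ (n - 1)) ^ 2) * (errConst m Q ρ (n - 1) / (1 - ρ) * ρ ^ N) := by
    rw [norm_mul]
    exact mul_le_mul h_a (hE_le (n - 1)) (norm_nonneg _) (by positivity)
  rw [h_split, norm_mul, mul_assoc ‖z⁻¹‖]
  gcongr
  refine (norm_sub_le _ _).trans ((add_le_add ((norm_add_le _ _).trans
    (add_le_add (norm_laxDefect_le hT ha h hz hn) h_here)) h_pred).trans_eq ?_)
  rw [laxConst]; ring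

theorem hasDerivAt_jostF (hT : IsTodaSolution a b) (ha : ∀ n t, a n t ≠ 0) {s : Set ℝ}
    (hs : IsOpen s) (h : ∀ t ∈ s, HasBackground A B m Q ρ (a · t) (b · t)) (hz : ‖z‖ ≤ 1)
    (hz0 : z ≠ 0) (n : ℤ) {t : ℝ} (ht : t ∈ s) :
    HasDerivAt (fun t => jostF (a · t) (b · t) A B n z)
      (laxField A B (a · t) (b · t) z (fun k => jostF (a · t) (b · t) A B k z) n) t := by
  refine hasDerivAt_of_tendstoUniformlyOn (l := (atTop : Filter ℕ)) hs
    (f := fun N t => jostApprox (a · t) (b · t) A B z N n)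
    (f' := fun N t => deriv (fun t => jostApprox (a · t) (b · t) A B z N n) t)
    (g' := fun t => laxField A B (a · t) (b · t) z (fun k => jostF (a · t) (b · t) A B k z) n)
    ?_ ?_ ?_ ht
  · have hlim : Tendsto (fun N : ℕ => ‖z⁻¹‖ * laxConst A m Q ρ n * ρ ^ N) atTop (𝓝 0) := by
      simpa using (tendsto_pow_atTop_nhds_zero_of_lt_one (h t ht).rho_pos.le
        (h t ht).rho_lt).const_mul (‖z⁻¹‖ * laxConst A m Q ρ n)
    rw [Metric.tendstoUniformlyOn_iff]
    intro ε hε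
    filter_upwards [hlim.eventually_lt_const hε, eventually_ge_atTop n.toNat] with N hN hnN u hu
    rw [dist_comm, dist_eq_norm]
    exact (norm_deriv_jostApprox_sub_laxField_le hT ha (h u hu) hz hz0 (by omega)).trans_lt hN
  · exact Eventually.of_forall fun N u _ =>
      (jostApprox_differentiable_time hT ha N n u).hasDerivAt
  · exact fun u hu => (h u hu).tendsto_jostApprox hz n

end TimeDerivative

/-! ### Persistence of exponential decay under the Toda flow -/

section Persistence

theorem hasDerivAt_pow_div_factorial (κ : ℝ) (k : ℕ) (t : ℝ) :
    HasDerivAt (fun s => (κ * s) ^ (k + 1) / ((k + 1).factorial : ℝ))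
      ((κ * t) ^ k / k.factorial * κ) t := by
  refine ((((hasDerivAt_id t).const_mul κ).pow (k + 1)).div_const _).congr_deriv ?_
  have : (k.factorial : ℝ) ≠ 0 := by positivity
  rw [Nat.factorial_succ]
  push_cast
  simp only [id, mul_one]
  field_simp

variable {E : Type*} [NormedAddCommGroup E] [NormedSpace ℝ E] {x x' : ℤ → ℝ → E} {τ K M D w : ℝ}

-- Picard iteration: every use of the differential inequality gains one factor `3Kt / k`.
theorem norm_le_of_nearest_neighbour_iterate (hK : 0 ≤ K) (hD : 0 ≤ D) (hw : 0 < w)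
    (hx : ∀ n t, HasDerivAt (x n) (x' n t) t)
    (hx' : ∀ n, ∀ t ∈ Set.Icc 0 τ, ‖x' n t‖ ≤ K * (‖x (n - 1) t‖ + ‖x n t‖ + ‖x (n + 1) t‖))
    (hM : ∀ n, ∀ t ∈ Set.Icc 0 τ, ‖x n t‖ ≤ M) (h0 : ∀ n, ‖x n 0‖ ≤ D * w ^ n) (k : ℕ)
    (n : ℤ) {t : ℝ} (ht : t ∈ Set.Icc 0 τ) :
    ‖x n t‖ ≤ D * w ^ n * Real.exp (K * (w⁻¹ + 1 + w) * t) +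
      M * ((3 * K * t) ^ k / k.factorial) := by
  set L := K * (w⁻¹ + 1 + w) with hL
  induction k generalizing n t with
  | zero =>
    have : 0 ≤ D * w ^ n * Real.exp (L * t) := by positivity
    simpa using (hM n t ht).trans (le_add_of_nonneg_left this)
  | succ k ih =>
    refine image_norm_le_of_norm_deriv_right_le_deriv_boundary (a := 0) (b := τ)
      (B := fun t => D * w ^ n * Real.exp (L * t) +
        M * ((3 * K * t) ^ (k + 1) / (k + 1).factorial))
      (B' := fun t => D * w ^ n * (Real.exp (L * t) * L) +
        M * ((3 * K * t) ^ k / k.factorial * (3 * K)))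
      (fun s _ => (hx n s).continuousAt.continuousWithinAt)
      (fun s _ => (hx n s).hasDerivWithinAt) (by simpa using h0 n) (fun s => ?_)
      (fun s hs => ?_) ht
    · have hexp : HasDerivAt (fun t => Real.exp (L * t)) (Real.exp (L * s) * L) s := by
        simpa using ((hasDerivAt_id s).const_mul L).exp
      exact (hexp.const_mul _).add ((hasDerivAt_pow_div_factorial (3 * K) k s).const_mul M)
    · have hs' := Set.Ico_subset_Icc_self hs
      have h_pred := ih (n - 1) hs'
      have h_succ := ih (n + 1) hs'
      rw [zpow_sub_one₀ hw.ne'] at h_pred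
      rw [zpow_add_one₀ hw.ne'] at h_succ
      refine (hx' n s hs').trans ((mul_le_mul_of_nonneg_left
        (add_le_add (add_le_add h_pred (ih n hs')) h_succ) hK).trans_eq ?_)
      rw [hL]; ring

theorem norm_le_of_nearest_neighbour (hK : 0 ≤ K) (hD : 0 ≤ D) (hw : 0 < w)
    (hx : ∀ n t, HasDerivAt (x n) (x' n t) t)
    (hx' : ∀ n, ∀ t ∈ Set.Icc 0 τ, ‖x' n t‖ ≤ K * (‖x (n - 1) t‖ + ‖x n t‖ + ‖x (n + 1) t‖))
    (hM : ∀ n, ∀ t ∈ Set.Icc 0 τ, ‖x n t‖ ≤ M) (h0 : ∀ n, ‖x n 0‖ ≤ D * w ^ n)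
    (n : ℤ) {t : ℝ} (ht : t ∈ Set.Icc 0 τ) :
    ‖x n t‖ ≤ D * w ^ n * Real.exp (K * (w⁻¹ + 1 + w) * t) := by
  have hlim := ((FloorSemiring.tendsto_pow_div_factorial_atTop (3 * K * t)).const_mul M).const_add
    (D * w ^ n * Real.exp (K * (w⁻¹ + 1 + w) * t))
  rw [mul_zero, add_zero] at hlim
  exact ge_of_tendsto' hlim fun k =>
    norm_le_of_nearest_neighbour_iterate hK hD hw hx hx' hM h0 k n ht

theorem norm_le_of_nearest_neighbour_abs (hK : 0 ≤ K) (hD : 0 ≤ D) (hw : 0 < w)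
    (hx : ∀ n t, HasDerivAt (x n) (x' n t) t)
    (hx' : ∀ n t, |t| ≤ τ → ‖x' n t‖ ≤ K * (‖x (n - 1) t‖ + ‖x n t‖ + ‖x (n + 1) t‖))
    (hM : ∀ n t, |t| ≤ τ → ‖x n t‖ ≤ M) (h0 : ∀ n, ‖x n 0‖ ≤ D * w ^ n)
    (n : ℤ) {t : ℝ} (ht : |t| ≤ τ) :
    ‖x n t‖ ≤ D * w ^ n * Real.exp (K * (w⁻¹ + 1 + w) * |t|) := by
  have hmem : ∀ s ∈ Set.Icc 0 τ, |s| ≤ τ := fun s hs => by rw [abs_of_nonneg hs.1]; exact hs.2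
  rcases le_total 0 t with hp | hp
  · rw [abs_of_nonneg hp] at ht ⊢
    exact norm_le_of_nearest_neighbour hK hD hw hx (fun n s hs => hx' n s (hmem s hs))
      (fun n s hs => hM n s (hmem s hs)) h0 n ⟨hp, ht⟩
  · rw [abs_of_nonpos hp] at ht ⊢
    have hrev : ∀ n s, HasDerivAt (fun s => x n (-s)) (-x' n (-s)) s := fun n s =>
      ((hx n (-s)).scomp s (hasDerivAt_neg s)).congr_deriv (neg_one_smul ℝ _)
    simpa using norm_le_of_nearest_neighbour hK hD hw hrev
      (fun n s hs => by rw [norm_neg]; exact hx' n (-s) (by rw [abs_neg]; exact hmem s hs))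
      (fun n s hs => hM n (-s) (by rw [abs_neg]; exact hmem s hs)) (by simpa using h0) n
      (t := -t) ⟨by linarith, ht⟩

end Persistence

section TodaBounds

variable {a b : ℤ → ℝ → ℝ}

theorem IsTodaSolution.reflect (h : IsTodaSolution a b) :
    IsTodaSolution (fun n t => a (-n - 1) (-t)) (fun n t => b (-n) (-t)) where
  b_eq n t := by
    refine ((h.b_eq (-n) (-t)).scomp t (hasDerivAt_neg t)).congr_deriv ?_
    rw [show -(n - 1) - 1 = -n by ring, neg_one_smul]
    ring
  a_eq n t := by
    refine ((h.a_eq (-n - 1) (-t)).scomp t (hasDerivAt_neg t)).congr_deriv ?_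
    rw [show -n - 1 + 1 = -n by ring, show -(n + 1) = -n - 1 by ring, neg_one_smul]
    ring
  bounded τ := by
    obtain ⟨M, hM⟩ := h.bounded τ
    exact ⟨M, fun n t ht =>
      ⟨(hM (-n - 1) (-t) (by simpa using ht)).1, (hM (-n) (-t) (by simpa using ht)).2⟩⟩

theorem IsTodaSolution.a_eq_exp (h : IsTodaSolution a b) (n : ℤ) (t : ℝ) :
    a n t = a n 0 * Real.exp (∫ s in (0 : ℝ)..t, (b (n + 1) s - b n s)) := by
  set G : ℝ → ℝ := fun t => ∫ s in (0 : ℝ)..t, (b (n + 1) s - b n s) with hG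
  have hcont : Continuous fun s => b (n + 1) s - b n s :=
    continuous_iff_continuousAt.2 fun s =>
      (h.b_eq (n + 1) s).continuousAt.sub (h.b_eq n s).continuousAt
  have hderiv : ∀ t, HasDerivAt (fun t => a n t * Real.exp (-G t)) 0 t := fun t =>
    ((h.a_eq n t).mul (hcont.integral_hasStrictDerivAt 0 t).hasDerivAt.neg.exp).congr_deriv
      (by ring)
  have hconst := is_const_of_deriv_eq_zero (fun t => (hderiv t).differentiableAt)
    (fun t => (hderiv t).deriv) t 0
  simp only [hG, intervalIntegral.integral_same, neg_zero, Real.exp_zero, mul_one] at hconst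
  rw [← hconst, mul_assoc, ← Real.exp_add, neg_add_cancel, Real.exp_zero, mul_one]

theorem IsTodaSolution.le_a (h : IsTodaSolution a b) {m M τ : ℝ} (hm : 0 < m)
    (h0 : ∀ n, m ≤ a n 0) (hM : ∀ n t, |t| ≤ τ → |a n t| ≤ M ∧ |b n t| ≤ M) (n : ℤ) {t : ℝ}
    (ht : |t| ≤ τ) : m * Real.exp (-(2 * M * τ)) ≤ a n t := by
  have hM0 : 0 ≤ M := (abs_nonneg _).trans (hM n t ht).1
  have hbound : ∀ s ∈ Set.uIoc 0 t, ‖b (n + 1) s - b n s‖ ≤ 2 * M := fun s hs => by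
    have hs' := Set.abs_sub_left_of_mem_uIcc (Set.uIoc_subset_uIcc hs)
    rw [sub_zero, sub_zero] at hs'
    rw [Real.norm_eq_abs]
    linarith [abs_sub (b (n + 1) s) (b n s), (hM (n + 1) s (hs'.trans ht)).2,
      (hM n s (hs'.trans ht)).2]
  have hint := intervalIntegral.norm_integral_le_of_norm_le_const hbound
  rw [Real.norm_eq_abs, sub_zero] at hint
  rw [h.a_eq_exp n t]
  have : 2 * M * |t| ≤ 2 * M * τ := by gcongr
  refine mul_le_mul (h0 n) (Real.exp_le_exp.2 ?_) (Real.exp_pos _).le (hm.le.trans (h0 n))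
  linarith [neg_le_of_abs_le hint]

/-- The deviation of the coefficients from a constant background. -/
def bgDiff (A B : ℝ) (a b : ℤ → ℝ → ℝ) (n : ℤ) (t : ℝ) : ℝ × ℝ := (a n t - A, b n t - B)

theorem IsTodaSolution.hasDerivAt_bgDiff (h : IsTodaSolution a b) (A B : ℝ) (n : ℤ) (t : ℝ) :
    HasDerivAt (bgDiff A B a b n)
      (a n t * (b (n + 1) t - b n t), 2 * (a n t ^ 2 - a (n - 1) t ^ 2)) t :=
  ((h.a_eq n t).sub_const A).prodMk ((h.b_eq n t).sub_const B)

theorem abs_a_sub_le_norm_bgDiff (A B : ℝ) (n : ℤ) (t : ℝ) :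
    |a n t - A| ≤ ‖bgDiff A B a b n t‖ := norm_fst_le (bgDiff A B a b n t)

theorem abs_b_sub_le_norm_bgDiff (A B : ℝ) (n : ℤ) (t : ℝ) :
    |b n t - B| ≤ ‖bgDiff A B a b n t‖ := norm_snd_le (bgDiff A B a b n t)

theorem norm_bgDiff_le {A B M : ℝ} {n : ℤ} {t : ℝ} (hM : |a n t| ≤ M ∧ |b n t| ≤ M) :
    ‖bgDiff A B a b n t‖ ≤ M + |A| + |B| := by
  have := abs_nonneg A
  have := abs_nonneg B
  refine max_le ?_ ?_
  · simp only [bgDiff, Real.norm_eq_abs]; linarith [abs_sub (a n t) A, hM.1]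
  · simp only [bgDiff, Real.norm_eq_abs]; linarith [abs_sub (b n t) B, hM.2]

theorem norm_todaField_le {A B M : ℝ} {n : ℤ} {t : ℝ} (hM : ∀ n, |a n t| ≤ M) :
    ‖((a n t * (b (n + 1) t - b n t), 2 * (a n t ^ 2 - a (n - 1) t ^ 2)) : ℝ × ℝ)‖ ≤
      4 * M * (‖bgDiff A B a b (n - 1) t‖ + ‖bgDiff A B a b n t‖ +
        ‖bgDiff A B a b (n + 1) t‖) := by
  have hM0 : 0 ≤ M := (abs_nonneg _).trans (hM n)
  set β : ℤ → ℝ := fun k => ‖bgDiff A B a b k t‖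
  have hβ0 : ∀ k, 0 ≤ β k := fun k => norm_nonneg _
  have h_a : |a n t * (b (n + 1) t - b n t)| ≤ M * (β (n + 1) + β n) := by
    rw [abs_mul, ← sub_sub_sub_cancel_right _ _ B]
    gcongr
    · exact hM n
    · exact (abs_sub _ _).trans
        (add_le_add (abs_b_sub_le_norm_bgDiff A B _ t) (abs_b_sub_le_norm_bgDiff A B _ t))
  have h_b : |2 * (a n t ^ 2 - a (n - 1) t ^ 2)| ≤ 2 * (2 * M * (β n + β (n - 1))) := by
    rw [abs_mul, abs_two, sq_sub_sq, abs_mul, ← sub_sub_sub_cancel_right (a n t) _ A]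
    gcongr
    · linarith [abs_add_le (a n t) (a (n - 1) t), hM n, hM (n - 1)]
    · exact (abs_sub _ _).trans
        (add_le_add (abs_a_sub_le_norm_bgDiff A B n t) (abs_a_sub_le_norm_bgDiff A B _ t))
  have h_pred := mul_nonneg hM0 (hβ0 (n - 1))
  have h_self := mul_nonneg hM0 (hβ0 n)
  have h_succ := mul_nonneg hM0 (hβ0 (n + 1))
  change max |_| |_| ≤ 4 * M * (β (n - 1) + β n + β (n + 1))
  exact max_le (by linarith) (by linarith)

theorem IsTodaSolution.norm_bgDiff_le_zpow (h : IsTodaSolution a b) {A B D M w τ : ℝ}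
    (hD : 0 ≤ D) (hw : 0 < w) (hM : ∀ n t, |t| ≤ τ → |a n t| ≤ M ∧ |b n t| ≤ M)
    (h0 : ∀ n, ‖bgDiff A B a b n 0‖ ≤ D * w ^ n) (n : ℤ) {t : ℝ} (ht : |t| ≤ τ) :
    ‖bgDiff A B a b n t‖ ≤ D * Real.exp (4 * M * (w⁻¹ + 1 + w) * τ) * w ^ n := by
  have hM0 : 0 ≤ M := (abs_nonneg _).trans (hM n t ht).1
  refine (norm_le_of_nearest_neighbour_abs (by positivity) hD hw
    (h.hasDerivAt_bgDiff A B) (fun k s hs => norm_todaField_le fun i => (hM i s hs).1)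
    (fun k s hs => norm_bgDiff_le (hM k s hs)) h0 n ht).trans ?_
  rw [mul_right_comm]
  gcongr

theorem IsTodaSolution.exists_hasBackground (h : IsTodaSolution a b) {A B m D w : ℝ} (hm : 0 < m)
    (hD : 0 ≤ D) (hw : 0 < w) (hw1 : w < 1) (h0 : ∀ n, m ≤ a n 0)
    (h_decay : ∀ n, ‖bgDiff A B a b n 0‖ ≤ D * w ^ n) (τ : ℝ) :
    ∃ m' Q, ∀ t, |t| ≤ τ → HasBackground A B m' Q (Real.sqrt w) (a · t) (b · t) := by
  obtain ⟨M, hM⟩ := h.bounded τ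
  have h_sqrt : ∀ n : ℤ, (Real.sqrt w ^ n) ^ 2 = w ^ n := fun n => by
    rw [← zpow_natCast, ← zpow_mul, mul_comm, zpow_mul, zpow_natCast, Real.sq_sqrt hw.le]
  refine ⟨m * Real.exp (-(2 * M * τ)), D * Real.exp (4 * M * (w⁻¹ + 1 + w) * τ), fun t ht => ?_⟩
  have h_diff := fun n => h.norm_bgDiff_le_zpow hD hw hM h_decay n ht
  exact {
    m_pos := by positivity
    Q_nonneg := by positivity
    rho_pos := Real.sqrt_pos.2 hw
    rho_lt := by rw [Real.sqrt_lt' one_pos]; simpa using hw1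
    le_a := fun n => h.le_a hm h0 hM n ht
    a_sub := fun n => by rw [h_sqrt]; exact (abs_a_sub_le_norm_bgDiff A B n t).trans (h_diff n)
    b_sub := fun n => by rw [h_sqrt]; exact (abs_b_sub_le_norm_bgDiff A B n t).trans (h_diff n) }

end TodaBounds

/-! ### The two backgrounds -/

/-- The index `j` of the two ends of the lattice: `left` is `j = 1`, with background `(d, -c)` at
`n → -∞`, and `right` is `j = 2`, with background `(1/2, 0)` at `n → +∞`. Both are treated at
once by reading the lattice in the direction of the respective end. -/
inductive Side
  | left
  | right

namespace Side

/-- The index of the opposite end. -/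
def other : Side → Side
  | left => right
  | right => left

/-- The off-diagonal coefficient of the background of an end. -/
def amp (d : ℝ) : Side → ℝ
  | left => d
  | right => 1 / 2

/-- The diagonal coefficient of the background of an end. -/
def center (c : ℝ) : Side → ℝ
  | left => -c
  | right => 0

/-- The `n`-th site of the lattice, counted in the direction of an end. -/
def site : Side → ℤ → ℤ
  | left, n => -n
  | right, n => n

/-- The bond between the sites `n` and `n + 1`, counted in the direction of an end. -/
def bond : Side → ℤ → ℤ
  | left, n => -n - 1
  | right, n => n

/-- The direction of an end; reading the lattice towards `-∞` reverses the time of the Toda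
flow. -/
def sign : Side → ℝ
  | left => -1
  | right => 1

variable (j : Side)

@[simp] theorem other_other : j.other.other = j := by cases j <;> rfl

@[simp] theorem site_site (n : ℤ) : j.site (j.site n) = n := by
  cases j
  · exact neg_neg n
  · rfl

theorem site_other (n : ℤ) : j.other.site n = -j.site n := by
  cases j
  · exact (neg_neg n).symm
  · rfl

@[simp] theorem sign_mul_sign : j.sign * j.sign = 1 := by cases j <;> norm_num [sign]

@[simp] theorem abs_sign : |j.sign| = 1 := by cases j <;> norm_num [sign]

theorem amp_pos {d : ℝ} (hd : 0 < d) : 0 < j.amp d := by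
  cases j
  · exact hd
  · exact one_half_pos

end Side

theorem exists_bound_of_summable {C : ℝ} {f : ℕ → ℝ}
    (h : Summable fun n : ℕ => Real.exp (C * n) * f n) :
    ∃ D, 0 ≤ D ∧ ∀ n, f n ≤ D * Real.exp (-C) ^ n := by
  obtain ⟨D, hD⟩ := h.tendsto_atTop_zero.bddAbove_range
  refine ⟨max D 0, le_max_right _ _, fun n => ?_⟩
  have hbound : Real.exp (C * n) * f n ≤ max D 0 := (hD ⟨n, rfl⟩).trans (le_max_left _ _)
  have hpow : Real.exp (-C) ^ n = (Real.exp (C * n))⁻¹ := by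
    rw [← Real.exp_nat_mul, ← Real.exp_neg, mul_neg, mul_comm]
  rwa [hpow, ← div_eq_mul_inv, le_div_iff₀' (Real.exp_pos _)]

theorem exists_zpow_bound {f : ℤ → ℝ} {M D w : ℝ} (hw : 0 < w) (hw1 : w ≤ 1)
    (hM : ∀ n, f n ≤ M) (hD : 0 ≤ D) (h : ∀ n : ℕ, f n ≤ D * w ^ n) :
    ∃ D', 0 ≤ D' ∧ ∀ n : ℤ, f n ≤ D' * w ^ n := by
  refine ⟨max D M, le_max_of_le_left hD, fun n => ?_⟩
  rcases le_total 0 n with hn | hn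
  · lift n to ℕ using hn
    rw [zpow_natCast]
    exact (h n).trans (by gcongr; exact le_max_left _ _)
  · calc f n ≤ max D M := (hM n).trans (le_max_right _ _)
      _ ≤ max D M * w ^ n :=
        le_mul_of_one_le_right (le_max_of_le_left hD) (one_le_zpow_of_nonpos₀ hw hw1 hn)

theorem exists_pos_lower_bound {f : ℤ → ℝ} {x y : ℝ} (hf : ∀ n, 0 < f n) (hx : 0 < x)
    (hy : 0 < y) (htop : Tendsto f atTop (𝓝 x)) (hbot : Tendsto f atBot (𝓝 y)) :
    ∃ m, 0 < m ∧ ∀ n, m ≤ f n := by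
  obtain ⟨N₁, hN₁⟩ := eventually_atTop.1 (htop.eventually_const_lt (half_lt_self hx))
  obtain ⟨N₂, hN₂⟩ := eventually_atBot.1 (hbot.eventually_const_lt (half_lt_self hy))
  obtain ⟨k, hk⟩ : ∃ k, ∀ n ∈ Set.Icc N₂ N₁, f k ≤ f n := by
    rcases (Set.Icc N₂ N₁).eq_empty_or_nonempty with hempty | hne
    · exact ⟨0, by simp [hempty]⟩
    · obtain ⟨k, -, hk⟩ := Set.exists_min_image _ f (Set.finite_Icc N₂ N₁) hne
      exact ⟨k, hk⟩
  refine ⟨min (f k) (min (x / 2) (y / 2)), by have := hf k; positivity, fun n => ?_⟩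
  rcases lt_or_ge N₁ n with h | h
  · exact ((min_le_right _ _).trans (min_le_left _ _)).trans (hN₁ n h.le).le
  rcases lt_or_ge n N₂ with h' | h'
  · exact ((min_le_right _ _).trans (min_le_right _ _)).trans (hN₂ n h'.le).le
  · exact (min_le_left _ _).trans (hk n ⟨h', h⟩)

theorem tendsto_zpow_atTop_zero {w : ℝ} (hw : 0 ≤ w) (hw1 : w < 1) :
    Tendsto (fun n : ℤ => w ^ n) atTop (𝓝 0) := by
  have hnat : Tendsto Int.toNat atTop atTop := tendsto_atTop.2 fun k => by
    filter_upwards [eventually_ge_atTop (k : ℤ)] with n hn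
    omega
  refine ((tendsto_pow_atTop_nhds_zero_of_lt_one hw hw1).comp hnat).congr' ?_
  filter_upwards [eventually_ge_atTop 0] with n hn
  rw [Function.comp_apply, ← zpow_natCast, Int.toNat_of_nonneg hn]

theorem tendsto_of_zpow_bound {f : ℤ → ℝ} {x D w : ℝ} (hw : 0 ≤ w) (hw1 : w < 1)
    (h : ∀ n, |f n - x| ≤ D * w ^ n) : Tendsto f atTop (𝓝 x) := by
  have hlim := (tendsto_zpow_atTop_zero hw hw1).const_mul D
  rw [mul_zero] at hlim
  rw [tendsto_iff_dist_tendsto_zero]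
  exact squeeze_zero (fun _ => dist_nonneg) h hlim

section

variable {c d C : ℝ}

theorem SteplikeDecay.exists_bound {a₀ b₀ : ℤ → ℝ} (hC : 0 ≤ C)
    (h : SteplikeDecay c d C a₀ b₀) (j : Side) :
    ∃ D, 0 ≤ D ∧ ∀ n : ℕ, |a₀ (j.bond n) - j.amp d| ≤ D * Real.exp (-C) ^ n ∧
      |b₀ (j.site n) - j.center c| ≤ D * Real.exp (-C) ^ n := by
  cases j
  · obtain ⟨D, hD, hbound⟩ := exists_bound_of_summable h.left
    refine ⟨D, hD, fun n => ⟨?_, ?_⟩⟩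
    · have hn := (le_add_of_nonneg_right (abs_nonneg _)).trans (hbound (n + 1))
      rw [Nat.cast_add_one, neg_add'] at hn
      exact hn.trans (mul_le_mul_of_nonneg_left (pow_le_pow_of_le_one (Real.exp_nonneg _)
        (Real.exp_le_one_iff.2 (neg_nonpos.2 hC)) n.le_succ) hD)
    · simp only [Side.site, Side.center, sub_neg_eq_add]
      exact (le_add_of_nonneg_left (abs_nonneg _)).trans (hbound n)
  · obtain ⟨D, hD, hbound⟩ := exists_bound_of_summable h.right
    refine ⟨D, hD, fun n => ⟨?_, ?_⟩⟩
    · exact (le_add_of_nonneg_right (abs_nonneg _)).trans (hbound n)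
    · simp only [Side.site, Side.center, sub_zero]
      exact (le_add_of_nonneg_left (abs_nonneg _)).trans (hbound n)

variable {a b : ℤ → ℝ → ℝ}

theorem IsTodaSolution.oriented (h : IsTodaSolution a b) (j : Side) :
    IsTodaSolution (fun n t => a (j.bond n) (j.sign * t))
      (fun n t => b (j.site n) (j.sign * t)) := by
  cases j
  · simpa only [Side.bond, Side.site, Side.sign, neg_one_mul] using h.reflect
  · simpa only [Side.bond, Side.site, Side.sign, one_mul] using h

theorem IsTodaSolution.exists_zpow_bound_bgDiff (h : IsTodaSolution a b) (hC : 0 ≤ C)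
    (hdecay : SteplikeDecay c d C (a · 0) (b · 0)) (j : Side) :
    ∃ D, 0 ≤ D ∧ ∀ n : ℤ, ‖bgDiff (j.amp d) (j.center c) (fun n t => a (j.bond n) (j.sign * t))
      (fun n t => b (j.site n) (j.sign * t)) n 0‖ ≤ D * Real.exp (-C) ^ n := by
  obtain ⟨M, hM⟩ := (h.oriented j).bounded 0
  obtain ⟨D, hD, hbound⟩ := hdecay.exists_bound hC j
  refine exists_zpow_bound (Real.exp_pos _) (Real.exp_le_one_iff.2 (neg_nonpos.2 hC))
    (fun n => norm_bgDiff_le (hM n 0 (by simp))) hD fun n => ?_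
  simpa [bgDiff, Prod.norm_def] using hbound n

theorem IsTodaSolution.exists_pos_lower_bound (h : IsTodaSolution a b) (hC : 0 < C) (hd : 0 < d)
    (hpos : ∀ n, 0 < a n 0) (hdecay : SteplikeDecay c d C (a · 0) (b · 0)) :
    ∃ m, 0 < m ∧ ∀ n, m ≤ a n 0 := by
  have hlim (j : Side) : Tendsto (fun n => a (j.bond n) 0) atTop (𝓝 (j.amp d)) := by
    obtain ⟨D, -, hD⟩ := h.exists_zpow_bound_bgDiff hC.le hdecay j
    have := tendsto_of_zpow_bound (Real.exp_nonneg _) (Real.exp_lt_one_iff.2 (neg_neg_of_pos hC))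
      fun n => (abs_a_sub_le_norm_bgDiff _ _ n 0).trans (hD n)
    simpa using this
  have hleft : Tendsto (fun n : ℤ => -n - 1) atBot atTop :=
    tendsto_atTop_add_const_right _ _ tendsto_neg_atBot_atTop
  refine TodaShock.exists_pos_lower_bound hpos one_half_pos hd (hlim .right) ?_
  simpa [Function.comp_def, Side.bond, Side.amp] using (hlim .left).comp hleft

theorem IsTodaSolution.exists_backgrounds (h : IsTodaSolution a b) (hC : 0 < C) (hd : 0 < d)
    (hpos : ∀ n, 0 < a n 0) (hdecay : SteplikeDecay c d C (a · 0) (b · 0)) (j : Side) (τ : ℝ) :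
    ∃ m Q ρ, ∀ t, |t| ≤ τ →
      HasBackground (j.amp d) (j.center c) m Q ρ ((a · t) ∘ j.bond) ((b · t) ∘ j.site) := by
  obtain ⟨m, hm, hle⟩ := h.exists_pos_lower_bound hC hd hpos hdecay
  obtain ⟨D, hD, hbound⟩ := h.exists_zpow_bound_bgDiff hC.le hdecay j
  obtain ⟨m', Q, hbg⟩ := (h.oriented j).exists_hasBackground hm hD (Real.exp_pos _)
    (Real.exp_lt_one_iff.2 (neg_neg_of_pos hC)) (fun n => by simpa using hle _) hbound τ
  refine ⟨m', Q, √(Real.exp (-C)), fun t ht => ?_⟩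
  have := hbg (j.sign * t) (by simpa [abs_mul] using ht)
  simpa only [← mul_assoc, Side.sign_mul_sign, one_mul, Function.comp_def] using this

end

/-! ### The Joukowski variable of a band -/

/-- The spectrum `[B - 2A, B + 2A]` of the constant background `(A, B)`, as a subset of `ℂ`. -/
def band (A B : ℝ) : Set ℂ := (fun x : ℝ => (x : ℂ)) '' Set.Icc (B - 2 * A) (B + 2 * A)

/-- The branch of `√((lam - B)² - 4A²)` which is holomorphic off the band. -/
def root (A B : ℝ) (lam : ℂ) : ℂ := bandRoot (B - 2 * A) (B + 2 * A) lam

/-- The Joukowski variable of a band: the solution of `lam = B + A (z + z⁻¹)` inside the unit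
disk. -/
def jouk (A B : ℝ) (lam : ℂ) : ℂ := (lam - B - root A B lam) / (2 * A)

/-- `√((lam - (B + 2A)) / (lam - (B - 2A)))`, in the right half plane for `lam` off the band. -/
def sqrtRatio (A B : ℝ) (lam : ℂ) : ℂ := ((lam - (B + 2 * A)) / (lam - (B - 2 * A))) ^ (1 / 2 : ℂ)

theorem re_cpow_half_pos {w : ℂ} (hw : w ∈ Complex.slitPlane) : 0 < (w ^ (1 / 2 : ℂ)).re := by
  rw [one_div, Complex.cpow_inv_two_re, Real.sqrt_pos]
  refine half_pos ?_
  rcases hw with hre | him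
  · exact add_pos_of_nonneg_of_pos (norm_nonneg w) hre
  · linarith [neg_abs_le w.re, Complex.abs_re_lt_norm.2 him]

theorem one_add_ne_zero_of_re_pos {r : ℂ} (hr : 0 < r.re) : 1 + r ≠ 0 := fun h => by
  have := congrArg Complex.re h
  simp only [Complex.add_re, Complex.one_re, Complex.zero_re] at this
  linarith

theorem norm_cayley_lt_one {r : ℂ} (hr : 0 < r.re) : ‖(1 - r) / (1 + r)‖ < 1 := by
  rw [norm_div, div_lt_one (norm_pos_iff.2 (one_add_ne_zero_of_re_pos hr))]
  refine lt_of_pow_lt_pow_left₀ 2 (norm_nonneg _) ?_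
  simp only [Complex.sq_norm, Complex.normSq_apply, Complex.add_re, Complex.sub_re, Complex.one_re,
    Complex.add_im, Complex.sub_im, Complex.one_im]
  linarith

theorem root_sq (A B : ℝ) (lam : ℂ) : root A B lam ^ 2 = (lam - B) ^ 2 - 4 * A ^ 2 := by
  rw [root, bandRoot_sq]
  ring

section

variable {A B : ℝ} {lam : ℂ}

theorem ofReal_mem_band {x : ℝ} : (x : ℂ) ∈ band A B ↔ x ∈ Set.Icc (B - 2 * A) (B + 2 * A) := by
  simp [band]

theorem isCompact_band : IsCompact (band A B) := isCompact_Icc.image Complex.continuous_ofReal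

theorem not_mem_band_of_im_ne_zero (h : lam.im ≠ 0) : lam ∉ band A B := by
  rintro ⟨x, -, rfl⟩
  exact h (Complex.ofReal_im x)

theorem sub_lower_edge_ne_zero (hA : 0 < A) (h : lam ∉ band A B) : lam - (B - 2 * A) ≠ 0 := by
  refine fun h₀ => h ⟨B - 2 * A, ⟨le_rfl, by linarith⟩, ?_⟩
  push_cast
  exact (sub_eq_zero.1 h₀).symm

theorem root_ne_zero (hA : 0 < A) (h : lam ∉ band A B) : root A B lam ≠ 0 := by
  intro h₀
  have hsq : root A B lam ^ 2 = (lam - (B - 2 * A)) * (lam - (B + 2 * A)) := bandRoot_sq _ _ _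
  rw [h₀, zero_pow two_ne_zero, zero_eq_mul] at hsq
  refine hsq.elim (sub_lower_edge_ne_zero hA h) fun hupper =>
    h ⟨B + 2 * A, ⟨by linarith, le_rfl⟩, ?_⟩
  push_cast
  exact (sub_eq_zero.1 hupper).symm

theorem ratio_mem_slitPlane (hA : 0 < A) (h : lam ∉ band A B) :
    (lam - (B + 2 * A)) / (lam - (B - 2 * A)) ∈ Complex.slitPlane := by
  have h₀ := sub_lower_edge_ne_zero hA h
  by_contra hslit
  rw [Complex.mem_slitPlane_iff_not_le_zero, not_not, Complex.le_def] at hslit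
  obtain ⟨hre, him⟩ := hslit
  set w := (lam - (B + 2 * A)) / (lam - (B - 2 * A)) with hw
  have hreal : w = (w.re : ℂ) := Complex.ext rfl him
  set x := w.re
  have hx : 0 < 1 - x := by
    have : x ≤ 0 := hre
    linarith
  have hlam : lam = (((B + 2 * A) - x * (B - 2 * A)) / (1 - x) : ℝ) := by
    have hmul : lam - (B + 2 * A) = x * (lam - (B - 2 * A)) := by
      rw [← hreal, hw, div_mul_cancel₀ _ h₀]
    push_cast
    rw [eq_div_iff (by exact_mod_cast hx.ne')]
    linear_combination hmul
  rw [hlam, ofReal_mem_band] at h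
  refine h ⟨?_, ?_⟩
  · rw [le_div_iff₀ hx]
    linarith
  · rw [div_le_iff₀ hx]
    nlinarith [show x ≤ 0 from hre]

theorem re_sqrtRatio_pos (hA : 0 < A) (h : lam ∉ band A B) : 0 < (sqrtRatio A B lam).re :=
  re_cpow_half_pos (ratio_mem_slitPlane hA h)

theorem differentiableAt_root (hA : 0 < A) (h : lam ∉ band A B) :
    DifferentiableAt ℂ (root A B) lam := by
  have hratio : DifferentiableAt ℂ
      (fun lam : ℂ => (lam - (B + 2 * A)) / (lam - (B - 2 * A))) lam :=
    DifferentiableAt.fun_div (by fun_prop) (by fun_prop) (sub_lower_edge_ne_zero hA h)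
  exact DifferentiableAt.fun_mul (by fun_prop)
    (hratio.cpow (by fun_prop) (ratio_mem_slitPlane hA h))

theorem differentiableAt_jouk (hA : 0 < A) (h : lam ∉ band A B) :
    DifferentiableAt ℂ (jouk A B) lam := by
  have := differentiableAt_root hA h
  unfold jouk
  fun_prop

theorem root_conj (hA : 0 < A) (h : lam ∉ band A B) :
    root A B (starRingEnd ℂ lam) = starRingEnd ℂ (root A B lam) := by
  have hcpow := Complex.conj_cpow _ (1 / 2 : ℂ)
    (Complex.mem_slitPlane_iff_arg.1 (ratio_mem_slitPlane hA h)).1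
  simp only [map_div₀, map_sub, map_add, map_mul, Complex.conj_ofReal, map_ofNat, map_one] at hcpow
  simp only [root, bandRoot, map_mul, map_sub, Complex.conj_ofReal, map_ofNat, hcpow]

theorem jouk_eq_cayley (hA : 0 < A) (h : lam ∉ band A B) :
    jouk A B lam = (1 - sqrtRatio A B lam) / (1 + sqrtRatio A B lam) := by
  have hA₀ : (2 * A : ℂ) ≠ 0 := by exact_mod_cast (mul_pos two_pos hA).ne'
  have hroot : root A B lam = (lam - (B - 2 * A)) * sqrtRatio A B lam := rfl
  have hsq : sqrtRatio A B lam ^ 2 * (lam - (B - 2 * A)) = lam - (B + 2 * A) := by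
    rw [show sqrtRatio A B lam ^ 2 = (lam - (B + 2 * A)) / (lam - (B - 2 * A)) by simp [sqrtRatio],
      div_mul_cancel₀ _ (sub_lower_edge_ne_zero hA h)]
  rw [jouk, hroot, div_eq_div_iff hA₀ (one_add_ne_zero_of_re_pos (re_sqrtRatio_pos hA h))]
  linear_combination -hsq

theorem norm_jouk_lt_one (hA : 0 < A) (h : lam ∉ band A B) : ‖jouk A B lam‖ < 1 := by
  rw [jouk_eq_cayley hA h]
  exact norm_cayley_lt_one (re_sqrtRatio_pos hA h)

theorem tendsto_sub_const_cobounded (x : ℂ) :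
    Tendsto (fun lam : ℂ => lam - x) (Bornology.cobounded ℂ) (Bornology.cobounded ℂ) := by
  rw [← tendsto_norm_atTop_iff_cobounded]
  refine tendsto_atTop_mono (fun lam => norm_sub_norm_le lam x) ?_
  exact tendsto_atTop_add_const_right _ (-‖x‖) tendsto_norm_cobounded_atTop

theorem eventually_not_mem_band : ∀ᶠ lam in Bornology.cobounded ℂ, lam ∉ band A B :=
  isCompact_band.isBounded

theorem tendsto_sqrtRatio_cobounded (hA : 0 < A) :
    Tendsto (sqrtRatio A B) (Bornology.cobounded ℂ) (𝓝 1) := by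
  have hratio : Tendsto (fun lam : ℂ => 1 - 4 * A * (lam - (B - 2 * A))⁻¹)
      (Bornology.cobounded ℂ) (𝓝 1) := by
    simpa [Function.comp_def] using ((tendsto_inv₀_cobounded.comp
      (tendsto_sub_const_cobounded (B - 2 * A))).const_mul (4 * A : ℂ)).const_sub 1
  have hcpow := (continuousAt_cpow_const (b := (1 / 2 : ℂ)) Complex.one_mem_slitPlane).tendsto
  rw [Complex.one_cpow] at hcpow
  refine (hcpow.comp hratio).congr' ?_
  filter_upwards [eventually_not_mem_band] with lam hlam
  have h₀ := sub_lower_edge_ne_zero hA hlam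
  simp only [Function.comp_apply, sqrtRatio]
  congr 1
  rw [eq_div_iff h₀, sub_mul, mul_assoc, inv_mul_cancel₀ h₀]
  ring

theorem tendsto_jouk_cobounded (hA : 0 < A) :
    Tendsto (jouk A B) (Bornology.cobounded ℂ) (𝓝 0) := by
  have hratio := tendsto_sqrtRatio_cobounded (B := B) hA
  have hcayley := (hratio.const_sub 1).div (hratio.const_add 1) (by norm_num)
  rw [sub_self, zero_div] at hcayley
  refine hcayley.congr' ?_
  filter_upwards [eventually_not_mem_band] with lam hlam
  exact (jouk_eq_cayley hA hlam).symm

end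

theorem joukowski_relations {A B lam s z : ℂ} (hA : A ≠ 0)
    (hs : s ^ 2 = (lam - B) ^ 2 - 4 * A ^ 2) (hz : z = (lam - B - s) / (2 * A)) :
    z ≠ 0 ∧ lam = B + A * (z + z⁻¹) ∧ s = A * (z⁻¹ - z) := by
  have hmul : z * ((lam - B + s) / (2 * A)) = 1 := by
    rw [hz]
    field_simp
    linear_combination -hs
  have hinv : z⁻¹ = (lam - B + s) / (2 * A) := inv_eq_of_mul_eq_one_right hmul
  refine ⟨left_ne_zero_of_mul_eq_one hmul, ?_, ?_⟩ <;>
  · rw [hinv, hz]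
    field_simp
    ring

/-! ### The two-sheeted surface -/

/-- The standing assumptions on the position of the bands. -/
structure BandGap (c d : ℝ) : Prop where
  d_pos : 0 < d
  gap : 2 * d < c - 1

namespace Side

/-- The band `I_j`. -/
def band (c d : ℝ) (j : Side) : Set ℂ := TodaShock.band (j.amp d) (j.center c)

/-- The root belonging to the band `I_j`, holomorphic off it. -/
def root (c d : ℝ) (j : Side) : ℂ → ℂ := TodaShock.root (j.amp d) (j.center c)

/-- The contour `Σ_j`. -/
def cut (c d : ℝ) (j : Side) : Set (Curve c d) := {p | p.lam ∈ j.band c d}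

variable {c d : ℝ}

/-- The root `s_j` on `clos Π_U`. -/
def s : Side → Curve c d → ℂ
  | left => s1
  | right => s2

/-- The Joukowski variable `z_j` on `clos Π_U`. -/
def z : Side → Curve c d → ℂ
  | left => z1
  | right => z2

theorem root_left : left.root c d = root1 c d := by
  funext lam
  simp [root, TodaShock.root, amp, center, root1]

theorem root_right : right.root c d = root2 := by
  funext lam
  simp [root, TodaShock.root, amp, center, root2]

theorem band_right : right.band c d = I2 := by
  simp [band, TodaShock.band, amp, center, I2]

theorem cut_right : right.cut c d = Sigma2 c d := by
  simp only [cut, band_right]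
  rfl

theorem s_eq_onClosU (j : Side) (p : Curve c d) : j.s p = onClosU (j.root c d) p := by
  cases j
  · rw [root_left]
    rfl
  · rw [root_right]
    rfl

theorem z_eq (j : Side) (p : Curve c d) :
    j.z p = (p.lam - (j.center c : ℝ) - j.s p) / (2 * (j.amp d : ℝ)) := by
  cases j
  · simp [z, s, z1, center, amp]
  · simp [z, s, z2, center, amp]

end Side

variable {c d : ℝ}

theorem mem_bands_iff (j : Side) {lam : ℂ} :
    lam ∈ bands c d ↔ lam ∈ j.band c d ∨ lam ∈ j.other.band c d := by
  cases j
  · rw [Side.other, Side.band_right]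
    rfl
  · rw [Side.other, Side.band_right, or_comm]
    rfl

theorem mem_Sig_iff (j : Side) {p : Curve c d} :
    p ∈ Sig c d ↔ p ∈ j.cut c d ∨ p ∈ j.other.cut c d := mem_bands_iff j

theorem Rhalf_eq (j : Side) (lam : ℂ) :
    Rhalf c d lam = -(j.root c d lam * j.other.root c d lam) := by
  cases j <;> simp only [Side.other, Side.root_left, Side.root_right, Rhalf, mul_comm]

theorem lam_not_mem_band (j : Side) {p : Curve c d} (hp : p ∈ PiU c d) : p.lam ∉ j.band c d :=
  fun h => hp.1 ((mem_bands_iff j).2 (Or.inl h))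

theorem not_mem_bands_of_im_ne_zero {lam : ℂ} (h : lam.im ≠ 0) : lam ∉ bands c d := by
  rw [mem_bands_iff Side.left, not_or]
  exact ⟨not_mem_band_of_im_ne_zero h, not_mem_band_of_im_ne_zero h⟩

theorem upperPt_mem {lam : ℂ} (h : lam ∉ bands c d) : upperPt c d lam ∈ PiU c d := ⟨h, rfl⟩

theorem not_mem_PiU_of_mem_Sig {p : Curve c d} (hp : p ∈ Sig c d) : p ∉ PiU c d :=
  fun h => h.1 hp

namespace Curve

theorem continuous_lam : Continuous (lam : Curve c d → ℂ) :=
  continuous_fst.comp continuous_subtype_val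

theorem continuous_w : Continuous (w : Curve c d → ℂ) :=
  continuous_snd.comp continuous_subtype_val

theorem continuous_star : Continuous (star : Curve c d → Curve c d) :=
  Continuous.subtype_mk (continuous_lam.prodMk continuous_w.neg) _

@[simp] theorem star_star (p : Curve c d) : p.star.star = p := by simp [star]

@[simp] theorem lam_star (p : Curve c d) : p.star.lam = p.lam := rfl

@[simp] theorem w_star (p : Curve c d) : p.star.w = -p.w := rfl

theorem w_sq (j : Side) (p : Curve c d) :
    p.w ^ 2 = ((p.lam - (j.center c : ℝ)) ^ 2 - 4 * (j.amp d : ℝ) ^ 2) *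
      ((p.lam - (j.other.center c : ℝ)) ^ 2 - 4 * (j.other.amp d : ℝ) ^ 2) := by
  refine Eq.trans (b := (p.lam ^ 2 - 1) * ((p.lam + c) ^ 2 - 4 * (d : ℂ) ^ 2)) p.2 ?_
  cases j <;>
  · simp only [Side.other, Side.center, Side.amp]
    push_cast
    ring

end Curve

theorem star_mem_Sig {p : Curve c d} : p.star ∈ Sig c d ↔ p ∈ Sig c d := Iff.rfl

theorem star_mem_PiU {p : Curve c d} : p.star ∈ PiU c d ↔ p ∈ PiL c d := by
  simp [PiU, PiL, neg_eq_iff_eq_neg]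

theorem star_mem_PiL {p : Curve c d} : p.star ∈ PiL c d ↔ p ∈ PiU c d := by
  simp [PiU, PiL]

theorem tendsto_star_PiL (p : Curve c d) :
    Tendsto Curve.star (𝓝[PiL c d] p) (𝓝[PiU c d] p.star) :=
  tendsto_nhdsWithin_iff.2 ⟨Curve.continuous_star.continuousAt.tendsto.mono_left
    nhdsWithin_le_nhds, eventually_nhdsWithin_of_forall fun _ hq => star_mem_PiU.2 hq⟩

theorem tendsto_star_PiU (p : Curve c d) :
    Tendsto Curve.star (𝓝[PiU c d] p) (𝓝[PiL c d] p.star) :=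
  tendsto_nhdsWithin_iff.2 ⟨Curve.continuous_star.continuousAt.tendsto.mono_left
    nhdsWithin_le_nhds, eventually_nhdsWithin_of_forall fun _ hq => star_mem_PiL.2 hq⟩

theorem tendsto_lam (p : Curve c d) : Tendsto Curve.lam (𝓝[PiU c d] p) (𝓝 p.lam) :=
  Curve.continuous_lam.continuousAt.tendsto.mono_left nhdsWithin_le_nhds

theorem exists_lam_eq_ofReal {p : Curve c d} (hp : p ∈ Sig c d) : ∃ x : ℝ, p.lam = x := by
  rcases hp with ⟨x, -, hx⟩ | ⟨x, -, hx⟩ <;> exact ⟨x, hx.symm⟩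

theorem conj_lam {p : Curve c d} (hp : p ∈ Sig c d) : starRingEnd ℂ p.lam = p.lam := by
  obtain ⟨x, hx⟩ := exists_lam_eq_ofReal hp
  rw [hx, Complex.conj_ofReal]

theorem re_eq_zero_of_sq_eq_nonpos {w : ℂ} {y : ℝ} (h : w ^ 2 = y) (hy : y ≤ 0) : w.re = 0 := by
  have hre : w.re * w.re - w.im * w.im = y := by simpa [sq] using congrArg Complex.re h
  have him : w.re * w.im = 0 := by
    have := congrArg Complex.im h
    simp only [sq, Complex.mul_im, Complex.ofReal_im] at this
    linarith
  rcases mul_eq_zero.1 him with h₀ | h₀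
  · exact h₀
  · rw [h₀, mul_zero, sub_zero] at hre
    exact mul_self_eq_zero.1 (le_antisymm (hre ▸ hy) (mul_self_nonneg _))

theorem norm_sub_lt_or_norm_add_lt {u w : ℂ} {ε : ℝ} (hε : 0 < ε) (h : ‖u ^ 2 - w ^ 2‖ < ε ^ 2) :
    ‖u - w‖ < ε ∨ ‖u + w‖ < ε := by
  by_contra! hcon
  rw [sq_sub_sq, norm_mul, sq] at h
  exact h.not_ge (mul_le_mul hcon.2 hcon.1 hε.le (norm_nonneg _))

namespace BandGap

variable {j : Side} {p : Curve c d}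

theorem amp_pos (h : BandGap c d) (j : Side) : 0 < j.amp d := Side.amp_pos j h.d_pos

theorem amp_ne_zero (h : BandGap c d) (j : Side) : ((j.amp d : ℝ) : ℂ) ≠ 0 :=
  Complex.ofReal_ne_zero.2 (h.amp_pos j).ne'

theorem not_mem_band_of_mem_other (h : BandGap c d) {lam : ℂ} (hl : lam ∈ j.other.band c d) :
    lam ∉ j.band c d := by
  obtain ⟨x, hx, rfl⟩ := hl
  have := h.gap
  rw [Side.band, ofReal_mem_band]
  cases j <;>
  · simp only [Side.other, Side.center, Side.amp, Set.mem_Icc] at hx ⊢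
    rintro ⟨_, _⟩
    linarith

theorem not_mem_PiU_of_mem_PiL (h : BandGap c d) (hp : p ∈ PiL c d) : p ∉ PiU c d := by
  intro hU
  have hzero : Rhalf c d p.lam = 0 := by
    have := hp.2.symm.trans hU.2
    linear_combination (-1 / 2) * this
  rw [Rhalf_eq Side.left, neg_eq_zero, mul_eq_zero] at hzero
  exact hzero.elim (root_ne_zero (h.amp_pos _) (lam_not_mem_band _ hU))
    (root_ne_zero (h.amp_pos _) (lam_not_mem_band _ hU))

theorem conj_w (h : BandGap c d) (hp : p ∈ Sig c d) : starRingEnd ℂ p.w = -p.w := by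
  obtain ⟨j, hj⟩ : ∃ j : Side, p ∈ j.cut c d :=
    ((mem_Sig_iff Side.left).1 hp).elim (fun h => ⟨_, h⟩) (fun h => ⟨_, h⟩)
  have hother : p.lam ∉ j.other.band c d :=
    h.not_mem_band_of_mem_other ((Side.other_other j).symm ▸ hj)
  obtain ⟨x, hin, hx⟩ := hj
  have hout : x ∉ Set.Icc _ _ := fun hmem => hother ⟨x, hmem, hx⟩
  have hneg : (x - j.center c) ^ 2 - 4 * j.amp d ^ 2 ≤ 0 := by nlinarith [hin.1, hin.2]
  have hpos : 0 ≤ (x - j.other.center c) ^ 2 - 4 * j.other.amp d ^ 2 := by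
    have hA := h.amp_pos j.other
    rw [Set.mem_Icc, not_and_or, not_le, not_le] at hout
    rcases hout with hlt | hlt <;> nlinarith
  have hre : p.w.re = 0 := by
    refine re_eq_zero_of_sq_eq_nonpos ?_ (mul_nonpos_of_nonpos_of_nonneg hneg hpos)
    rw [p.w_sq j, ← hx]
    push_cast
    ring
  exact Complex.ext (by simp [hre]) (by simp)

theorem Rhalf_conj (h : BandGap c d) {lam : ℂ} (hl : lam ∉ bands c d) :
    Rhalf c d (starRingEnd ℂ lam) = starRingEnd ℂ (Rhalf c d lam) := by
  rw [mem_bands_iff Side.left, not_or] at hl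
  rw [Rhalf_eq Side.left, Rhalf_eq Side.left, map_neg, map_mul]
  congr 2
  · exact root_conj (h.amp_pos _) hl.1
  · exact root_conj (h.amp_pos _) hl.2

theorem exists_near_of_mem_Sig (hp : p ∈ Sig c d) {ε : ℝ} (hε : 0 < ε) :
    ∃ lam : ℂ, lam.im ≠ 0 ∧ dist lam p.lam < ε ∧ ‖Rhalf c d lam ^ 2 - p.w ^ 2‖ < ε ^ 2 := by
  obtain ⟨x, hx⟩ := exists_lam_eq_ofReal hp
  have hline : Tendsto (fun y : ℝ => (x + y * Complex.I : ℂ)) (𝓝[≠] 0) (𝓝 p.lam) := by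
    have : Continuous fun y : ℝ => (x + y * Complex.I : ℂ) := by fun_prop
    simpa [hx] using (this.tendsto 0).mono_left nhdsWithin_le_nhds
  have hpoly : Continuous fun lam : ℂ => (lam ^ 2 - 1) * ((lam + c) ^ 2 - 4 * (d : ℂ) ^ 2) := by
    fun_prop
  have hsq := ((hpoly.tendsto p.lam).comp hline).eventually (Metric.ball_mem_nhds _ (pow_pos hε 2))
  obtain ⟨y, hsq, hdist, hy⟩ :=
    (hsq.and ((hline.eventually (Metric.ball_mem_nhds _ hε)).and self_mem_nhdsWithin)).exists
  refine ⟨x + y * Complex.I, by simpa using hy, hdist, ?_⟩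
  have hR : Rhalf c d (x + y * Complex.I) ^ 2 = _ := (upperPt c d (x + y * Complex.I)).2
  have hw : p.w ^ 2 = _ := p.2
  rw [hR, hw]
  exact mem_ball_iff_norm.1 hsq

theorem mem_closure_PiU (h : BandGap c d) (hp : p ∈ Sig c d) : p ∈ closure (PiU c d) := by
  refine Metric.mem_closure_iff.2 fun ε hε => ?_
  obtain ⟨lam, him, hdist, hsq⟩ := exists_near_of_mem_Sig hp hε
  have hlam : lam ∉ bands c d := not_mem_bands_of_im_ne_zero him
  rcases norm_sub_lt_or_norm_add_lt hε hsq with hw | hw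
  · refine ⟨upperPt c d lam, upperPt_mem hlam, ?_⟩
    rw [dist_comm, Subtype.dist_eq, Prod.dist_eq]
    exact max_lt hdist (by rwa [dist_eq_norm])
  · refine ⟨upperPt c d (starRingEnd ℂ lam), upperPt_mem (not_mem_bands_of_im_ne_zero ?_), ?_⟩
    · rwa [Complex.conj_im, neg_ne_zero]
    rw [dist_comm, Subtype.dist_eq, Prod.dist_eq]
    refine max_lt ?_ ?_
    · change dist (starRingEnd ℂ lam) p.lam < ε
      rwa [← conj_lam hp, Complex.dist_conj_conj]
    · change dist (Rhalf c d (starRingEnd ℂ lam)) p.w < ε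
      rwa [h.Rhalf_conj hlam, Complex.dist_conj_comm, h.conj_w hp, dist_eq_norm, sub_neg_eq_add]

theorem neBot_PiU (h : BandGap c d) (hp : p ∈ Sig c d) : (𝓝[PiU c d] p).NeBot :=
  mem_closure_iff_nhdsWithin_neBot.1 (h.mem_closure_PiU hp)

theorem neBot_PiL (h : BandGap c d) (hp : p ∈ Sig c d) : (𝓝[PiL c d] p).NeBot := by
  have := h.neBot_PiU (star_mem_Sig.2 hp)
  simpa only [Curve.star_star] using (tendsto_star_PiU p.star).neBot

end BandGap

/-! ### Boundary values of the roots and of the Joukowski variables -/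

section

variable {p : Curve c d}

theorem onClosU_of_mem {f : ℂ → ℂ} (hp : p ∈ PiU c d) : onClosU f p = f p.lam := if_pos hp

theorem onClosU_eq_of_tendsto (h : BandGap c d) {f : ℂ → ℂ} (hp : p ∈ Sig c d) {y : ℂ}
    (hf : Tendsto (fun q : Curve c d => f q.lam) (𝓝[PiU c d] p) (𝓝 y)) : onClosU f p = y := by
  have := h.neBot_PiU hp
  rw [onClosU, if_neg (not_mem_PiU_of_mem_Sig hp)]
  exact hf.limUnder_eq

theorem tendsto_of_mul_eq_neg_w {f g : ℂ → ℂ} (hg : ContinuousAt g p.lam) (hg₀ : g p.lam ≠ 0)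
    (hfg : ∀ q ∈ PiU c d, f q.lam * g q.lam = -q.w) :
    Tendsto (fun q : Curve c d => f q.lam) (𝓝[PiU c d] p) (𝓝 (-p.w / g p.lam)) := by
  have hglim := hg.tendsto.comp (tendsto_lam p)
  have hw : Tendsto (fun q : Curve c d => -q.w) (𝓝[PiU c d] p) (𝓝 (-p.w)) :=
    (Curve.continuous_w.neg.tendsto p).mono_left nhdsWithin_le_nhds
  refine (hw.div hglim hg₀).congr' ?_
  filter_upwards [hglim.eventually_ne hg₀, self_mem_nhdsWithin] with q hq hqU
  exact (div_eq_iff hq).2 (hfg q hqU).symm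

theorem root_mul_root_other (j : Side) (hp : p ∈ PiU c d) :
    j.root c d p.lam * j.other.root c d p.lam = -p.w := by
  rw [hp.2, Rhalf_eq j, neg_neg]

end

theorem norm_eq_one_of_conj_eq_inv {z : ℂ} (hz : z ≠ 0) (h : starRingEnd ℂ z = z⁻¹) :
    ‖z‖ = 1 := by
  have hnorm := congrArg norm h
  rw [Complex.norm_conj, norm_inv, ← mul_eq_one_iff_eq_inv₀ (norm_ne_zero_iff.2 hz), ← sq] at hnorm
  exact (pow_eq_one_iff_of_nonneg (norm_nonneg z) two_ne_zero).1 hnorm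

namespace BandGap

variable {j : Side} {p : Curve c d}

theorem not_mem_band_of_mem_cut_other (h : BandGap c d) (hp : p ∈ j.other.cut c d) :
    p.lam ∉ j.band c d := h.not_mem_band_of_mem_other hp

theorem lam_not_mem_band_other (h : BandGap c d) (hp : p ∈ j.cut c d) :
    p.lam ∉ j.other.band c d :=
  h.not_mem_band_of_mem_other (j.other_other.symm ▸ hp)

theorem continuousAt_root (h : BandGap c d) {lam : ℂ} (hl : lam ∉ j.band c d) :
    ContinuousAt (j.root c d) lam :=
  (differentiableAt_root (h.amp_pos j) hl).continuousAt

theorem root_ne_zero (h : BandGap c d) {lam : ℂ} (hl : lam ∉ j.band c d) : j.root c d lam ≠ 0 :=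
  TodaShock.root_ne_zero (h.amp_pos j) hl

theorem s_eq_root (h : BandGap c d) (hp : p ∈ closU c d) (hl : p.lam ∉ j.band c d) :
    j.s p = j.root c d p.lam := by
  rw [Side.s_eq_onClosU]
  exact hp.elim onClosU_of_mem fun hp =>
    onClosU_eq_of_tendsto h hp ((h.continuousAt_root hl).tendsto.comp (tendsto_lam p))

theorem tendsto_root_of_mem_cut (h : BandGap c d) (hp : p ∈ j.cut c d) :
    Tendsto (fun q : Curve c d => j.root c d q.lam) (𝓝[PiU c d] p)
      (𝓝 (-p.w / j.other.root c d p.lam)) :=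
  tendsto_of_mul_eq_neg_w (h.continuousAt_root (h.lam_not_mem_band_other hp))
    (h.root_ne_zero (h.lam_not_mem_band_other hp)) fun _ hq => root_mul_root_other j hq

theorem s_eq_div (h : BandGap c d) (hp : p ∈ j.cut c d) :
    j.s p = -p.w / j.other.root c d p.lam := by
  rw [Side.s_eq_onClosU]
  exact onClosU_eq_of_tendsto h ((mem_Sig_iff j).2 (Or.inl hp)) (h.tendsto_root_of_mem_cut hp)

theorem s_of_mem (j : Side) (hp : p ∈ PiU c d) : j.s p = j.root c d p.lam := by
  rw [Side.s_eq_onClosU, onClosU_of_mem hp]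

theorem z_of_mem (j : Side) (hp : p ∈ PiU c d) :
    j.z p = jouk (j.amp d) (j.center c) p.lam := by
  rw [Side.z_eq, s_of_mem j hp]
  rfl

theorem tendsto_s (h : BandGap c d) (j : Side) (hp : p ∈ Sig c d) :
    Tendsto j.s (𝓝[PiU c d] p) (𝓝 (j.s p)) := by
  refine Tendsto.congr' (eventually_nhdsWithin_of_forall fun q hq => (s_of_mem j hq).symm) ?_
  rcases (mem_Sig_iff j).1 hp with hj | hj
  · rw [h.s_eq_div hj]
    exact h.tendsto_root_of_mem_cut hj
  · rw [h.s_eq_root (Or.inr hp) (h.not_mem_band_of_mem_cut_other hj)]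
    exact (h.continuousAt_root (h.not_mem_band_of_mem_cut_other hj)).tendsto.comp (tendsto_lam p)

theorem tendsto_z (h : BandGap c d) (j : Side) (hp : p ∈ Sig c d) :
    Tendsto j.z (𝓝[PiU c d] p) (𝓝 (j.z p)) := by
  simp only [funext (j.z_eq (c := c) (d := d))]
  exact (((tendsto_lam p).sub_const _).sub (h.tendsto_s j hp)).div_const _

theorem s_sq (h : BandGap c d) (j : Side) (hp : p ∈ closU c d) :
    j.s p ^ 2 = (p.lam - (j.center c : ℝ)) ^ 2 - 4 * (j.amp d : ℝ) ^ 2 := by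
  rcases hp with hp | hp
  · rw [s_of_mem j hp]
    exact root_sq _ _ _
  · have := h.neBot_PiU hp
    refine tendsto_nhds_unique ((h.tendsto_s j hp).pow 2) ((((tendsto_lam p).sub_const
      _).pow 2).sub_const _ |>.congr' (eventually_nhdsWithin_of_forall fun q hq => ?_))
    change _ = j.s q ^ 2
    rw [s_of_mem j hq]
    exact (root_sq _ _ _).symm

theorem z_relations (h : BandGap c d) (j : Side) (hp : p ∈ closU c d) :
    j.z p ≠ 0 ∧ p.lam = (j.center c : ℝ) + (j.amp d : ℝ) * (j.z p + (j.z p)⁻¹) ∧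
      j.s p = (j.amp d : ℝ) * ((j.z p)⁻¹ - j.z p) :=
  joukowski_relations (h.amp_ne_zero j) (h.s_sq j hp) (j.z_eq p)

theorem z_ne_zero (h : BandGap c d) (j : Side) (hp : p ∈ closU c d) : j.z p ≠ 0 :=
  (h.z_relations j hp).1

theorem conj_root_lam (h : BandGap c d) (hp : p ∈ Sig c d) (hl : p.lam ∉ j.band c d) :
    starRingEnd ℂ (j.root c d p.lam) = j.root c d p.lam := by
  refine (root_conj (h.amp_pos j) hl).symm.trans ?_
  rw [conj_lam hp]
  rfl

theorem conj_s_of_mem_other (h : BandGap c d) (hp : p ∈ j.other.cut c d) :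
    starRingEnd ℂ (j.s p) = j.s p := by
  have hSig : p ∈ Sig c d := (mem_Sig_iff j).2 (Or.inr hp)
  have hl := h.not_mem_band_of_mem_cut_other hp
  rw [h.s_eq_root (Or.inr hSig) hl, h.conj_root_lam hSig hl]

theorem conj_s_of_mem (h : BandGap c d) (hp : p ∈ j.cut c d) :
    starRingEnd ℂ (j.s p) = -j.s p := by
  have hSig : p ∈ Sig c d := (mem_Sig_iff j).2 (Or.inl hp)
  rw [h.s_eq_div hp, map_div₀, map_neg, h.conj_w hSig,
    h.conj_root_lam hSig (h.lam_not_mem_band_other hp), neg_div]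

theorem s_star (h : BandGap c d) (j : Side) (hp : p ∈ Sig c d) :
    j.s p.star = starRingEnd ℂ (j.s p) := by
  rcases (mem_Sig_iff j).1 hp with hj | hj
  · rw [h.conj_s_of_mem hj, h.s_eq_div hj, h.s_eq_div (p := p.star) hj, p.lam_star, p.w_star,
      neg_div]
  · have hl := h.not_mem_band_of_mem_cut_other hj
    rw [h.conj_s_of_mem_other hj, h.s_eq_root (Or.inr hp) hl,
      h.s_eq_root (p := p.star) (Or.inr (star_mem_Sig.2 hp)) hl, p.lam_star]

theorem conj_z (hp : p ∈ Sig c d) :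
    starRingEnd ℂ (j.z p) = (p.lam - (j.center c : ℝ) - starRingEnd ℂ (j.s p)) /
      (2 * (j.amp d : ℝ)) := by
  simp only [j.z_eq, map_div₀, map_sub, map_mul, conj_lam hp, Complex.conj_ofReal, map_ofNat]

theorem z_star (h : BandGap c d) (j : Side) (hp : p ∈ Sig c d) :
    j.z p.star = starRingEnd ℂ (j.z p) := by
  rw [conj_z hp, j.z_eq, h.s_star j hp, p.lam_star]

theorem conj_z_of_mem_other (h : BandGap c d) (hp : p ∈ j.other.cut c d) :
    starRingEnd ℂ (j.z p) = j.z p := by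
  rw [conj_z ((mem_Sig_iff j).2 (Or.inr hp)), h.conj_s_of_mem_other hp, j.z_eq]

theorem conj_z_of_mem (h : BandGap c d) (hp : p ∈ j.cut c d) :
    starRingEnd ℂ (j.z p) = (j.z p)⁻¹ := by
  have hSig : p ∈ Sig c d := (mem_Sig_iff j).2 (Or.inl hp)
  obtain ⟨-, hlam, hs⟩ := h.z_relations j (Or.inr hSig)
  rw [conj_z hSig, h.conj_s_of_mem hp, div_eq_iff (mul_ne_zero two_ne_zero (h.amp_ne_zero j)), hs]
  linear_combination hlam

theorem norm_z_lt (h : BandGap c d) (hp : p ∈ closU c d) (hl : p.lam ∉ j.band c d) :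
    ‖j.z p‖ < 1 := by
  have hz : j.z p = jouk (j.amp d) (j.center c) p.lam := by
    rw [j.z_eq, h.s_eq_root hp hl]
    rfl
  exact hz ▸ norm_jouk_lt_one (h.amp_pos j) hl

theorem norm_z_le (h : BandGap c d) (j : Side) (hp : p ∈ closU c d) : ‖j.z p‖ ≤ 1 := by
  by_cases hj : p ∈ j.cut c d
  · exact (norm_eq_one_of_conj_eq_inv (h.z_ne_zero j hp) (h.conj_z_of_mem hj)).le
  · exact (h.norm_z_lt hp hj).le

end BandGap

theorem tendsto_lam_atInfPlus : Tendsto Curve.lam (atInfPlus c d) (Bornology.cobounded ℂ) :=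
  tendsto_comap.mono_left inf_le_left

theorem eventually_mem_atInfPlus : ∀ᶠ p in atInfPlus c d, p ∈ PiU c d :=
  mem_inf_of_right (mem_principal_self _)

theorem BandGap.tendsto_z_atInfPlus (h : BandGap c d) (j : Side) :
    Tendsto j.z (atInfPlus c d) (𝓝 0) := by
  refine ((tendsto_jouk_cobounded (B := j.center c) (h.amp_pos j)).comp
    tendsto_lam_atInfPlus).congr' ?_
  filter_upwards [eventually_mem_atInfPlus] with p hp
  exact (z_of_mem j hp).symm

/-! ### Wronskians of solutions of the Jacobi equation -/

/-- The Wronskian of two sequences for the off-diagonal coefficients `a`, as in the definition of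
`wronskian`. -/
def wr (a : ℤ → ℝ) (u v : ℤ → ℂ) (n : ℤ) : ℂ :=
  (a (n - 1) : ℂ) * (u (n - 1) * v n - u n * v (n - 1))

section Jacobi

variable {a b : ℤ → ℝ} {lam : ℂ} {u v : ℤ → ℂ}

theorem wr_succ (hu : IsJacobiSolution a b lam u) (hv : IsJacobiSolution a b lam v) (n : ℤ) :
    wr a u v (n + 1) = wr a u v n := by
  simp only [wr, add_sub_cancel_right]
  linear_combination u n * hv n - v n * hu n

theorem wr_const (hu : IsJacobiSolution a b lam u) (hv : IsJacobiSolution a b lam v) (n k : ℤ) :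
    wr a u v n = wr a u v k := by
  have eq_zero : ∀ n, wr a u v n = wr a u v 0 := fun n => by
    induction n using Int.induction_on with
    | zero => rfl
    | succ i ih => rw [wr_succ hu hv, ih]
    | pred i ih => rw [← ih, ← wr_succ hu hv, sub_add_cancel]
  rw [eq_zero n, eq_zero k]

theorem wr_plucker (a : ℤ → ℝ) (u v w : ℤ → ℂ) (n : ℤ) :
    wr a u v n * w n + wr a v w n * u n + wr a w u n * v n = 0 := by
  simp only [wr]
  ring

theorem wr_conj_of_real (a : ℤ → ℝ) {u : ℤ → ℂ}
    (hu : ∀ n, starRingEnd ℂ (u n) = u n) (v : ℤ → ℂ) (n : ℤ) :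
    wr a (fun k => starRingEnd ℂ (v k)) u n = -starRingEnd ℂ (wr a u v n) := by
  simp only [wr, map_mul, map_sub, Complex.conj_ofReal, hu]
  ring

theorem IsJacobiSolution.sub_smul (hu : IsJacobiSolution a b lam u)
    (hv : IsJacobiSolution a b lam v) (k : ℂ) :
    IsJacobiSolution a b lam (fun n => v n - k * u n) := fun n => by
  linear_combination hv n - k * hu n

theorem IsJacobiSolution.conj {x : ℂ} (hx : starRingEnd ℂ x = x) (hu : IsJacobiSolution a b x u) :
    IsJacobiSolution a b x (fun n => starRingEnd ℂ (u n)) := fun n => by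
  simpa [hx] using congrArg (starRingEnd ℂ) (hu n)

theorem IsJacobiSolution.oriented (hu : IsJacobiSolution a b lam u) (j : Side) :
    IsJacobiSolution (a ∘ j.bond) (b ∘ j.site) lam (u ∘ j.site) := by
  cases j
  · intro n
    have := hu (-n)
    simp only [Function.comp_apply, Side.bond, Side.site, show -(n - 1) = -n + 1 by ring,
      show -(n + 1) = -n - 1 by ring, add_sub_cancel_right]
    linear_combination this
  · exact hu

theorem IsJacobiSolution.of_oriented {j : Side}
    (hu : IsJacobiSolution (a ∘ j.bond) (b ∘ j.site) lam (u ∘ j.site)) :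
    IsJacobiSolution a b lam u := by
  cases j
  · simpa [Function.comp_def, Side.bond, Side.site] using hu.oriented .left
  · exact hu

theorem IsJacobiSolution.eq_zero (ha : ∀ n, a n ≠ 0) (hu : IsJacobiSolution a b lam u) {k : ℤ}
    (h0 : u (k - 1) = 0) (h1 : u k = 0) : u = 0 := by
  have ha' : ∀ n, (a n : ℂ) ≠ 0 := fun n => by exact_mod_cast ha n
  have consecutive : ∀ n, u (n - 1) = 0 ∧ u n = 0 := fun n => by
    induction n using Int.inductionOn' (b := k) with
    | zero => exact ⟨h0, h1⟩
    | succ n _ ih =>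
      have e := hu n
      simp only [ih, mul_zero, zero_add, mul_eq_zero, ha', false_or] at e
      exact ⟨by rw [add_sub_cancel_right, ih.2], e⟩
    | pred n _ ih =>
      have e := hu (n - 1)
      rw [sub_add_cancel, ih.1, ih.2] at e
      simp only [mul_zero, add_zero, mul_eq_zero, ha', false_or] at e
      exact ⟨e, ih.1⟩
  exact funext fun n => (consecutive n).2

theorem exists_smul_of_wr_eq_zero (ha : ∀ n, a n ≠ 0) (hu : IsJacobiSolution a b lam u)
    (hv : IsJacobiSolution a b lam v) (hu0 : u ≠ 0) {n : ℤ} (h : wr a u v n = 0) :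
    ∃ k : ℂ, ∀ n, v n = k * u n := by
  obtain ⟨j, hj : u j ≠ 0⟩ := Function.ne_iff.1 hu0
  have ha' : (a (j - 1) : ℂ) ≠ 0 := by exact_mod_cast ha (j - 1)
  have hw : u (j - 1) * v j - u j * v (j - 1) = 0 :=
    (mul_eq_zero.1 ((wr_const hu hv j n).trans h)).resolve_left ha'
  have vanish := (hu.sub_smul hv (v j / u j)).eq_zero ha (k := j)
    (by field_simp; linear_combination -hw) (by field_simp; ring)
  exact ⟨v j / u j, fun n => sub_eq_zero.1 (congrFun vanish n)⟩

/-- The imaginary part of `a(n) u(n+1) conj u(n)`: for `lam.im ≠ 0` it is monotone along a solution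
(Green's identity). -/
def imFlux (a : ℤ → ℝ) (u : ℤ → ℂ) (n : ℤ) : ℝ := a n * (u (n + 1) * starRingEnd ℂ (u n)).im

theorem imFlux_succ_sub (hu : IsJacobiSolution a b lam u) (n : ℤ) :
    imFlux a u (n + 1) - imFlux a u n = lam.im * Complex.normSq (u (n + 1)) := by
  have e := congrArg (fun x => (x * starRingEnd ℂ (u (n + 1))).im) (hu (n + 1))
  simp only [add_sub_cancel_right] at e
  simp only [imFlux, Complex.normSq_apply]
  simp only [Complex.mul_im, Complex.mul_re, Complex.add_im, Complex.add_re, Complex.conj_re,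
    Complex.conj_im, Complex.ofReal_re, Complex.ofReal_im] at e ⊢
  linear_combination e

theorem tendsto_imFlux {M : ℝ} (hM : ∀ n, |a n| ≤ M) {l : Filter ℤ} (h : Tendsto u l (𝓝 0))
    (h' : Tendsto (fun n => u (n + 1)) l (𝓝 0)) : Tendsto (imFlux a u) l (𝓝 0) := by
  have bound : Tendsto (fun n => M * ‖u (n + 1) * starRingEnd ℂ (u n)‖) l (𝓝 0) := by
    simpa [Function.comp_def] using
      ((h'.mul ((Complex.continuous_conj.tendsto _).comp h)).norm).const_mul M
  refine squeeze_zero_norm (fun n => ?_) bound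
  rw [imFlux, Real.norm_eq_abs, abs_mul]
  exact mul_le_mul (hM n) (Complex.abs_im_le_norm _) (abs_nonneg _) ((abs_nonneg _).trans (hM n))

theorem eq_zero_of_monotone_of_tendsto {q : ℤ → ℝ} (hq : Monotone q)
    (htop : Tendsto q atTop (𝓝 0)) (hbot : Tendsto q atBot (𝓝 0)) (n : ℤ) : q n = 0 :=
  le_antisymm (hq.ge_of_tendsto htop n) (hq.le_of_tendsto hbot n)

theorem IsJacobiSolution.eq_zero_of_im (hu : IsJacobiSolution a b lam u) (him : lam.im ≠ 0)
    {M : ℝ} (hM : ∀ n, |a n| ≤ M) (htop : Tendsto u atTop (𝓝 0)) (hbot : Tendsto u atBot (𝓝 0)) :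
    u = 0 := by
  have lim_top := tendsto_imFlux hM htop (htop.comp (tendsto_atTop_add_const_right _ 1 tendsto_id))
  have lim_bot := tendsto_imFlux hM hbot (hbot.comp (tendsto_atBot_add_const_right _ 1 tendsto_id))
  have mono : Monotone fun n => lam.im * imFlux a u n := monotone_int_of_le_succ fun n => by
    rw [← sub_nonneg, ← mul_sub, imFlux_succ_sub hu, ← mul_assoc]
    exact mul_nonneg (mul_self_nonneg _) (Complex.normSq_nonneg _)
  have zero : ∀ n, imFlux a u n = 0 := fun n =>
    (mul_eq_zero.1 (eq_zero_of_monotone_of_tendsto mono (by simpa using lim_top.const_mul lam.im)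
      (by simpa using lim_bot.const_mul lam.im) n)).resolve_left him
  funext n
  have := imFlux_succ_sub hu (n - 1)
  rw [zero, zero, sub_zero, zero_eq_mul, or_iff_right him, sub_add_cancel] at this
  exact Complex.normSq_eq_zero.1 this

end Jacobi

/-! ### Jost solutions at `+∞` -/

theorem tendsto_comp_pred {X : Type*} {f : ℤ → X} {l : Filter X} (hf : Tendsto f atTop l) :
    Tendsto (fun n => f (n - 1)) atTop l :=
  hf.comp (tendsto_atTop_add_const_right _ (-1) tendsto_id)

namespace HasBackground

variable {A B m Q ρ : ℝ} {a b : ℤ → ℝ} {z lam : ℂ} {u v : ℤ → ℂ}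

theorem tendsto_a_pred (h : HasBackground A B m Q ρ a b) :
    Tendsto (fun n => (a (n - 1) : ℂ)) atTop (𝓝 (A : ℂ)) := by
  have hρ := h.rho_pos
  have tendsto_a : Tendsto a atTop (𝓝 A) :=
    tendsto_of_zpow_bound (D := Q) (w := ρ ^ 2) (by positivity)
      (pow_lt_one₀ hρ.le h.rho_lt two_ne_zero) fun n => (h.a_sub n).trans_eq <| by
        rw [← zpow_natCast, ← zpow_natCast, ← zpow_mul, ← zpow_mul, mul_comm n]
  exact tendsto_comp_pred (f := fun n => (a n : ℂ))
    ((Complex.continuous_ofReal.tendsto _).comp tendsto_a)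

theorem isJacobiSolution (h : HasBackground A B m Q ρ a b) (hz : ‖z‖ ≤ 1) (hz0 : z ≠ 0)
    (hl : lam = B + A * (z + z⁻¹)) :
    IsJacobiSolution a b lam (fun n => z ^ n * jostF a b A B n z) := fun n => by
  have e : (a (n - 1) : ℂ) * jostF a b A B (n - 1) z =
      (A * (1 + z ^ 2) - (b n - B) * z) * jostF a b A B n z -
        a n * z ^ 2 * jostF a b A B (n + 1) z := h.normalizedEq_jostF hz n
  have h1 : z ^ n = z ^ (n - 1) * z := by rw [← zpow_add_one₀ hz0, sub_add_cancel]
  have h2 : z ^ (n + 1) = z ^ (n - 1) * z * z := by rw [← h1, zpow_add_one₀ hz0]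
  have h3 : z * z⁻¹ = 1 := mul_inv_cancel₀ hz0
  beta_reduce
  rw [h1, h2, hl]
  linear_combination z ^ (n - 1) * e - z ^ (n - 1) * A * jostF a b A B n z * h3

theorem tendsto_jost (h : HasBackground A B m Q ρ a b) (hz : ‖z‖ ≤ 1) (hz0 : z ≠ 0) :
    Tendsto (fun n : ℤ => z ^ (-n) * (z ^ n * jostF a b A B n z)) atTop (𝓝 1) := by
  refine (h.tendsto_jostF_atTop hz).congr fun n => ?_
  rw [← mul_assoc, ← zpow_add₀ hz0, neg_add_cancel, zpow_zero, one_mul]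

theorem tendsto_wr_of_tendsto (h : HasBackground A B m Q ρ a b) (hz : ‖z‖ ≤ 1) (hz0 : z ≠ 0)
    (hu : Tendsto (fun n : ℤ => z ^ (-n) * u n) atTop (𝓝 1))
    (hv : Tendsto (fun n : ℤ => z ^ (-n) * v n) atTop (𝓝 1)) :
    Tendsto (wr a u v) atTop (𝓝 0) := by
  have h1 := h.tendsto_a_pred.mul
    (((tendsto_comp_pred hu).mul hv).sub (hu.mul (tendsto_comp_pred hv)))
  rw [mul_one, sub_self, mul_zero, tendsto_zero_iff_norm_tendsto_zero] at h1
  refine squeeze_zero_norm' ?_ h1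
  filter_upwards [eventually_ge_atTop 1] with n hn
  have e : z ^ (2 * n - 1) * (z ^ (-(n - 1)) * z ^ (-n)) = 1 := by
    rw [← zpow_add₀ hz0, ← zpow_add₀ hz0,
      show 2 * n - 1 + (-(n - 1) + -n) = 0 by ring, zpow_zero]
  have factor : wr a u v n = z ^ (2 * n - 1) * ((a (n - 1) : ℂ) *
      (z ^ (-(n - 1)) * u (n - 1) * (z ^ (-n) * v n) -
        z ^ (-n) * u n * (z ^ (-(n - 1)) * v (n - 1)))) := by
    simp only [wr]
    linear_combination -((a (n - 1) : ℂ) * (u (n - 1) * v n - u n * v (n - 1))) * e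
  rw [factor, norm_mul, norm_zpow]
  refine mul_le_of_le_one_left (norm_nonneg _) ?_
  lift 2 * n - 1 to ℕ using by omega with k
  simpa using pow_le_one₀ (norm_nonneg z) hz

theorem jost_unique (h : HasBackground A B m Q ρ a b) (hz : ‖z‖ ≤ 1) (hz0 : z ≠ 0)
    (hu : IsJacobiSolution a b lam u) (hv : IsJacobiSolution a b lam v)
    (hu1 : Tendsto (fun n : ℤ => z ^ (-n) * u n) atTop (𝓝 1))
    (hv1 : Tendsto (fun n : ℤ => z ^ (-n) * v n) atTop (𝓝 1)) : v = u := by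
  have wr_zero : wr a u v 0 = 0 := tendsto_nhds_unique
    (tendsto_const_nhds.congr fun n => wr_const hu hv 0 n) (h.tendsto_wr_of_tendsto hz hz0 hu1 hv1)
  have hu0 : u ≠ 0 := by
    rintro rfl
    simp only [Pi.zero_apply, mul_zero] at hu1
    exact zero_ne_one (tendsto_nhds_unique tendsto_const_nhds hu1)
  obtain ⟨k, hk⟩ := exists_smul_of_wr_eq_zero (fun n => (h.a_pos n).ne') hu hv hu0 wr_zero
  have hk1 : k = 1 := by
    have := hu1.const_mul k
    rw [mul_one] at this
    refine tendsto_nhds_unique (this.congr fun n => ?_) hv1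
    rw [hk]; ring
  funext n
  rw [hk, hk1, one_mul]

theorem wr_eq_of_asymptotics (h : HasBackground A B m Q ρ a b) (hz0 : z ≠ 0)
    (hu : IsJacobiSolution a b lam u) (hv : IsJacobiSolution a b lam v)
    (hu1 : Tendsto (fun n : ℤ => z ^ (-n) * u n) atTop (𝓝 1))
    (hv1 : Tendsto (fun n : ℤ => z ^ n * v n) atTop (𝓝 1)) (n : ℤ) :
    wr a u v n = A * (z⁻¹ - z) := by
  have h1 := h.tendsto_a_pred.mul ((((tendsto_comp_pred hu1).mul hv1).const_mul z⁻¹).sub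
    ((hu1.mul (tendsto_comp_pred hv1)).const_mul z))
  simp only [mul_one] at h1
  refine tendsto_nhds_unique (tendsto_const_nhds.congr fun k => ?_) h1
  rw [wr_const hu hv n k, wr]
  have e1 : z⁻¹ * (z ^ (-(k - 1)) * z ^ k) = 1 := by
    rw [← zpow_neg_one, ← zpow_add₀ hz0, ← zpow_add₀ hz0,
      show -1 + (-(k - 1) + k) = 0 by ring, zpow_zero]
  have e2 : z * (z ^ (-k) * z ^ (k - 1)) = 1 := by
    nth_rewrite 1 [← zpow_one z]
    rw [← zpow_add₀ hz0, ← zpow_add₀ hz0, show 1 + (-k + (k - 1)) = 0 by ring, zpow_zero]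
  linear_combination (a (k - 1) : ℂ) * (u k * v (k - 1) * e2 - u (k - 1) * v k * e1)

end HasBackground

/-! ### Jost solutions of steplike Jacobi operators -/

/-- Jacobi coefficients on `ℤ` which converge exponentially fast to the background of each end, the
bands of the two backgrounds being disjoint. -/
structure Steplike (c d : ℝ) (a b : ℤ → ℝ) : Prop where
  gap : BandGap c d
  background : ∀ j : Side, ∃ m Q ρ,
    HasBackground (j.amp d) (j.center c) m Q ρ (a ∘ j.bond) (b ∘ j.site)

namespace Side

variable {c d : ℝ}

/-- The condition that `ψ` is the Jost solution of an end, `IsJost1` or `IsJost2`. -/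
def IsJost (j : Side) (a b : ℤ → ℝ) (p : Curve c d) (ψ : ℤ → ℂ) : Prop :=
  IsJacobiSolution a b p.lam ψ ∧ Tendsto (fun n : ℤ => j.z p ^ (-n) * ψ (j.site n)) atTop (𝓝 1)

/-- The Jost solution `ψ_j(p, ·)` of an end. -/
def jost (a b : ℤ → ℝ) (p : Curve c d) : Side → ℤ → ℂ
  | left => jost1 a b p
  | right => jost2 a b p

/-- The transmission coefficient `T_j` on `clos Π_U`. -/
def T (a b : ℤ → ℝ) : Side → Curve c d → ℂ
  | left => T1 a b
  | right => T2 a b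

/-- The Jost solution `ψ_j(n)` divided by its leading behaviour at the end `j`, as a function of
`z_j`. -/
def normJost (j : Side) (c d : ℝ) (a b : ℤ → ℝ) (n : ℤ) : ℂ → ℂ :=
  jostF (a ∘ j.bond) (b ∘ j.site) (j.amp d) (j.center c) (j.site n)

variable {a b : ℤ → ℝ} {p : Curve c d} {ψ : ℤ → ℂ}

theorem isJost_left_iff : left.IsJost a b p ψ ↔ IsJost1 a b p ψ := by
  refine and_congr_right fun _ => ⟨fun h => ?_, fun h => h.comp tendsto_neg_atTop_atBot⟩
  simpa [Function.comp_def, site, z] using h.comp tendsto_neg_atBot_atTop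

theorem IsJost.ne_zero {j : Side} (h : j.IsJost a b p ψ) : ψ ≠ 0 := by
  rintro rfl
  have := h.2
  simp only [Pi.zero_apply, mul_zero] at this
  exact zero_ne_one (tendsto_nhds_unique tendsto_const_nhds this)

theorem isJost_jost {j : Side} (h : j.IsJost a b p ψ) : j.IsJost a b p (j.jost a b p) := by
  cases j
  · exact isJost_left_iff.2 (Classical.epsilon_spec ⟨ψ, isJost_left_iff.1 h⟩)
  · exact Classical.epsilon_spec (p := IsJost2 a b p) ⟨ψ, h⟩

theorem T_eq (j : Side) (a b : ℤ → ℝ) (p : Curve c d) :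
    j.T a b p = -j.s p / wronskian a b p := by
  cases j <;> rfl

theorem eq_edge_of_s_eq_zero (hg : BandGap c d) (j : Side) (hp : p ∈ closU c d)
    (hs : j.s p = 0) :
    p.lam = -c - 2 * d ∨ p.lam = -c + 2 * d ∨ p.lam = -1 ∨ p.lam = 1 := by
  have hsq := hg.s_sq j hp
  have factor : (p.lam - ((j.center c : ℝ) - 2 * (j.amp d : ℝ))) *
      (p.lam - ((j.center c : ℝ) + 2 * (j.amp d : ℝ))) = 0 := by
    rw [hs] at hsq
    linear_combination -hsq
  have edge := (mul_eq_zero.1 factor).imp sub_eq_zero.1 sub_eq_zero.1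
  cases j
  · simp only [center, amp, Complex.ofReal_neg] at edge
    tauto
  · simp only [center, amp, Complex.ofReal_zero, Complex.ofReal_div, Complex.ofReal_one,
      Complex.ofReal_ofNat, mul_one_div_cancel (two_ne_zero' ℂ), zero_sub, zero_add] at edge
    tauto

end Side

theorem differentiableOn_upperPt {c d : ℝ} {f : Curve c d → ℂ} {g : ℂ → ℂ}
    (hfg : ∀ p ∈ PiU c d, f p = g p.lam)
    (hg : ∀ lam ∉ bands c d, DifferentiableAt ℂ g lam) :
    DifferentiableOn ℂ (fun lam => f (upperPt c d lam)) (bands c d)ᶜ :=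
  DifferentiableOn.congr (fun lam hl => (hg lam hl).differentiableWithinAt)
    fun _ hl => hfg _ (upperPt_mem hl)

namespace BandGap

variable {c d : ℝ} {p : Curve c d}

theorem tendsto_z_zpow (hg : BandGap c d) (j : Side) (hp : p ∈ Sig c d)
    (n : ℤ) : Tendsto (fun q => j.z q ^ n) (𝓝[PiU c d] p) (𝓝 (j.z p ^ n)) :=
  (hg.tendsto_z j hp).zpow₀ n (Or.inl (hg.z_ne_zero j (Or.inr hp)))

theorem differentiableOn_z (hg : BandGap c d) (j : Side) :
    DifferentiableOn ℂ (fun lam => j.z (upperPt c d lam)) (bands c d)ᶜ :=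
  differentiableOn_upperPt (fun _ hp => z_of_mem j hp) fun _ hl =>
    differentiableAt_jouk (hg.amp_pos j) fun h => hl ((mem_bands_iff j).2 (Or.inl h))

theorem differentiableOn_s (hg : BandGap c d) (j : Side) :
    DifferentiableOn ℂ (fun lam => j.s (upperPt c d lam)) (bands c d)ᶜ :=
  differentiableOn_upperPt (fun _ hp => s_of_mem j hp) fun _ hl =>
    differentiableAt_root (hg.amp_pos j) fun h => hl ((mem_bands_iff j).2 (Or.inl h))

theorem differentiableOn_z_zpow (hg : BandGap c d) (j : Side) (n : ℤ) :
    DifferentiableOn ℂ (fun lam => j.z (upperPt c d lam) ^ n) (bands c d)ᶜ :=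
  (hg.differentiableOn_z j).zpow (Or.inl fun _ hl => hg.z_ne_zero j (Or.inl (upperPt_mem hl)))

end BandGap

namespace Steplike

variable {c d : ℝ} {a b : ℤ → ℝ} {p : Curve c d}

theorem a_ne (hs : Steplike c d a b) (n : ℤ) : a n ≠ 0 := by
  obtain ⟨m, Q, ρ, h⟩ := hs.background .right
  exact (h.a_pos n).ne'

theorem norm_z_le (hs : Steplike c d a b) (j : Side) (hp : p ∈ closU c d) : ‖j.z p‖ ≤ 1 :=
  hs.gap.norm_z_le j hp

theorem isJost_normJost (hs : Steplike c d a b) (j : Side) (hp : p ∈ closU c d) :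
    j.IsJost a b p (fun n => j.z p ^ j.site n * j.normJost c d a b n (j.z p)) := by
  obtain ⟨m, Q, ρ, h⟩ := hs.background j
  obtain ⟨hz0, hl, -⟩ := hs.gap.z_relations j hp
  refine ⟨IsJacobiSolution.of_oriented (j := j) ?_, ?_⟩
  · simpa [Function.comp_def, Side.normJost] using
      h.isJacobiSolution (hs.norm_z_le j hp) hz0 hl
  · simpa only [Side.normJost, Side.site_site] using h.tendsto_jost (hs.norm_z_le j hp) hz0

theorem isJost (hs : Steplike c d a b) (j : Side) (hp : p ∈ closU c d) :
    j.IsJost a b p (j.jost a b p) := Side.isJost_jost (hs.isJost_normJost j hp)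

theorem jost_eq (hs : Steplike c d a b) (j : Side) (hp : p ∈ closU c d) (n : ℤ) :
    j.jost a b p n = j.z p ^ j.site n * j.normJost c d a b n (j.z p) := by
  obtain ⟨m, Q, ρ, h⟩ := hs.background j
  have spec := hs.isJost j hp
  have formula := hs.isJost_normJost j hp
  have := congrFun (h.jost_unique (hs.norm_z_le j hp) (hs.gap.z_ne_zero j hp)
    (formula.1.oriented j) (spec.1.oriented j) formula.2 spec.2) (j.site n)
  simpa only [Function.comp_apply, Side.site_site] using this

theorem wronskian_eq_wr (hs : Steplike c d a b) (j : Side) (hp : p ∈ closU c d) (n : ℤ) :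
    wronskian a b p =
      wr (a ∘ j.bond) (j.other.jost a b p ∘ j.site) (j.jost a b p ∘ j.site) n := by
  have const := wr_const ((hs.isJost j.other hp).1.oriented j) ((hs.isJost j hp).1.oriented j) n
  cases j
  · rw [const 1]
    simp only [wr, Function.comp_apply, sub_self, Side.bond, Side.site, Side.jost, Side.other,
      neg_zero, zero_sub, wronskian]
    ring
  · rw [const 0]
    rfl

section Cuts

theorem normJost_conj (hs : Steplike c d a b) (j : Side) {z : ℂ} (hz : ‖z‖ ≤ 1) (n : ℤ) :
    j.normJost c d a b n (starRingEnd ℂ z) = starRingEnd ℂ (j.normJost c d a b n z) := by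
  obtain ⟨m, Q, ρ, h⟩ := hs.background j
  exact h.jostF_conj hz _

theorem jost_star (hs : Steplike c d a b) (j : Side) (hp : p ∈ Sig c d) (n : ℤ) :
    j.jost a b p.star n = starRingEnd ℂ (j.jost a b p n) := by
  rw [hs.jost_eq j (Or.inr hp), hs.jost_eq j (p := p.star) (Or.inr hp), hs.gap.z_star j hp,
    hs.normJost_conj j (hs.norm_z_le j (Or.inr hp)), map_mul, map_zpow₀]

theorem conj_jost_of_mem_other (hs : Steplike c d a b) {j : Side} (hp : p ∈ j.other.cut c d)
    (n : ℤ) : starRingEnd ℂ (j.jost a b p n) = j.jost a b p n := by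
  have hSig : p ∈ Sig c d := (mem_Sig_iff j).2 (Or.inr hp)
  rw [hs.jost_eq j (Or.inr hSig), map_mul, map_zpow₀,
    ← hs.normJost_conj j (hs.norm_z_le j (Or.inr hSig)), hs.gap.conj_z_of_mem_other hp]

theorem wronskian_star (hs : Steplike c d a b) (hp : p ∈ Sig c d) :
    wronskian a b p.star = starRingEnd ℂ (wronskian a b p) := by
  have h1 := hs.jost_star .left hp
  have h2 := hs.jost_star .right hp
  simp only [Side.jost] at h1 h2
  simp only [wronskian, h1, h2, map_mul, map_sub, Complex.conj_ofReal]

theorem T_star (hs : Steplike c d a b) (j : Side) (hp : p ∈ Sig c d) :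
    j.T a b p.star = starRingEnd ℂ (j.T a b p) := by
  rw [Side.T_eq, Side.T_eq, hs.wronskian_star hp, hs.gap.s_star j hp, map_div₀, map_neg]

theorem wronskian_relation (hs : Steplike c d a b) {j : Side} (hp : p ∈ j.cut c d) (n : ℤ) :
    wronskian a b p * starRingEnd ℂ (j.jost a b p n) -
      starRingEnd ℂ (wronskian a b p) * j.jost a b p n = -j.s p * j.other.jost a b p n := by
  have hSig : p ∈ Sig c d := (mem_Sig_iff j).2 (Or.inl hp)
  have hU : p ∈ closU c d := Or.inr hSig
  obtain ⟨m, Q, ρ, h⟩ := hs.background j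
  obtain ⟨hz0, -, hsz⟩ := hs.gap.z_relations j hU
  have own := hs.isJost j hU
  have real : ∀ k, starRingEnd ℂ ((j.other.jost a b p ∘ j.site) k) =
      (j.other.jost a b p ∘ j.site) k := fun k =>
    hs.conj_jost_of_mem_other (j.other_other.symm ▸ hp) _
  have conj_lim : Tendsto (fun n : ℤ => j.z p ^ n * starRingEnd ℂ ((j.jost a b p ∘ j.site) n))
      atTop (𝓝 1) := by
    simpa [Function.comp_def, map_zpow₀, hs.gap.conj_z_of_mem hp] using
      (Complex.continuous_conj.tendsto _).comp own.2
  have wr_conj : wr (a ∘ j.bond) (j.jost a b p ∘ j.site)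
      (fun k => starRingEnd ℂ ((j.jost a b p ∘ j.site) k)) (j.site n) = j.s p :=
    hsz ▸ h.wr_eq_of_asymptotics hz0 (own.1.oriented j)
      ((own.1.oriented j).conj (conj_lam hSig)) own.2 conj_lim _
  have plucker := wr_plucker (a ∘ j.bond) (j.other.jost a b p ∘ j.site) (j.jost a b p ∘ j.site)
    (fun k => starRingEnd ℂ ((j.jost a b p ∘ j.site) k)) (j.site n)
  rw [wr_conj, wr_conj_of_real _ real, ← hs.wronskian_eq_wr j hU] at plucker
  simp only [Function.comp_apply, Side.site_site] at plucker
  linear_combination plucker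

end Cuts

section Regularity

theorem tendsto_normJost (hs : Steplike c d a b) (j : Side) (hp : p ∈ Sig c d) (n : ℤ) :
    Tendsto (fun q => j.normJost c d a b n (j.z q)) (𝓝[PiU c d] p)
      (𝓝 (j.normJost c d a b n (j.z p))) := by
  obtain ⟨m, Q, ρ, h⟩ := hs.background j
  have cont := h.continuousOn_jostF (j.site n) (j.z p)
    (mem_closedBall_zero_iff.2 (hs.norm_z_le j (Or.inr hp)))
  exact cont.tendsto.comp (tendsto_nhdsWithin_iff.2 ⟨hs.gap.tendsto_z j hp,
    eventually_nhdsWithin_of_forall fun q hq =>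
      mem_closedBall_zero_iff.2 (hs.norm_z_le j (Or.inl hq))⟩)

theorem tendsto_jost (hs : Steplike c d a b) (j : Side) (hp : p ∈ Sig c d) (n : ℤ) :
    Tendsto (fun q => j.jost a b q n) (𝓝[PiU c d] p) (𝓝 (j.jost a b p n)) := by
  rw [hs.jost_eq j (Or.inr hp)]
  refine ((hs.gap.tendsto_z_zpow j hp _).mul (hs.tendsto_normJost j hp n)).congr' ?_
  exact eventually_nhdsWithin_of_forall fun q hq => (hs.jost_eq j (Or.inl hq) n).symm

theorem tendsto_wronskian (hs : Steplike c d a b) (hp : p ∈ Sig c d) :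
    Tendsto (wronskian a b) (𝓝[PiU c d] p) (𝓝 (wronskian a b p)) :=
  (((hs.tendsto_jost .left hp (-1)).mul (hs.tendsto_jost .right hp 0)).sub
    ((hs.tendsto_jost .left hp 0).mul (hs.tendsto_jost .right hp (-1)))).const_mul _

theorem tendsto_T (hs : Steplike c d a b) (j : Side) (hp : p ∈ Sig c d)
    (hW : wronskian a b p ≠ 0) : Tendsto (j.T a b) (𝓝[PiU c d] p) (𝓝 (j.T a b p)) := by
  rw [funext (j.T_eq a b)]
  exact (hs.gap.tendsto_s j hp).neg.div (hs.tendsto_wronskian hp) hW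

theorem differentiableOn_jost (hs : Steplike c d a b) (j : Side) (n : ℤ) :
    DifferentiableOn ℂ (fun lam => j.jost a b (upperPt c d lam) n) (bands c d)ᶜ := by
  obtain ⟨m, Q, ρ, h⟩ := hs.background j
  have norm_lt : Set.MapsTo (fun lam => j.z (upperPt c d lam)) (bands c d)ᶜ (Metric.ball 0 1) :=
    fun lam hl => mem_ball_zero_iff.2 (hs.gap.norm_z_lt (Or.inl (upperPt_mem hl))
      (lam_not_mem_band j (upperPt_mem hl)))
  exact ((hs.gap.differentiableOn_z_zpow j (j.site n)).fun_mul
    ((h.differentiableOn_jostF (j.site n)).fun_comp (hs.gap.differentiableOn_z j) norm_lt)).congr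
    fun lam hl => hs.jost_eq j (Or.inl (upperPt_mem hl)) n

theorem differentiableOn_wronskian (hs : Steplike c d a b) :
    DifferentiableOn ℂ (fun lam => wronskian a b (upperPt c d lam)) (bands c d)ᶜ :=
  (((hs.differentiableOn_jost .left (-1)).fun_mul (hs.differentiableOn_jost .right 0)).fun_sub
    ((hs.differentiableOn_jost .left 0).fun_mul (hs.differentiableOn_jost .right (-1)))).const_mul _

theorem differentiableOn_T (hs : Steplike c d a b) (j : Side)
    (hW : ∀ p ∈ PiU c d, wronskian a b p ≠ 0) :
    DifferentiableOn ℂ (fun lam => j.T a b (upperPt c d lam)) (bands c d)ᶜ := by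
  simp only [Side.T_eq]
  exact (hs.gap.differentiableOn_s j).fun_neg.fun_div hs.differentiableOn_wronskian
    fun _ hl => hW _ (upperPt_mem hl)

end Regularity

end Steplike

/-! ### The Wronskian does not vanish -/

section Nonvanishing

variable {c d : ℝ} {a b : ℤ → ℝ} {p : Curve c d}

/-- Exponential decay of a sequence at an end of the lattice. -/
def DecaysAt (j : Side) (u : ℤ → ℂ) : Prop :=
  ∃ K w : ℝ, 0 ≤ w ∧ w < 1 ∧ ∀ᶠ n : ℤ in atTop, ‖u (j.site n)‖ ≤ K * w ^ n

namespace DecaysAt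

variable {j : Side} {u : ℤ → ℂ}

theorem const_mul (h : DecaysAt j u) (k : ℂ) : DecaysAt j (fun n => k * u n) := by
  obtain ⟨K, w, hw, hw1, hu⟩ := h
  refine ⟨‖k‖ * K, w, hw, hw1, hu.mono fun n hn => ?_⟩
  rw [norm_mul, mul_assoc]
  exact mul_le_mul_of_nonneg_left hn (norm_nonneg k)

theorem tendsto (h : DecaysAt j u) : Tendsto (u ∘ j.site) atTop (𝓝 0) := by
  obtain ⟨K, w, hw, hw1, hu⟩ := h
  exact squeeze_zero_norm' hu (by simpa using (tendsto_zpow_atTop_zero hw hw1).const_mul K)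

theorem summable_norm_sq (h : DecaysAt j u) : Summable fun n : ℕ => ‖u (j.site n)‖ ^ 2 := by
  obtain ⟨K, w, hw, hw1, hu⟩ := h
  have geometric : Summable fun n : ℕ => K ^ 2 * (w ^ 2) ^ n :=
    (summable_geometric_of_lt_one (by positivity) (pow_lt_one₀ hw hw1 two_ne_zero)).mul_left _
  refine Summable.of_norm_bounded_eventually_nat geometric ?_
  filter_upwards [tendsto_natCast_atTop_atTop.eventually hu] with n hn
  rw [norm_pow, norm_norm, ← pow_mul, mul_comm 2, pow_mul, ← mul_pow]
  exact pow_le_pow_left₀ (norm_nonneg _) (by simpa using hn) 2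

end DecaysAt

theorem Side.IsJost.decaysAt {j : Side} {ψ : ℤ → ℂ} (h : j.IsJost a b p ψ) (hz0 : j.z p ≠ 0)
    (hz : ‖j.z p‖ < 1) : DecaysAt j ψ := by
  refine ⟨2, ‖j.z p‖, norm_nonneg _, hz, ?_⟩
  filter_upwards [h.2.norm.eventually_le_const (show ‖(1 : ℂ)‖ < 2 by norm_num)] with n hn
  rw [norm_mul, norm_zpow, zpow_neg, inv_mul_le_iff₀ (by positivity)] at hn
  linarith

theorem IsJacobiSolution.eq_zero_of_decaysAt {lam : ℂ} {u : ℤ → ℂ} {M : ℝ}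
    (hu : IsJacobiSolution a b lam u) (hM : ∀ n, |a n| ≤ M)
    (hspec : discreteSpectrum c d a b = ∅) (hl : lam ∉ bands c d)
    (hleft : DecaysAt .left u) (hright : DecaysAt .right u) : u = 0 := by
  by_contra h0
  by_cases him : lam.im = 0
  · have hre : lam = (lam.re : ℂ) := Complex.ext rfl (by simpa using him)
    have square_summable : Summable fun n : ℤ => ‖u n‖ ^ 2 :=
      Summable.of_nat_of_neg hright.summable_norm_sq hleft.summable_norm_sq
    have mem_l2 : Memℓp u 2 := memℓp_gen (by simpa using square_summable)
    have eigenvalue : lam.re ∈ discreteSpectrum c d a b := ⟨hre ▸ hl, u, h0, mem_l2, hre ▸ hu⟩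
    rwa [hspec] at eigenvalue
  · have tendsto_bot := hleft.tendsto.comp tendsto_neg_atBot_atTop
    exact h0 (hu.eq_zero_of_im him hM hright.tendsto
      (by simpa [Function.comp_def, Side.site] using tendsto_bot))

namespace Steplike

theorem wronskian_ne_zero_of_mem_PiU (hs : Steplike c d a b) {M : ℝ} (hM : ∀ n, |a n| ≤ M)
    (hspec : discreteSpectrum c d a b = ∅) (hp : p ∈ PiU c d) : wronskian a b p ≠ 0 := by
  have hU : p ∈ closU c d := Or.inl hp
  have jost := fun j => hs.isJost j hU
  have decays : ∀ j, DecaysAt j (j.jost a b p) := fun j =>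
    (jost j).decaysAt (hs.gap.z_ne_zero j hU) (hs.gap.norm_z_lt hU (lam_not_mem_band j hp))
  intro hW
  obtain ⟨k, hk⟩ := exists_smul_of_wr_eq_zero hs.a_ne (jost .left).1 (jost .right).1
    (jost .left).ne_zero ((hs.wronskian_eq_wr .right hU 0).symm.trans hW)
  exact (jost .right).ne_zero ((jost .right).1.eq_zero_of_decaysAt hM hspec hp.1
    (funext hk ▸ (decays .left).const_mul k) (decays .right))

theorem wronskian_ne_zero_of_mem_cut (hs : Steplike c d a b) (hres : NonResonant c d a b)
    {j : Side} (hp : p ∈ j.cut c d) : wronskian a b p ≠ 0 := by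
  have hU : p ∈ closU c d := Or.inr ((mem_Sig_iff j).2 (Or.inl hp))
  intro hW
  have relation := hs.wronskian_relation hp
  simp only [hW, map_zero, zero_mul, sub_zero, zero_eq_mul, neg_eq_zero] at relation
  obtain ⟨n, hn⟩ := Function.ne_iff.1 (hs.isJost j.other hU).ne_zero
  exact hres p (j.eq_edge_of_s_eq_zero hs.gap hU ((relation n).resolve_right hn)) hW

theorem wronskian_ne_zero (hs : Steplike c d a b) {M : ℝ} (hM : ∀ n, |a n| ≤ M)
    (hspec : discreteSpectrum c d a b = ∅) (hres : NonResonant c d a b) (hp : p ∈ closU c d) :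
    wronskian a b p ≠ 0 := by
  rcases hp with hp | hp
  · exact hs.wronskian_ne_zero_of_mem_PiU hM hspec hp
  · exact ((mem_Sig_iff .left).1 hp).elim (hs.wronskian_ne_zero_of_mem_cut hres)
      (hs.wronskian_ne_zero_of_mem_cut hres)

end Steplike

end Nonvanishing

/-! ### Scattering relations -/

namespace Side

variable {c d : ℝ}

/-- The reflection coefficient `R_j` on `Σ_j`. -/
def R (a b : ℤ → ℝ) : Side → Curve c d → ℂ
  | left => R1 a b
  | right => R2 a b

/-- The entry `-conj (T_j) T_k`, `k ≠ j`, of the jump matrix `v_j` on `Σ_k`. It is `conj χ` for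
`j = 1` and `χ` for `j = 2`. -/
def transfer (j : Side) (a b : ℤ → ℝ) (p : Curve c d) : ℂ :=
  -(starRingEnd ℂ (j.T a b p) * j.other.T a b p)

variable {a b : ℤ → ℝ} {p : Curve c d}

theorem R_spec (j : Side)
    (h : ∃ r, ∀ n, j.T a b p * j.other.jost a b p n =
      starRingEnd ℂ (j.jost a b p n) + r * j.jost a b p n) (n : ℤ) :
    j.T a b p * j.other.jost a b p n =
      starRingEnd ℂ (j.jost a b p n) + j.R a b p * j.jost a b p n := by
  cases j
  · exact Classical.epsilon_spec h n
  · exact Classical.epsilon_spec h n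

end Side

namespace Steplike

variable {c d : ℝ} {a b : ℤ → ℝ} {p : Curve c d} {j : Side}

theorem scattering_relation (hs : Steplike c d a b) (hp : p ∈ j.cut c d)
    (hW : wronskian a b p ≠ 0) (n : ℤ) :
    j.T a b p * j.other.jost a b p n = starRingEnd ℂ (j.jost a b p n) +
      -(starRingEnd ℂ (wronskian a b p) / wronskian a b p) * j.jost a b p n := by
  rw [Side.T_eq]
  field_simp
  linear_combination -hs.wronskian_relation hp n

theorem T_mul_jost (hs : Steplike c d a b) (hp : p ∈ j.cut c d) (hW : wronskian a b p ≠ 0)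
    (n : ℤ) :
    j.T a b p * j.other.jost a b p n =
      starRingEnd ℂ (j.jost a b p n) + j.R a b p * j.jost a b p n :=
  j.R_spec ⟨_, hs.scattering_relation hp hW⟩ n

theorem R_eq (hs : Steplike c d a b) (hp : p ∈ j.cut c d) (hW : wronskian a b p ≠ 0) :
    j.R a b p = -(starRingEnd ℂ (wronskian a b p) / wronskian a b p) := by
  obtain ⟨n, hn⟩ := Function.ne_iff.1 (hs.isJost j (Or.inr ((mem_Sig_iff j).2 (Or.inl hp)))).ne_zero
  exact mul_right_cancel₀ hn (add_left_cancel
    ((hs.T_mul_jost hp hW n).symm.trans (hs.scattering_relation hp hW n)))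

theorem conj_T_mul_R (hs : Steplike c d a b) (hp : p ∈ j.cut c d) (hW : wronskian a b p ≠ 0) :
    starRingEnd ℂ (j.T a b p) * j.R a b p = j.T a b p := by
  have hV := (map_ne_zero (starRingEnd ℂ)).2 hW
  rw [hs.R_eq hp hW, Side.T_eq, map_div₀, map_neg, hs.gap.conj_s_of_mem hp]
  field_simp

theorem conj_T_mul_R_other (hs : Steplike c d a b) (hp : p ∈ j.other.cut c d)
    (hW : wronskian a b p ≠ 0) :
    starRingEnd ℂ (j.T a b p) * j.other.R a b p = -j.T a b p := by
  have hV := (map_ne_zero (starRingEnd ℂ)).2 hW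
  rw [hs.R_eq hp hW, Side.T_eq, map_div₀, map_neg, hs.gap.conj_s_of_mem_other hp]
  field_simp

theorem chi_eq (hs : Steplike c d a b) (hp : p ∈ Sig c d) (hW : wronskian a b p ≠ 0) :
    chi a b p = Side.right.transfer a b p := by
  have := hs.gap.neBot_PiU hp
  rw [Side.transfer, mul_comm]
  exact congrArg Neg.neg (Tendsto.limUnder_eq ((hs.tendsto_T .left hp hW).mul
    ((Complex.continuous_conj.tendsto _).comp (hs.tendsto_T .right hp hW))))

theorem conj_chi_eq (hs : Steplike c d a b) (hp : p ∈ Sig c d) (hW : wronskian a b p ≠ 0) :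
    starRingEnd ℂ (chi a b p) = Side.left.transfer a b p := by
  rw [hs.chi_eq hp hW, Side.transfer, Side.transfer, map_neg, map_mul, Complex.conj_conj, mul_comm]
  rfl

theorem isScatteringData (hs : Steplike c d a b) (hW : ∀ p ∈ closU c d, wronskian a b p ≠ 0) :
    IsScatteringData (c := c) (d := d) a b (jost1 a b) (jost2 a b) (T1 a b) (T2 a b) (R1 a b)
      (R2 a b) where
  jost_left _ hp := Side.isJost_left_iff.1 (hs.isJost .left hp)
  jost_right _ hp := hs.isJost .right hp
  left_relation p hp := hs.T_mul_jost (j := .left) hp (hW p (Or.inr (Or.inl hp)))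
  right_relation p hp :=
    hs.T_mul_jost (j := .right) (Side.cut_right ▸ hp) (hW p (Or.inr (Or.inr hp)))
  left_holomorphic := hs.differentiableOn_T .left fun p hp => hW p (Or.inl hp)
  right_holomorphic := hs.differentiableOn_T .right fun p hp => hW p (Or.inl hp)
  left_boundary p hp := hs.tendsto_T .left hp (hW p (Or.inr hp))
  right_boundary p hp := hs.tendsto_T .right hp (hW p (Or.inr hp))

end Steplike

/-! ### Time evolution of the scattering data -/

/-- A Toda solution which converges exponentially fast to the background of each end, locally
uniformly in time. -/
structure TodaSteplike (c d : ℝ) (a b : ℤ → ℝ → ℝ) : Prop where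
  gap : BandGap c d
  toda : IsTodaSolution a b
  background : ∀ (j : Side) (τ : ℝ), ∃ m Q ρ, ∀ t, |t| ≤ τ →
    HasBackground (j.amp d) (j.center c) m Q ρ ((a · t) ∘ j.bond) ((b · t) ∘ j.site)

/-- The factor `e^{∓ts_j}`, upper sign for `j = 2`, by which the Toda flow changes the scattering
data belonging to the end `j`. -/
def Side.evol {c d : ℝ} (j : Side) (t : ℝ) (p : Curve c d) : ℂ :=
  Complex.exp (-(j.sign * t * j.s p))

section Evol

variable {c d : ℝ} {p : Curve c d} {j : Side}

theorem Side.evol_ne_zero (j : Side) (t : ℝ) (p : Curve c d) : j.evol t p ≠ 0 :=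
  Complex.exp_ne_zero _

theorem BandGap.conj_evol_of_mem (hg : BandGap c d) (hp : p ∈ j.cut c d) (t : ℝ) :
    starRingEnd ℂ (j.evol t p) = (j.evol t p)⁻¹ := by
  rw [Side.evol, ← Complex.exp_conj, ← Complex.exp_neg]
  simp [hg.conj_s_of_mem hp]

theorem BandGap.conj_evol_of_mem_other (hg : BandGap c d) (hp : p ∈ j.other.cut c d) (t : ℝ) :
    starRingEnd ℂ (j.evol t p) = j.evol t p := by
  rw [Side.evol, ← Complex.exp_conj]
  simp [hg.conj_s_of_mem_other hp]

end Evol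

namespace TodaSteplike

variable {c d : ℝ} {a b : ℤ → ℝ → ℝ} {p : Curve c d}

theorem steplike (h : TodaSteplike c d a b) (t : ℝ) : Steplike c d (a · t) (b · t) where
  gap := h.gap
  background j := by
    obtain ⟨m, Q, ρ, hb⟩ := h.background j |t|
    exact ⟨m, Q, ρ, hb t le_rfl⟩

theorem hasDerivAt_normJost (h : TodaSteplike c d a b) (j : Side) {z : ℂ} (hz : ‖z‖ ≤ 1)
    (hz0 : z ≠ 0) (n : ℤ) (t : ℝ) :
    HasDerivAt (fun t => j.normJost c d (a · t) (b · t) n z)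
      (j.sign * laxField (j.amp d) (j.center c) ((a · t) ∘ j.bond) ((b · t) ∘ j.site) z
        (fun k => j.normJost c d (a · t) (b · t) (j.site k) z) (j.site n)) t := by
  obtain ⟨m, Q, ρ, hb⟩ := h.background j (|t| + 1)
  have time_mem : j.sign * t ∈ Set.Ioo (-(|t| + 1)) (|t| + 1) :=
    abs_lt.1 (by simp [abs_mul])
  have oriented := hasDerivAt_jostF (h.toda.oriented j) (fun n t => (h.steplike _).a_ne _)
    isOpen_Ioo (fun s hs => hb (j.sign * s) (by simpa [abs_mul] using (abs_lt.2 hs).le)) hz hz0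
    (j.site n) time_mem
  have reversed := oriented.scomp t ((hasDerivAt_id t).const_mul j.sign)
  simpa [Function.comp_def, ← mul_assoc, Side.normJost] using reversed

theorem hasDerivAt_jost (h : TodaSteplike c d a b) (j : Side) (hp : p ∈ closU c d) (n : ℤ)
    (t : ℝ) :
    HasDerivAt (fun t => j.jost (a · t) (b · t) p n)
      (j.sign * ((p.lam + j.s p - b n t) * j.jost (a · t) (b · t) p n -
        2 * a (j.bond (j.site n - 1)) t *
          j.jost (a · t) (b · t) p (j.site (j.site n - 1)))) t := by
  obtain ⟨hz0, hl, hsz⟩ := h.gap.z_relations j hp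
  have jost_eq : ∀ s k, j.jost (a · s) (b · s) p k =
      j.z p ^ j.site k * j.normJost c d (a · s) (b · s) k (j.z p) := fun s =>
    (h.steplike s).jost_eq j hp
  simp only [jost_eq]
  refine ((h.hasDerivAt_normJost j (h.gap.norm_z_le j hp) hz0 n t).const_mul
    (j.z p ^ j.site n)).congr_deriv ?_
  rw [laxField, hsz, hl]
  simp only [Function.comp_apply, Side.site_site]
  rw [zpow_sub_one₀ hz0]
  linear_combination -(j.z p ^ j.site n) * j.sign * (b n t - j.center c) *
    j.normJost c d (a · t) (b · t) n (j.z p) * (inv_mul_cancel₀ hz0)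

theorem hasDerivAt_wronskian (h : TodaSteplike c d a b) (hp : p ∈ closU c d) (t : ℝ) :
    HasDerivAt (fun t => wronskian (a · t) (b · t) p)
      ((s2 p - s1 p) * wronskian (a · t) (b · t) p) t := by
  have jacobi_left := ((h.steplike t).isJost .left hp).1 0
  have jacobi_right := ((h.steplike t).isJost .right hp).1 (-1)
  have deriv_left := h.hasDerivAt_jost .left hp
  have deriv_right := h.hasDerivAt_jost .right hp
  have product_rule := (h.toda.a_eq (-1) t).ofReal_comp.mul
    (((deriv_left (-1) t).mul (deriv_right 0 t)).sub ((deriv_left 0 t).mul (deriv_right (-1) t)))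
  refine product_rule.congr_deriv ?_
  simp only [wronskian, Side.jost, Side.sign, Side.site, Side.bond, Side.s] at *
  norm_num at jacobi_left jacobi_right ⊢
  linear_combination (-2 * (a (-1) t : ℂ) * jost2 (a · t) (b · t) p (-1)) * jacobi_left +
    (2 * (a (-1) t : ℂ) * jost1 (a · t) (b · t) p 0) * jacobi_right

theorem wronskian_initial (h : TodaSteplike c d a b) (hp : p ∈ closU c d) (t : ℝ) :
    wronskian (a · 0) (b · 0) p =
      wronskian (a · t) (b · t) p * Complex.exp ((s1 p - s2 p) * t) := by
  have deriv_exp : ∀ t : ℝ, HasDerivAt (fun t : ℝ => Complex.exp ((s1 p - s2 p) * t))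
      (Complex.exp ((s1 p - s2 p) * t) * (s1 p - s2 p)) t := fun t => by
    simpa using ((hasDerivAt_id t).ofReal_comp.const_mul (s1 p - s2 p)).cexp
  have deriv_zero : ∀ t : ℝ, HasDerivAt (fun t : ℝ => wronskian (a · t) (b · t) p *
      Complex.exp ((s1 p - s2 p) * t)) 0 t := fun t =>
    ((h.hasDerivAt_wronskian hp t).mul (deriv_exp t)).congr_deriv (by ring)
  simpa using is_const_of_deriv_eq_zero (fun t => (deriv_zero t).differentiableAt)
    (fun t => (deriv_zero t).deriv) 0 t

theorem wronskian_ne_zero (h : TodaSteplike c d a b) (hp : p ∈ closU c d)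
    (hW : wronskian (a · 0) (b · 0) p ≠ 0) (t : ℝ) : wronskian (a · t) (b · t) p ≠ 0 :=
  left_ne_zero_of_mul (h.wronskian_initial hp t ▸ hW)

theorem wronskian_initial_eq_evol (h : TodaSteplike c d a b) (j : Side) (hp : p ∈ closU c d)
    (t : ℝ) :
    wronskian (a · 0) (b · 0) p =
      wronskian (a · t) (b · t) p * (j.evol t p * j.other.evol t p) := by
  rw [h.wronskian_initial hp t, Side.evol, Side.evol, ← Complex.exp_add]
  congr 2
  cases j <;> simp only [Side.sign, Side.s, Side.other] <;> push_cast <;> ring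

theorem T_evol (h : TodaSteplike c d a b) (j k : Side) (hp : p ∈ closU c d) (t : ℝ) :
    k.T (a · t) (b · t) p =
      k.T (a · 0) (b · 0) p * (j.evol t p * j.other.evol t p) := by
  have hE := mul_ne_zero (j.evol_ne_zero t p) (j.other.evol_ne_zero t p)
  rw [Side.T_eq, Side.T_eq, h.wronskian_initial_eq_evol j hp t, ← div_div, div_mul_cancel₀ _ hE]

theorem R_evol (h : TodaSteplike c d a b) {j : Side} (hp : p ∈ j.cut c d)
    (hW : wronskian (a · 0) (b · 0) p ≠ 0) (t : ℝ) :
    j.R (a · t) (b · t) p = j.R (a · 0) (b · 0) p * j.evol t p ^ 2 := by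
  have hU : p ∈ closU c d := Or.inr ((mem_Sig_iff j).2 (Or.inl hp))
  have hWt := h.wronskian_ne_zero hU hW t
  have evol_ne := j.evol_ne_zero t p
  have evol_other_ne := j.other.evol_ne_zero t p
  rw [(h.steplike t).R_eq hp hWt, (h.steplike 0).R_eq hp hW, h.wronskian_initial_eq_evol j hU t,
    map_mul, map_mul, h.gap.conj_evol_of_mem hp,
    h.gap.conj_evol_of_mem_other (j := j.other) (j.other_other.symm ▸ hp)]
  field_simp

theorem transfer_evol (h : TodaSteplike c d a b) {j : Side} (hp : p ∈ j.other.cut c d) (t : ℝ) :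
    j.transfer (a · t) (b · t) p = j.transfer (a · 0) (b · 0) p * j.evol t p ^ 2 := by
  have hU : p ∈ closU c d := Or.inr ((mem_Sig_iff j).2 (Or.inr hp))
  have evol_other_ne := j.other.evol_ne_zero t p
  rw [Side.transfer, Side.transfer, h.T_evol j j hU, h.T_evol j j.other hU, map_mul, map_mul,
    h.gap.conj_evol_of_mem_other hp, h.gap.conj_evol_of_mem hp]
  field_simp

end TodaSteplike

/-! ### Boundary values of the phases -/

/-- The phase `Φ_j`. -/
def Side.Phi {c d : ℝ} (ξ : ℝ) : Side → Curve c d → ℂ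
  | left => Phi1 ξ
  | right => Phi2 ξ

/-- The value of `e^{tΦ_j}`, `ξ = n/t`, on `Π_U` and of its limits from `Π_U` on `Σ`. -/
def Side.expPhase {c d : ℝ} (j : Side) (n : ℤ) (t : ℝ) (p : Curve c d) : ℂ :=
  j.evol t p * j.z p ^ j.site n

namespace BandGap

variable {c d : ℝ} {p : Curve c d} {t : ℝ} {n : ℤ}

theorem exp_Phi (hg : BandGap c d) (j : Side) (ht : t ≠ 0) (hp : p ∈ PiU c d) :
    Complex.exp (t * j.Phi (n / t) p) = j.expPhase n t p := by
  obtain ⟨hz0, -, hs⟩ := hg.z_relations j (Or.inl hp)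
  have ht' : (t : ℂ) ≠ 0 := Complex.ofReal_ne_zero.2 ht
  rw [Side.expPhase, Side.evol, hs, ← Complex.exp_log hz0, ← Complex.exp_int_mul,
    ← Complex.exp_add, Complex.exp_log hz0]
  congr 1
  cases j <;>
    simp only [Side.Phi, Phi1, Phi2, extendOdd, if_pos hp, Side.amp, Side.sign, Side.z,
      Side.site] <;>
    push_cast <;> field_simp <;> ring

theorem exp_Phi_of_mem_PiL (hg : BandGap c d) (j : Side) (ht : t ≠ 0) (hp : p ∈ PiL c d) :
    Complex.exp (t * j.Phi (n / t) p) = (j.expPhase n t p.star)⁻¹ := by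
  rw [← hg.exp_Phi j ht (star_mem_PiU.2 hp), ← Complex.exp_neg]
  cases j <;>
    simp only [Side.Phi, Phi1, Phi2, extendOdd, if_neg (hg.not_mem_PiU_of_mem_PiL hp),
      if_pos (star_mem_PiU.2 hp), mul_neg]

theorem tendsto_expPhase (hg : BandGap c d) (j : Side) (hp : p ∈ Sig c d) :
    Tendsto (j.expPhase n t) (𝓝[PiU c d] p) (𝓝 (j.expPhase n t p)) :=
  ((Complex.continuous_exp.tendsto _).comp ((hg.tendsto_s j hp).const_mul _).neg).mul
    (hg.tendsto_z_zpow j hp _)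

theorem expPlus_Phi (hg : BandGap c d) (j : Side) (ht : t ≠ 0) (hp : p ∈ Sig c d) :
    expPlus t (j.Phi (n / t)) p = j.expPhase n t p := by
  have := hg.neBot_PiU hp
  exact ((hg.tendsto_expPhase j hp).congr'
    (eventually_nhdsWithin_of_forall fun q hq => (hg.exp_Phi j ht hq).symm)).limUnder_eq

theorem expMinus_Phi (hg : BandGap c d) {j : Side} (ht : t ≠ 0) (hp : p ∈ j.other.cut c d) :
    expMinus t (j.Phi (n / t)) p = (j.expPhase n t p)⁻¹ := by
  have hSig : p ∈ Sig c d := (mem_Sig_iff j).2 (Or.inr hp)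
  have := hg.neBot_PiL hSig
  have star_eq : j.expPhase n t p.star = j.expPhase n t p := by
    rw [Side.expPhase, Side.expPhase, Side.evol, Side.evol, hg.s_star j hSig, hg.z_star j hSig,
      hg.conj_s_of_mem_other hp, hg.conj_z_of_mem_other hp]
  have expPhase_ne : j.expPhase n t p ≠ 0 :=
    mul_ne_zero (j.evol_ne_zero t p) (zpow_ne_zero _ (hg.z_ne_zero j (Or.inr hSig)))
  have limit := ((hg.tendsto_expPhase (n := n) (t := t) j (star_mem_Sig.2 hSig)).comp
    (tendsto_star_PiL p)).inv₀ (star_eq.symm ▸ expPhase_ne)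
  rw [star_eq] at limit
  exact (limit.congr' (eventually_nhdsWithin_of_forall fun q hq =>
    (hg.exp_Phi_of_mem_PiL j ht hq).symm)).limUnder_eq

end BandGap

/-! ### The vectors `m_j` -/

namespace Side

variable {c d : ℝ}

/-- The vector `m_j` on `clos Π_U`. -/
def mUpper (j : Side) (a b : ℤ → ℝ) (n : ℤ) (p : Curve c d) : Fin 2 → ℂ :=
  ![j.T a b p * j.other.jost a b p n * j.z p ^ j.site n,
    j.jost a b p n * j.z p ^ (-j.site n)]

/-- The vector `m_j`. -/
def m (a b : ℤ → ℝ) (n : ℤ) : Side → Curve c d → Fin 2 → ℂ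
  | left => m1 a b n
  | right => m2 a b n

/-- The jump matrix `v_j`, for the scattering data of the coefficients `(a₀, b₀)`. -/
def v (a₀ b₀ : ℤ → ℝ) (n : ℤ) (t : ℝ) : Side → Curve c d → Matrix (Fin 2) (Fin 2) ℂ
  | left => v1 a₀ b₀ n t
  | right => v2 a₀ b₀ n t

theorem m_eq (j : Side) (a b : ℤ → ℝ) (n : ℤ) :
    j.m a b n = extendSym (c := c) (d := d) (j.mUpper a b n) := by
  cases j
  · change m1 a b n = extendSym fun p => ![_, jost1 a b p n * z1 p ^ (- -n)]
    rw [neg_neg]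
    rfl
  · rfl

end Side

theorem tendsto_vec_two {α : Type*} {l : Filter α} {f g : α → ℂ} {x y : ℂ}
    (hf : Tendsto f l (𝓝 x)) (hg : Tendsto g l (𝓝 y)) :
    Tendsto (fun q => ![f q, g q]) l (𝓝 ![x, y]) := by
  simpa [tendsto_pi_nhds, Fin.forall_fin_two] using ⟨hf, hg⟩

theorem differentiableOn_vec_two {f g : ℂ → ℂ} {s : Set ℂ} (hf : DifferentiableOn ℂ f s)
    (hg : DifferentiableOn ℂ g s) : DifferentiableOn ℂ (fun q => ![f q, g q]) s := by
  simpa [differentiableOn_pi, Fin.forall_fin_two] using ⟨hf, hg⟩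

namespace Steplike

variable {c d : ℝ} {a b : ℤ → ℝ} {p : Curve c d}

theorem differentiableOn_mUpper (hs : Steplike c d a b) (j : Side)
    (hW : ∀ p ∈ PiU c d, wronskian a b p ≠ 0) (n : ℤ) :
    DifferentiableOn ℂ (fun lam => j.mUpper a b n (upperPt c d lam)) (bands c d)ᶜ :=
  differentiableOn_vec_two
    (((hs.differentiableOn_T j hW).fun_mul (hs.differentiableOn_jost j.other n)).fun_mul
      (hs.gap.differentiableOn_z_zpow j _))
    ((hs.differentiableOn_jost j n).fun_mul (hs.gap.differentiableOn_z_zpow j _))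

theorem tendsto_mUpper (hs : Steplike c d a b) (j : Side) (hp : p ∈ Sig c d)
    (hW : wronskian a b p ≠ 0) (n : ℤ) :
    Tendsto (j.mUpper a b n) (𝓝[PiU c d] p) (𝓝 (j.mUpper a b n p)) :=
  tendsto_vec_two
    (((hs.tendsto_T j hp hW).mul (hs.tendsto_jost j.other hp n)).mul
      (hs.gap.tendsto_z_zpow j hp _))
    ((hs.tendsto_jost j hp n).mul (hs.gap.tendsto_z_zpow j hp _))

theorem mUpper_star (hs : Steplike c d a b) (j : Side) (hp : p ∈ Sig c d) (n : ℤ) :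
    j.mUpper a b n p.star = fun i => starRingEnd ℂ (j.mUpper a b n p i) := by
  ext i
  fin_cases i <;>
    simp [Side.mUpper, hs.T_star j hp, hs.jost_star j hp, hs.jost_star j.other hp,
      hs.gap.z_star j hp]

end Steplike

/-! ### Behaviour at infinity -/

namespace Steplike

variable {c d : ℝ} {a b : ℤ → ℝ}

theorem tendsto_normJost_atInfPlus (hs : Steplike c d a b) (j : Side) (n : ℤ) :
    Tendsto (fun p => j.normJost c d a b n (j.z p)) (atInfPlus c d)
      (𝓝 (j.normJost c d a b n 0)) := by
  obtain ⟨m, Q, ρ, h⟩ := hs.background j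
  have cont := h.continuousOn_jostF (j.site n) 0 (Metric.mem_closedBall_self zero_le_one)
  refine cont.tendsto.comp (tendsto_nhdsWithin_iff.2 ⟨hs.gap.tendsto_z_atInfPlus j, ?_⟩)
  filter_upwards [eventually_mem_atInfPlus] with p hp
  exact mem_closedBall_zero_iff.2 (hs.norm_z_le j (Or.inl hp))

theorem normJost_zero_pos (hs : Steplike c d a b) (j : Side) (n : ℤ) :
    ∃ r : ℝ, 0 < r ∧ j.normJost c d a b n 0 = r := by
  obtain ⟨m, Q, ρ, h⟩ := hs.background j
  exact ⟨_, h.jostF_zero_re_pos (hs.gap.amp_pos j) _, (h.ofReal_re_jostF_zero _).symm⟩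

theorem normJost_zero_pred (hs : Steplike c d a b) (j : Side) (n : ℤ) :
    (a (j.bond (n - 1)) : ℂ) * j.normJost c d a b (j.site (n - 1)) 0 =
      j.amp d * j.normJost c d a b (j.site n) 0 := by
  obtain ⟨m, Q, ρ, h⟩ := hs.background j
  simpa only [Side.normJost, Side.site_site, Function.comp_apply] using h.jostF_zero_pred n

theorem tendsto_wronskian_atInfPlus (hs : Steplike c d a b) (j : Side) (n : ℤ) :
    Tendsto (fun p : Curve c d =>
        wronskian a b p * (j.z p * (j.other.z p / j.z p) ^ j.site n)) (atInfPlus c d)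
      (𝓝 (-(j.amp d * (j.normJost c d a b n 0 * j.other.normJost c d a b n 0)))) := by
  have z_to_zero := hs.gap.tendsto_z_atInfPlus
  have normJost_lim := hs.tendsto_normJost_atInfPlus
  have limit := ((((z_to_zero j.other).mul (z_to_zero j)).mul
    ((normJost_lim j.other (j.site (j.site n - 1))).mul (normJost_lim j n))).sub
    ((normJost_lim j.other n).mul (normJost_lim j (j.site (j.site n - 1))))).const_mul
    (a (j.bond (j.site n - 1)) : ℂ)
  have pred := hs.normJost_zero_pred j (j.site n)
  rw [Side.site_site] at pred
  convert limit.congr' ?_ using 2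
  · linear_combination j.other.normJost c d a b n 0 * pred
  · filter_upwards [eventually_mem_atInfPlus] with p hp
    have hU : p ∈ closU c d := Or.inl hp
    have hz := hs.gap.z_ne_zero j hU
    have hzo := hs.gap.z_ne_zero j.other hU
    rw [hs.wronskian_eq_wr j hU (j.site n), wr]
    simp only [Function.comp_apply, hs.jost_eq j hU, hs.jost_eq j.other hU, Side.site_other,
      Side.site_site, zpow_neg, zpow_sub_one₀ hz, zpow_sub_one₀ hzo, div_zpow]
    field_simp

theorem exists_tendsto_mUpper_atInfPlus (hs : Steplike c d a b) (j : Side) (n : ℤ) :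
    ∃ mhat mtilde : ℝ, Tendsto (j.mUpper a b n) (atInfPlus c d)
      (𝓝 ![(mhat : ℂ), (mtilde : ℂ)]) ∧ mhat * mtilde = 1 ∧ 0 < mhat := by
  obtain ⟨r, hr, normJost_eq⟩ := hs.normJost_zero_pos j n
  obtain ⟨r', hr', normJost_other_eq⟩ := hs.normJost_zero_pos j.other n
  have amp_ne : (j.amp d : ℂ) ≠ 0 := hs.gap.amp_ne_zero j
  have r_ne : (r : ℂ) ≠ 0 := Complex.ofReal_ne_zero.2 hr.ne'
  have r'_ne : (r' : ℂ) ≠ 0 := Complex.ofReal_ne_zero.2 hr'.ne'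
  refine ⟨r⁻¹, r, ?_, inv_mul_cancel₀ hr.ne', inv_pos.2 hr⟩
  have numerator := (((hs.gap.tendsto_z_atInfPlus j).pow 2).const_sub 1).const_mul
    (j.amp d : ℂ) |>.neg.mul (hs.tendsto_normJost_atInfPlus j.other n)
  have first := numerator.div (hs.tendsto_wronskian_atInfPlus j n) (by
    simp [normJost_eq, normJost_other_eq, amp_ne, r_ne, r'_ne])
  convert (tendsto_vec_two first (hs.tendsto_normJost_atInfPlus j n)).congr' ?_ using 3
  · rw [normJost_eq, normJost_other_eq]
    push_cast
    field_simp
    ring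
  · rw [normJost_eq]
  · filter_upwards [eventually_mem_atInfPlus] with p hp
    have hU : p ∈ closU c d := Or.inl hp
    obtain ⟨hz, -, hsz⟩ := hs.gap.z_relations j hU
    have hzo := hs.gap.z_ne_zero j.other hU
    rw [Side.mUpper, Side.T_eq, hsz, hs.jost_eq j hU, hs.jost_eq j.other hU, Side.site_other,
      zpow_neg, zpow_neg]
    congr 1
    · simp only [Pi.div_apply, div_zpow]
      field_simp
    · congr 1
      field_simp

end Steplike

/-! ### The Riemann-Hilbert problems -/

section Extension

variable {c d : ℝ} {f : Curve c d → Fin 2 → ℂ} {p : Curve c d}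

theorem tendsto_extendSym_PiU {x : Fin 2 → ℂ} (h : Tendsto f (𝓝[PiU c d] p) (𝓝 x)) :
    Tendsto (extendSym f) (𝓝[PiU c d] p) (𝓝 x) :=
  h.congr' (eventually_nhdsWithin_of_forall fun _ hq => (if_pos hq).symm)

theorem BandGap.extendSym_of_mem_PiL (hg : BandGap c d) (hp : p ∈ PiL c d) :
    extendSym f p = ![f p.star 1, f p.star 0] := if_neg (hg.not_mem_PiU_of_mem_PiL hp)

theorem BandGap.tendsto_extendSym_PiL (hg : BandGap c d) {y : Fin 2 → ℂ}
    (h : Tendsto f (𝓝[PiU c d] p.star) (𝓝 y)) :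
    Tendsto (extendSym f) (𝓝[PiL c d] p) (𝓝 ![y 1, y 0]) := by
  have limit := tendsto_pi_nhds.1 (h.comp (tendsto_star_PiL p))
  exact (tendsto_vec_two (limit 1) (limit 0)).congr' (eventually_nhdsWithin_of_forall
    fun _ hq => (hg.extendSym_of_mem_PiL hq).symm)

theorem vecMul_two (x y p q r s : ℂ) :
    Matrix.vecMul ![x, y] !![p, q; r, s] = ![x * p + y * r, x * q + y * s] := by
  ext i
  fin_cases i <;> simp [Matrix.vecMul, dotProduct, Fin.sum_univ_two]

theorem BandGap.extendSym_star (hg : BandGap c d) (hp : p ∈ PiU c d ∪ PiL c d) :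
    extendSym f p.star = Matrix.vecMul (extendSym f p) !![0, 1; 1, 0] := by
  rcases hp with hp | hp
  · rw [hg.extendSym_of_mem_PiL (star_mem_PiL.2 hp), Curve.star_star, extendSym, if_pos hp]
    ext i
    fin_cases i <;> simp [Matrix.vecMul, dotProduct, Fin.sum_univ_two]
  · rw [hg.extendSym_of_mem_PiL hp, extendSym, if_pos (star_mem_PiU.2 hp), vecMul_two]
    ext i
    fin_cases i <;> simp

theorem BandGap.solvesRHP_extendSym (hg : BandGap c d)
    {v : Curve c d → Matrix (Fin 2) (Fin 2) ℂ}
    (hol : DifferentiableOn ℂ (fun lam => f (upperPt c d lam)) (bands c d)ᶜ)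
    (hlim : ∀ p ∈ Sig c d, Tendsto f (𝓝[PiU c d] p) (𝓝 (f p)))
    (hjump : ∀ p ∈ Sig c d, f p = Matrix.vecMul ![f p.star 1, f p.star 0] (v p))
    (hinf : ∃ mhat mtilde : ℝ, Tendsto f (atInfPlus c d) (𝓝 ![(mhat : ℂ), (mtilde : ℂ)]) ∧
      mhat * mtilde = 1 ∧ 0 < mhat) :
    SolvesRHP v (extendSym f) where
  holomorphic_upper := hol.congr fun lam hl => if_pos (upperPt_mem hl)
  holomorphic_lower := by
    refine (differentiableOn_vec_two (differentiableOn_pi.1 hol 1)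
      (differentiableOn_pi.1 hol 0)).congr fun lam hl => ?_
    rw [hg.extendSym_of_mem_PiL (star_mem_PiL.2 (upperPt_mem hl)), Curve.star_star]
  jump p hp := ⟨f p, ![f p.star 1, f p.star 0], tendsto_extendSym_PiU (hlim p hp),
    hg.tendsto_extendSym_PiL (hlim p.star (star_mem_Sig.2 hp)), hjump p hp⟩
  symmetry _ hp := hg.extendSym_star hp
  normalization := by
    obtain ⟨x, y, h, hxy⟩ := hinf
    refine ⟨x, y, h.congr' ?_, hxy⟩
    filter_upwards [eventually_mem_atInfPlus] with p hp
    exact (if_pos hp).symm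

end Extension

namespace TodaSteplike

variable {c d : ℝ} {a b : ℤ → ℝ → ℝ} {p : Curve c d} {j : Side} {n : ℤ} {t : ℝ}

theorem v_of_mem (h : TodaSteplike c d a b) (ht : t ≠ 0) (hp : p ∈ j.cut c d) :
    j.v (a · 0) (b · 0) n t p =
      jumpOwn (j.R (a · 0) (b · 0) p) (j.expPhase n t p) := by
  rw [← h.gap.expPlus_Phi j ht ((mem_Sig_iff j).2 (Or.inl hp))]
  cases j
  · exact if_pos hp
  · exact if_pos (Side.cut_right ▸ hp)

theorem v_of_mem_other (h : TodaSteplike c d a b) (ht : t ≠ 0) (hp : p ∈ j.other.cut c d)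
    (hW : wronskian (a · 0) (b · 0) p ≠ 0) :
    j.v (a · 0) (b · 0) n t p =
      jumpOther (j.transfer (a · 0) (b · 0) p) (j.expPhase n t p) (j.expPhase n t p)⁻¹ := by
  have hSig : p ∈ Sig c d := (mem_Sig_iff j).2 (Or.inr hp)
  have not_own := h.gap.not_mem_band_of_mem_cut_other hp
  rw [← h.gap.expMinus_Phi ht hp, ← h.gap.expPlus_Phi j ht hSig]
  cases j
  · rw [← (h.steplike 0).conj_chi_eq hSig hW]
    exact if_neg not_own
  · rw [← (h.steplike 0).chi_eq hSig hW]
    exact if_neg ((Side.cut_right (c := c) (d := d)).symm ▸ not_own)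

theorem jump_of_mem (h : TodaSteplike c d a b) (ht : t ≠ 0) (hp : p ∈ j.cut c d)
    (hW : wronskian (a · 0) (b · 0) p ≠ 0) :
    j.mUpper (a · t) (b · t) n p =
      Matrix.vecMul ![j.mUpper (a · t) (b · t) n p.star 1, j.mUpper (a · t) (b · t) n p.star 0]
        (j.v (a · 0) (b · 0) n t p) := by
  have hs := h.steplike t
  have hSig : p ∈ Sig c d := (mem_Sig_iff j).2 (Or.inl hp)
  have hWt := h.wronskian_ne_zero (Or.inr hSig) hW t
  have scattering := congrArg (starRingEnd ℂ) (hs.T_mul_jost hp hWt n)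
  have conj_T_mul_R := hs.conj_T_mul_R hp hWt
  have evol_ne := j.evol_ne_zero t p
  have zpow_ne : j.z p ^ j.site n ≠ 0 := zpow_ne_zero _ (h.gap.z_ne_zero j (Or.inr hSig))
  have other_real : starRingEnd ℂ (j.other.jost (a · t) (b · t) p n) =
      j.other.jost (a · t) (b · t) p n :=
    hs.conj_jost_of_mem_other (j.other_other.symm ▸ hp) n
  simp only [map_add, map_mul, Complex.conj_conj, other_real, h.R_evol hp hW t, map_pow,
    h.gap.conj_evol_of_mem hp] at scattering conj_T_mul_R
  rw [h.v_of_mem ht hp, hs.mUpper_star j hSig, jumpOwn, vecMul_two, Side.expPhase]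
  simp only [Side.mUpper, Matrix.cons_val_zero, Matrix.cons_val_one, map_mul, map_inv₀,
    zpow_neg, map_zpow₀, h.gap.conj_z_of_mem hp, other_real, inv_zpow, inv_inv]
  congr 1
  · field_simp
    linear_combination -j.other.jost (a · t) (b · t) p n * conj_T_mul_R
  · congr 1
    field_simp at scattering ⊢
    linear_combination -scattering

theorem jump_of_mem_other (h : TodaSteplike c d a b) (ht : t ≠ 0) (hp : p ∈ j.other.cut c d)
    (hW : wronskian (a · 0) (b · 0) p ≠ 0) :
    j.mUpper (a · t) (b · t) n p =
      Matrix.vecMul ![j.mUpper (a · t) (b · t) n p.star 1, j.mUpper (a · t) (b · t) n p.star 0]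
        (j.v (a · 0) (b · 0) n t p) := by
  have hs := h.steplike t
  have hSig : p ∈ Sig c d := (mem_Sig_iff j).2 (Or.inr hp)
  have hWt := h.wronskian_ne_zero (Or.inr hSig) hW t
  have scattering := hs.T_mul_jost hp hWt n
  rw [Side.other_other] at scattering
  have conj_T_mul_R := hs.conj_T_mul_R_other hp hWt
  have transfer_evol := h.transfer_evol hp t
  rw [Side.transfer] at transfer_evol
  have evol_ne := j.evol_ne_zero t p
  have zpow_ne : j.z p ^ j.site n ≠ 0 := zpow_ne_zero _ (h.gap.z_ne_zero j (Or.inr hSig))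
  rw [h.v_of_mem_other ht hp hW, hs.mUpper_star j hSig, jumpOther, vecMul_two, Side.expPhase]
  simp only [Side.mUpper, Matrix.cons_val_zero, Matrix.cons_val_one, map_mul, map_inv₀,
    zpow_neg, map_zpow₀, h.gap.conj_z_of_mem_other hp, hs.conj_jost_of_mem_other hp]
  congr 1
  · field_simp
    linear_combination j.jost (a · t) (b · t) p n * transfer_evol +
      starRingEnd ℂ (j.T (a · t) (b · t) p) * scattering +
      j.other.jost (a · t) (b · t) p n * conj_T_mul_R
  · congr 1
    field_simp
    ring

theorem solvesRHP (h : TodaSteplike c d a b) (j : Side)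
    (hW : ∀ p ∈ closU c d, wronskian (a · 0) (b · 0) p ≠ 0) (n : ℤ) (ht : t ≠ 0) :
    SolvesRHP (c := c) (d := d) (j.v (a · 0) (b · 0) n t) (j.m (a · t) (b · t) n) := by
  have hs := h.steplike t
  have hWt : ∀ p ∈ closU c d, wronskian (a · t) (b · t) p ≠ 0 :=
    fun p hp => h.wronskian_ne_zero hp (hW p hp) t
  rw [j.m_eq]
  refine h.gap.solvesRHP_extendSym (hs.differentiableOn_mUpper j (fun p hp => hWt p (Or.inl hp)) n)
    (fun p hp => hs.tendsto_mUpper j hp (hWt p (Or.inr hp)) n) (fun p hp => ?_)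
    (hs.exists_tendsto_mUpper_atInfPlus j n)
  exact ((mem_Sig_iff j).1 hp).elim (fun hp' => h.jump_of_mem ht hp' (hW p (Or.inr hp)))
    (fun hp' => h.jump_of_mem_other ht hp' (hW p (Or.inr hp)))

end TodaSteplike

end

end TodaShock

theorem theorem2p3_general (c d C : ℝ) (hd : 0 < d) (hcd : 2 * d < c - 1) (hC : 0 < C)
    (a b : ℤ → ℝ → ℝ) (hToda : TodaShock.IsTodaSolution a b)
    (hpos : ∀ n, 0 < a n 0)
    (hdecay : TodaShock.SteplikeDecay c d C (a · 0) (b · 0))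
    (hspec : TodaShock.discreteSpectrum c d (a · 0) (b · 0) = ∅)
    (hres : TodaShock.NonResonant c d (a · 0) (b · 0)) :
    (∀ t : ℝ, TodaShock.IsScatteringData (c := c) (d := d) (a · t) (b · t)
      (TodaShock.jost1 (a · t) (b · t)) (TodaShock.jost2 (a · t) (b · t))
      (TodaShock.T1 (a · t) (b · t)) (TodaShock.T2 (a · t) (b · t))
      (TodaShock.R1 (a · t) (b · t)) (TodaShock.R2 (a · t) (b · t))) ∧
    ∀ (n : ℤ) (t : ℝ), t ≠ 0 →
      TodaShock.SolvesRHP (c := c) (d := d)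
        (TodaShock.v1 (a · 0) (b · 0) n t) (TodaShock.m1 (a · t) (b · t) n) ∧
      TodaShock.SolvesRHP (c := c) (d := d)
        (TodaShock.v2 (a · 0) (b · 0) n t) (TodaShock.m2 (a · t) (b · t) n) := by
  have steplike : TodaShock.TodaSteplike c d a b :=
    ⟨⟨hd, hcd⟩, hToda, hToda.exists_backgrounds hC hd hpos hdecay⟩
  obtain ⟨M, hM⟩ := hToda.bounded 0
  have wronskian_ne : ∀ p ∈ TodaShock.closU c d, TodaShock.wronskian (a · 0) (b · 0) p ≠ 0 :=
    fun _ hp => (steplike.steplike 0).wronskian_ne_zero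
      (fun n => (hM n 0 abs_zero.le).1) hspec hres hp
  exact ⟨fun t => (steplike.steplike t).isScatteringData
      fun p hp => steplike.wronskian_ne_zero hp (wronskian_ne p hp) t,
    fun n _ ht => ⟨steplike.solvesRHP .left wronskian_ne n ht,
      steplike.solvesRHP .right wronskian_ne n ht⟩⟩

theorem theorem2p3 (c d C : ℝ) (hc : 1 < c) (hd : 0 < d) (hcd : 2 * d < c - 1)
    (hC : max (c + 2 * d + Real.sqrt ((c + 2 * d) ^ 2 - 1))
      (1 / (2 * d) * (1 + c + Real.sqrt ((1 + c) ^ 2 - 4 * d ^ 2))) ≤ C)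
    (a b : ℤ → ℝ → ℝ) (hToda : TodaShock.IsTodaSolution a b)
    (hpos : ∀ n, 0 < a n 0)
    (hdecay : TodaShock.SteplikeDecay c d C (fun n => a n 0) (fun n => b n 0))
    (hspec : TodaShock.discreteSpectrum c d (fun n => a n 0) (fun n => b n 0) = ∅)
    (hres : TodaShock.NonResonant c d (fun n => a n 0) (fun n => b n 0)) :
    (∀ t : ℝ, TodaShock.IsScatteringData (c := c) (d := d) (fun k => a k t) (fun k => b k t)
      (TodaShock.jost1 (fun k => a k t) (fun k => b k t))
      (TodaShock.jost2 (fun k => a k t) (fun k => b k t))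
      (TodaShock.T1 (fun k => a k t) (fun k => b k t))
      (TodaShock.T2 (fun k => a k t) (fun k => b k t))
      (TodaShock.R1 (fun k => a k t) (fun k => b k t))
      (TodaShock.R2 (fun k => a k t) (fun k => b k t))) ∧
    ∀ (n : ℤ) (t : ℝ), t ≠ 0 →
      TodaShock.SolvesRHP (c := c) (d := d)
        (TodaShock.v1 (fun k => a k 0) (fun k => b k 0) n t)
        (TodaShock.m1 (fun k => a k t) (fun k => b k t) n) ∧
      TodaShock.SolvesRHP (c := c) (d := d)
        (TodaShock.v2 (fun k => a k 0) (fun k => b k 0) n t)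
        (TodaShock.m2 (fun k => a k t) (fun k => b k t) n) := by
  have hC_pos : 0 < C := by
    linarith [(le_max_left _ _).trans hC, Real.sqrt_nonneg ((c + 2 * d) ^ 2 - 1)]
  exact theorem2p3_general c d C hd hcd hC_pos a b hToda hpos hdecay hspec hres
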